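/- Let $\mathbb{K}$ be any field, let $\ell>1$ be an odd integer, and let $q\in\mathbb{K}$ be a primitive $\ell$-th root of unity. For $n\ge 1$ let $V_n=\mathbb{K}^n$ with basis $e_1,\dots,e_n$, and let $R_n$ be the operator on $V_n\otimes V_n$ with $R_n(e_i\otimes e_j)=e_j\otimes e_i$ if $i<j$, $R_n(e_i\otimes e_i)=q\,e_i\otimes e_i$, and $R_n(e_i\otimes e_j)=(q-q^{-1})\,e_i\otimes e_j+e_j\otimes e_i$ if $i>j$. The Hecke algebra $\mathcal{H}_d$ acts on $V_n^{\otimes d}$, its generator $T_i$ acting as $R_n$ on the factors $i,i+1$. Let $\Gamma^d_q\mathcal{V}$ be the category with objects $V_n^{\otimes d}$ ($n\ge1$) and morphisms the $\mathcal{H}_d$-linear maps. A homogeneous quantum polynomial functor of degree $d$ is a $\mathbb{K}$-linear functor from $\Gamma^d_q\mathcal{V}$ to finite dimensional $\mathbb{K}$-vector spaces; these form an abelian category $\mathcal{P}^d_q$, and $\mathcal{P}_q=\bigoplus_{d\ge 0}\mathcal{P}^d_q$ is the category of quantum polynomial functors. Let $I\in\mathcal{P}_1^1$ be the identity functor $I(n)=V_n$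 (for $q=1$), and let $I^{(1)_q}\in\mathcal{P}_q^{\ell}\subset\mathcal{P}_q$ be its quantum Frobenius twist: $I^{(1)_q}(n)=V_n$, and $I^{(1)_q}$ sends an $\mathcal{H}_\ell$-linear map $f:V_n^{\otimes\ell}\to V_m^{\otimes\ell}$ to the linear map $V_n\to V_m$ whose matrix entry in position $(j,i)$ is the coefficient of $e_j^{\otimes\ell}$ in $f(e_i^{\otimes\ell})$. Then, as a graded $\mathbb{K}$-algebra under the Yoneda product, $\mathrm{Ext}^*_{\mathcal{P}_q}(I^{(1)_q},I^{(1)_q})$ is generated by an element $e$ of degree $2$ with the only relation $e^\ell=0$: $$\mathrm{Ext}^*_{\mathcal{P}_q}(I^{(1)_q},I^{(1)_q})\cong \mathbb{K}[e]/(e^\ell),\qquad \deg e=2 .$$ In particular, $\mathrm{Ext}^{j}_{\mathcal{P}_q}(I^{(1)_q},I^{(1)_q})\cong\mathbb{K}$ if $j=2i$ with $0\le i<\ell$, and it is $0$ for every other $j$. -/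

import Mathlib

open CategoryTheory CategoryTheory.Limits
open scoped DirectSum ZeroObject

set_option linter.unusedVariables false
set_option linter.unusedSimpArgs false

universe t w v u

namespace CategoryTheory.Abelian.Ext

variable {C : Type u} [Category.{v} C] [Abelian C] [HasExt.{w} C] {X : C}

/-- A Yoneda composite does not depend on how its degree is written. -/
theorem yoneda_sigma_congr {a b c c' : ℕ} (x : Ext X X a) (y : Ext X X b)
    (h : a + b = c) (h' : a + b = c') :
    (GradedMonoid.mk c (x.comp y h) : GradedMonoid (fun n : ℕ => Ext X X n)) =
      GradedMonoid.mk c' (x.comp y h') := by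
  obtain rfl : c = c' := h.symm.trans h'
  rfl

/-- The Yoneda product `α * β = α ∘ β` on the graded group `Ext^*(X, X)`. -/
noncomputable instance yonedaGMul : GradedMonoid.GMul (fun n : ℕ => Ext X X n) where
  mul {i j} α β := β.comp α (Nat.add_comm j i)

/-- The unit is the class of the identity in `Ext^0(X, X)`. -/
noncomputable instance yonedaGOne : GradedMonoid.GOne (fun n : ℕ => Ext X X n) where
  one := mk₀ (𝟙 X)

noncomputable instance yonedaGMonoid : GradedMonoid.GMonoid (fun n : ℕ => Ext X X n) where
  one_mul := by
    rintro ⟨i, α⟩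
    refine (yoneda_sigma_congr α (mk₀ (𝟙 X)) _ (add_zero i)).trans ?_
    rw [comp_mk₀_id]
    rfl
  mul_one := by
    rintro ⟨i, α⟩
    refine (yoneda_sigma_congr (mk₀ (𝟙 X)) α _ (zero_add i)).trans ?_
    rw [mk₀_id_comp]
    rfl
  mul_assoc := by
    rintro ⟨i, α⟩ ⟨j, β⟩ ⟨k, γ⟩
    refine (yoneda_sigma_congr γ (β.comp α (Nat.add_comm j i)) _
      (show k + (i + j) = i + (j + k) by omega)).trans ?_
    exact congrArg (GradedMonoid.mk (A := fun n : ℕ => Ext X X n) (i + (j + k)))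
      (comp_assoc γ β α (Nat.add_comm k j) (Nat.add_comm j i) (by omega)).symm

noncomputable instance yonedaGRing : DirectSum.GRing (fun n : ℕ => Ext X X n) where
  mul_zero {_ _} α := zero_comp X _ α _ _
  zero_mul {_ _} β := comp_zero β _ _ _ _
  mul_add {_ _} α β γ := add_comp β γ α _
  add_mul {_ _} α β γ := comp_add γ α β _
  natCast n := n • mk₀ (𝟙 X)
  natCast_zero := zero_smul _ _
  natCast_succ n := succ_nsmul _ _
  intCast n := n • mk₀ (𝟙 X)
  intCast_ofNat n := natCast_zsmul _ _
  intCast_negSucc_ofNat n := negSucc_zsmul _ _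

variable {R : Type t} [CommRing R] [Linear R C]

/-- The `R`-algebra structure on `Ext^*(X, X)` in an `R`-linear abelian category. -/
noncomputable instance yonedaGAlgebra : DirectSum.GAlgebra R (fun n : ℕ => Ext X X n) where
  toFun :=
    { toFun := fun r => r • mk₀ (𝟙 X)
      map_zero' := zero_smul _ _
      map_add' := fun r s => add_smul r s _ }
  map_one := one_smul _ _
  map_mul r s := by
    change GradedMonoid.mk 0 ((r * s) • mk₀ (𝟙 X)) =
      GradedMonoid.mk (0 + 0) ((s • mk₀ (𝟙 X)).comp (r • mk₀ (𝟙 X)) _)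
    simp [mul_smul]
  commutes := by
    rintro r ⟨i, α⟩
    refine (yoneda_sigma_congr α (r • mk₀ (𝟙 X)) _ (add_zero i)).trans ?_
    refine Eq.trans ?_ (yoneda_sigma_congr (r • mk₀ (𝟙 X)) α (zero_add i) _)
    simp
  smul_def := by
    rintro r ⟨i, α⟩
    refine Eq.trans ?_ (yoneda_sigma_congr α (r • mk₀ (𝟙 X)) (add_zero i) _)
    simp only [comp_smul, comp_mk₀_id]
    rfl

end CategoryTheory.Abelian.Ext

/-- The Yoneda algebra `Ext^*(X, X) = ⨁ n, Ext^n(X, X)`, with the Yoneda product. -/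
abbrev YonedaAlgebra {C : Type u} [Category.{v} C] [Abelian C] [HasExt.{w} C] (X : C) : Type w :=
  ⨁ n : ℕ, Abelian.Ext X X n

namespace CatFamily

variable {J : Type w} {C : J → Type u} [∀ i, Category.{v} (C i)]

/-- Morphisms of families are added componentwise. -/
instance piPreadditive [∀ i, Preadditive (C i)] : Preadditive (∀ i, C i) where
  homGroup X Y := inferInstanceAs (AddCommGroup (∀ i, X i ⟶ Y i))
  add_comp X Y Z f f' g := funext fun i => Preadditive.add_comp _ _ _ (f i) (f' i) (g i)
  comp_add X Y Z f g g' := funext fun i => Preadditive.comp_add _ _ _ (f i) (g i) (g' i)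

/-- Morphisms of families are multiplied by scalars componentwise. -/
instance piLinear (R : Type t) [Semiring R] [∀ i, Preadditive (C i)] [∀ i, Linear R (C i)] :
    Linear R (∀ i, C i) where
  homModule X Y := inferInstanceAs (Module R (∀ i, X i ⟶ Y i))
  smul_comp X Y Z r f g := funext fun i => Linear.smul_comp _ _ _ r (f i) (g i)
  comp_smul X Y Z f r g := funext fun i => Linear.comp_smul _ _ _ (f i) r (g i)

theorem isZero_pi {X : ∀ i, C i} (h : ∀ i, IsZero (X i)) : IsZero X where
  unique_to Y := ⟨⟨⟨fun i => (h i).to_ (Y i)⟩, fun f => funext fun i => (h i).eq_of_src _ _⟩⟩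
  unique_from Y := ⟨⟨⟨fun i => (h i).from_ (Y i)⟩, fun f => funext fun i => (h i).eq_of_tgt _ _⟩⟩

theorem isZero_apply [∀ i, HasZeroMorphisms (C i)] {X : ∀ i, C i} (h : IsZero X) (i : J) :
    IsZero (X i) :=
  (IsZero.iff_id_eq_zero _).2
    (congrFun (h.eq_of_src (𝟙 X) (fun j => (0 : X j ⟶ X j))) i)

variable [∀ i, Abelian (C i)]

instance : HasZeroObject (∀ i, C i) := ⟨fun _ => 0, isZero_pi fun _ => isZero_zero _⟩

theorem pi_zero_apply {X Y : ∀ i, C i} (i : J) : (0 : X ⟶ Y) i = 0 := rfl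

/-- Finite products in a product of categories are computed componentwise. -/
instance : HasFiniteProducts (∀ i, C i) where
  out n := ⟨fun F => HasLimit.mk
    { cone :=
        { pt := fun i => limit (F ⋙ Pi.eval C i)
          π :=
            { app := fun j i => limit.π (F ⋙ Pi.eval C i) j
              naturality := fun j j' f => funext fun i =>
                (limit.cone (F ⋙ Pi.eval C i)).π.naturality f } }
      isLimit :=
        { lift := fun s i => limit.lift (F ⋙ Pi.eval C i)
            { pt := s.pt i
              π := { app := fun j => s.π.app j i
                     naturality := fun _ _ f => congrFun (s.π.naturality f) i } }
          fac := fun s j => funext fun i => limit.lift_π _ j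
          uniq := fun s m hm => funext fun i => limit.hom_ext fun j => by
            rw [limit.lift_π]
            exact congrFun (hm j) i } }⟩

/-- Componentwise kernels are kernels. -/
def isLimitKernelFork {X Y Z : ∀ i, C i} (f : X ⟶ Y) (k : Z ⟶ X) (w : k ≫ f = 0)
    (h : ∀ i, IsLimit (KernelFork.ofι (f := f i) (k i) (congrFun w i))) :
    IsLimit (KernelFork.ofι k w) :=
  KernelFork.IsLimit.ofι k w
    (fun g hg i => (h i).lift (KernelFork.ofι (g i) (congrFun hg i)))
    (fun g hg => funext fun i => (h i).fac (KernelFork.ofι (g i) (congrFun hg i))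
      WalkingParallelPair.zero)
    (fun g hg m hm => funext fun i => Fork.IsLimit.hom_ext (h i) (by
      refine (congrFun hm i).trans ?_
      exact ((h i).fac (KernelFork.ofι (g i) (congrFun hg i)) WalkingParallelPair.zero).symm))

/-- Componentwise cokernels are cokernels. -/
def isColimitCokernelCofork {X Y Z : ∀ i, C i} (f : X ⟶ Y) (k : Y ⟶ Z) (w : f ≫ k = 0)
    (h : ∀ i, IsColimit (CokernelCofork.ofπ (f := f i) (k i) (congrFun w i))) :
    IsColimit (CokernelCofork.ofπ k w) :=
  CokernelCofork.IsColimit.ofπ k w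
    (fun g hg i => (h i).desc (CokernelCofork.ofπ (g i) (congrFun hg i)))
    (fun g hg => funext fun i => (h i).fac (CokernelCofork.ofπ (g i) (congrFun hg i))
      WalkingParallelPair.one)
    (fun g hg m hm => funext fun i => Cofork.IsColimit.hom_ext (h i) (by
      refine (congrFun hm i).trans ?_
      exact ((h i).fac (CokernelCofork.ofπ (g i) (congrFun hg i)) WalkingParallelPair.one).symm))

instance : HasKernels (∀ i, C i) where
  has_limit {X Y} f := HasLimit.mk
    ⟨_, isLimitKernelFork f (fun i => kernel.ι (f i)) (funext fun i => kernel.condition (f i))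
      fun i => kernelIsKernel (f i)⟩

instance : HasCokernels (∀ i, C i) where
  has_colimit {X Y} f := HasColimit.mk
    ⟨_, isColimitCokernelCofork f (fun i => cokernel.π (f i))
      (funext fun i => cokernel.condition (f i)) fun i => cokernelIsCokernel (f i)⟩

theorem mono_apply {X Y : ∀ i, C i} (f : X ⟶ Y) [Mono f] (i : J) : Mono (f i) := by
  have h : (fun i => kernel.ι (f i) : (fun i => kernel (f i)) ⟶ X) = 0 := by
    rw [← cancel_mono f, zero_comp]
    exact funext fun i => kernel.condition (f i)
  exact Preadditive.mono_of_kernel_zero (congrFun h i)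

theorem epi_apply {X Y : ∀ i, C i} (f : X ⟶ Y) [Epi f] (i : J) : Epi (f i) := by
  have h : (fun i => cokernel.π (f i) : Y ⟶ (fun i => cokernel (f i))) = 0 := by
    rw [← cancel_epi f, comp_zero]
    exact funext fun i => cokernel.condition (f i)
  exact Preadditive.epi_of_cokernel_zero (congrFun h i)

/-- A product of abelian categories is abelian. -/
noncomputable instance piAbelian : Abelian (∀ i, C i) where
  normalMonoOfMono {X Y} f _ :=
    ⟨{Z := fun i => cokernel (f i)
      g := fun i => cokernel.π (f i)
      w := funext fun i => cokernel.condition (f i)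
      isLimit := isLimitKernelFork _ f _ fun i =>
        haveI := mono_apply f i
        Abelian.monoIsKernelOfCokernel (CokernelCofork.ofπ _ (cokernel.condition (f i))) (cokernelIsCokernel (f i)) }⟩
  normalEpiOfEpi {X Y} f _ :=
    ⟨{W := fun i => kernel (f i)
      g := fun i => kernel.ι (f i)
      w := funext fun i => kernel.condition (f i)
      isColimit := isColimitCokernelCofork _ f _ fun i =>
        haveI := epi_apply f i
        Abelian.epiIsCokernelOfKernel (KernelFork.ofι _ (kernel.condition (f i))) (kernelIsKernel (f i)) }⟩

/-- The families of objects with only finitely many nonzero components. -/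
def finiteSupport (C : J → Type u) [∀ i, Category.{v} (C i)] : ObjectProperty (∀ i, C i) :=
  fun X => {i | ¬ IsZero (X i)}.Finite

instance : (finiteSupport C).ContainsZero where
  exists_zero := ⟨fun _ => 0, isZero_pi fun _ => isZero_zero _, by
    have : {i : J | ¬ IsZero (0 : C i)} = ∅ :=
      Set.eq_empty_of_forall_notMem fun i hi => hi (isZero_zero _)
    change {i : J | ¬ IsZero (0 : C i)}.Finite
    rw [this]; exact Set.finite_empty⟩

instance : (finiteSupport C).IsClosedUnderSubobjects where
  prop_of_mono {X Y} f _ hY := Set.Finite.subset hY fun i hi h0 =>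
    hi (haveI := mono_apply f i; IsZero.of_mono (f i) h0)

instance : (finiteSupport C).IsClosedUnderQuotients where
  prop_of_epi {X Y} f _ hX := Set.Finite.subset hX fun i hi h0 =>
    hi (haveI := epi_apply f i; IsZero.of_epi (f i) h0)

instance : (finiteSupport C).IsClosedUnderFiniteProducts where
  isClosedUnderLimitsOfShape S _ := ⟨by
    rintro X ⟨p⟩
    refine Set.Finite.subset (Set.finite_iUnion fun s : S => p.prop_diag_obj ⟨s⟩) ?_
    intro i hi
    by_contra hc
    simp only [Set.mem_iUnion, Set.mem_ofPred_eq, not_exists, not_not] at hc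
    apply hi
    classical
    let e : X ⟶ X := Function.update (fun j => 𝟙 (X j)) i 0
    have he : e = 𝟙 X := p.isLimit.hom_ext fun s => funext fun j => by
      by_cases hj : j = i
      · subst hj
        exact (hc s.as).eq_of_tgt _ _
      · change e j ≫ (p.π.app s) j = 𝟙 (X j) ≫ (p.π.app s) j
        simp [e, Function.update_of_ne hj]
    have := congrFun he i
    simp only [e, Function.update_self] at this
    exact (IsZero.iff_id_eq_zero _).2 this.symm⟩

/-- The direct sum of a family of categories `C i`: its objects are the families of objects with
only finitely many nonzero components, its morphisms are the families of morphisms. -/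
abbrev DirectSumCat (C : J → Type u) [∀ i, Category.{v} (C i)] := (finiteSupport C).FullSubcategory

/-- The object `X` of `C i`, seen in the direct sum: it is `X` in component `i` and zero in every
other component. -/
noncomputable def single [DecidableEq J] (i : J) (X : C i) : DirectSumCat C where
  obj := Function.update (fun _ => 0) i X
  property := by
    refine Set.Finite.subset (Set.finite_singleton i) fun j hj => ?_
    by_contra hne
    apply hj
    have hne' : j ≠ i := hne
    rw [Function.update_of_ne hne']
    exact isZero_zero _

theorem single_obj_self [DecidableEq J] (i : J) (X : C i) : (single i X).obj i = X :=
  Function.update_self i X (fun _ => 0)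

theorem single_obj_of_ne [DecidableEq J] {i j : J} (h : j ≠ i) (X : C i) :
    (single i X).obj j = 0 :=
  Function.update_of_ne h X (fun _ => 0)

end CatFamily

namespace QPoly
section Comb
variable {K : Type u} [Field K]

theorem sum_pow_card_gt {N : ℕ} (p : K) (B : Finset (Fin N)) :
    ∑ i ∈ B, p ^ (B.filter (i < ·)).card = ∑ t ∈ Finset.range B.card, p ^ t := by
  induction B using Finset.induction_on_min with
  | empty => simp
  | insert a B ha ih =>
    have hn : a ∉ B := fun h => lt_irrefl _ (ha a h)
    rw [Finset.sum_insert hn, Finset.card_insert_of_notMem hn, Finset.sum_range_succ, ← ih, add_comm]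
    congr 1
    · refine Finset.sum_congr rfl fun i hi => ?_
      rw [Finset.filter_insert, if_neg (not_lt.2 (ha i hi).le)]
    · rw [Finset.filter_insert, if_neg (lt_irrefl a), Finset.filter_true_of_mem ha]

theorem insertNth_castSucc_eq {N n : ℕ} (i : Fin N) (m : Fin n) (W : Fin N → Fin n) :
    (Fin.insertNth (α := fun _ => Fin n) i.castSucc m W : Fin (N + 1) → Fin n) =
      (Fin.insertNth (α := fun _ => Fin n) i.succ m W : Fin (N + 1) → Fin n) ∘
        Equiv.swap i.castSucc i.succ := by
  symm
  rw [Fin.eq_insertNth_iff]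
  constructor
  · simp
  · funext s
    simp only [Fin.removeNth, Function.comp]
    by_cases h : s = i
    · subst h
      rw [Fin.succAbove_castSucc_self, Equiv.swap_apply_right]
      rw [← Fin.succAbove_succ_self s, Fin.insertNth_apply_succAbove]
    · have h1 : i.castSucc.succAbove s = i.succ.succAbove s := by
        rcases lt_or_gt_of_ne h with h | h
        · rw [Fin.succAbove_of_castSucc_lt _ _ (by simpa using h),
            Fin.succAbove_of_castSucc_lt _ _ (by
              rw [Fin.lt_def] at h ⊢; simp only [Fin.val_castSucc, Fin.val_succ]; omega)]
        · rw [Fin.succAbove_of_le_castSucc _ _ (by simpa using h.le),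
            Fin.succAbove_of_le_castSucc _ _ (by
              rw [Fin.lt_def] at h
              rw [Fin.le_def]; simp only [Fin.val_castSucc, Fin.val_succ]; omega)]
      rw [Equiv.swap_apply_of_ne_of_ne (Fin.succAbove_ne _ _)
        (by rw [h1]; exact Fin.succAbove_ne _ _), h1, Fin.insertNth_apply_succAbove]

theorem sum_mul_count_eq_zero {N n : ℕ} (p : K)
    (hp : ∑ t ∈ Finset.range (N + 1), p ^ t = 0) (c : (Fin (N + 1) → Fin n) → K)
    (hc : ∀ (i : Fin N) (J : Fin (N + 1) → Fin n), J i.castSucc < J i.succ →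
      c (J ∘ Equiv.swap i.castSucc i.succ) = p * c J)
    (m : Fin n) (hm : ∀ J, c J ≠ 0 → ∀ s, J s ≤ m) :
    ∑ J, c J * ∑ t ∈ Finset.range (Finset.univ.filter (J · = m)).card, p ^ t = 0 := by
  let g : (Fin (N + 1) → Fin n) → Fin (N + 1) → K := fun J i =>
    c J * p ^ (Finset.univ.filter fun s => i < s ∧ J s = m).card
  have h1 : ∀ J, c J * ∑ t ∈ Finset.range (Finset.univ.filter (J · = m)).card, p ^ t =
      ∑ i, if J i = m then g J i else 0 := fun J => by
    rw [← sum_pow_card_gt, Finset.mul_sum, Finset.sum_filter]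
    refine Finset.sum_congr rfl fun i _ => ?_
    simp only [g, Finset.filter_filter, and_comm]
  have h2 : ∀ i : Fin (N + 1), (∑ J, if J i = m then g J i else 0) =
      ∑ W : Fin N → Fin n, g (Fin.insertNth (α := fun _ => Fin n) i m W) i := fun i => by
    rw [← (Fin.insertNthEquiv (fun _ => Fin n) i).sum_comp, Fintype.sum_prod_type]
    simp [Fin.insertNthEquiv]
  simp_rw [h1]
  rw [Finset.sum_comm]
  simp_rw [h2]
  rw [Finset.sum_comm]
  refine Finset.sum_eq_zero fun W _ => ?_
  set G : Fin (N + 1) → K := fun i => g (Fin.insertNth (α := fun _ => Fin n) i m W) i with hG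
  have step : ∀ i : Fin N, G i.castSucc = p * G i.succ := fun i => by
    simp only [hG, g]
    set J : Fin (N + 1) → Fin n := Fin.insertNth (α := fun _ => Fin n) i.succ m W with hJ
    rw [insertNth_castSucc_eq, ← hJ]
    have hJs : J i.succ = m := by simp [hJ]
    have hcount : (Finset.univ.filter fun s => i.castSucc < s ∧
        (J ∘ Equiv.swap i.castSucc i.succ) s = m) =
        (if J i.castSucc = m then {i.succ} else ∅) ∪
          (Finset.univ.filter fun s => i.succ < s ∧ J s = m) := by
      ext s
      simp only [Finset.mem_filter, Finset.mem_univ, true_and, Finset.mem_union, Function.comp]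
      by_cases hs : s = i.succ
      · subst hs
        simp only [Equiv.swap_apply_right, Fin.castSucc_lt_succ, true_and, lt_irrefl, false_and,
          or_false]
        by_cases hJm : J i.castSucc = m
        · rw [if_pos hJm]; exact iff_of_true hJm (Finset.mem_singleton_self _)
        · rw [if_neg hJm]; exact iff_of_false hJm (Finset.notMem_empty _)
      · have hlt : i.castSucc < s ↔ i.succ < s := by
          rw [Fin.castSucc_lt_iff_succ_le, le_iff_lt_or_eq]
          exact or_iff_left fun h => hs h.symm
        have hnot : s ∉ (if J i.castSucc = m then ({i.succ} : Finset (Fin (N + 1))) else ∅) := by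
          split_ifs <;> simp [hs]
        rw [hlt, or_iff_right hnot]
        refine and_congr_right fun h => ?_
        rw [Equiv.swap_apply_of_ne_of_ne ?_ hs]
        exact ((Fin.castSucc_lt_succ (i := i)).trans h).ne'
    have hdisj : Disjoint (if J i.castSucc = m then ({i.succ} : Finset (Fin (N + 1))) else ∅)
        (Finset.univ.filter fun s => i.succ < s ∧ J s = m) := by
      split_ifs <;> simp
    rw [hcount, Finset.card_union_of_disjoint hdisj]
    rcases lt_trichotomy (J i.castSucc) m with h | h | h
    · rw [hc i J (by rw [hJs]; exact h), if_neg h.ne, Finset.card_empty, zero_add, mul_assoc]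
    · have : J ∘ Equiv.swap i.castSucc i.succ = J := by
        rw [← Function.comp_id J, Function.comp_assoc]
        funext s
        simp only [Function.comp, id]
        rcases eq_or_ne s i.castSucc with rfl | h1
        · rw [Equiv.swap_apply_left, h, hJs]
        rcases eq_or_ne s i.succ with rfl | h2
        · rw [Equiv.swap_apply_right, h, hJs]
        rw [Equiv.swap_apply_of_ne_of_ne h1 h2]
      rw [this, if_pos h, Finset.card_singleton, pow_add, pow_one]
      ring
    · have e1 : c J = 0 := by
        by_contra hne
        exact absurd (hm J hne i.castSucc) (not_le.2 h)
      have e2 : c (J ∘ Equiv.swap i.castSucc i.succ) = 0 := by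
        by_contra hne
        have := hm _ hne i.succ
        simp only [Function.comp, Equiv.swap_apply_right] at this
        exact absurd this (not_le.2 h)
      rw [e1, e2]; ring
  have hpow : ∀ i : Fin (N + 1), G i = p ^ (N - (i : ℕ)) * G (Fin.last N) := fun i => by
    induction i using Fin.reverseInduction with
    | last => simp
    | cast i ih =>
      rw [step, ih, ← mul_assoc, ← pow_succ']
      congr 2
      simp only [Fin.val_succ, Fin.val_castSucc]
      omega
  change ∑ i, G i = 0
  rw [Finset.sum_congr rfl fun i _ => hpow i, ← Finset.sum_mul]
  rw [Fin.sum_univ_eq_sum_range (fun i => p ^ (N - i)) (N + 1)]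
  rw [← Finset.sum_range_reflect] at hp
  simp only [Nat.add_sub_cancel] at hp
  rw [show ∑ i ∈ Finset.range (N + 1), p ^ (N - i) = 0 from hp, zero_mul]

theorem count_swap {N n : ℕ} (J : Fin N → Fin n) (a b : Fin N) (m : Fin n) :
    (Finset.univ.filter ((J ∘ Equiv.swap a b) · = m)).card =
      (Finset.univ.filter (J · = m)).card :=
  Finset.card_bijective (Equiv.swap a b) (Equiv.bijective _) (by simp)

/-- Vanishing of quantum multinomial coefficients at a root of unity: if each sorting transposition
multiplies `c` by `p`, then only the constant words contribute to the sum of `c`. -/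
theorem sum_eq_sum_const {N n : ℕ} (p : K) (hp : ∑ t ∈ Finset.range (N + 1), p ^ t = 0)
    (hp' : ∀ k, 0 < k → k < N + 1 → ∑ t ∈ Finset.range k, p ^ t ≠ 0)
    (c : (Fin (N + 1) → Fin n) → K)
    (hc : ∀ (i : Fin N) (J : Fin (N + 1) → Fin n), J i.castSucc < J i.succ →
      c (J ∘ Equiv.swap i.castSucc i.succ) = p * c J) :
    ∑ J, c J = ∑ x : Fin n, c (fun _ => x) := by
  classical
  let cnt : (Fin (N + 1) → Fin n) → Fin n → ℕ := fun J m => (Finset.univ.filter (J · = m)).card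
  let P : Fin n → (Fin (N + 1) → Fin n) → Prop := fun m J =>
    (∀ s, J s ≤ m) ∧ 0 < cnt J m
  have hPswap : ∀ m J a b, P m (J ∘ Equiv.swap a b) ↔ P m J := fun m J a b => by
    refine and_congr ?_ ?_
    · exact (Equiv.swap a b).surjective.forall (p := fun s => J s ≤ m) |>.symm
    · simp only [cnt, count_swap]
  have key : ∀ m, ∑ J, (if P m J ∧ cnt J m < N + 1 then c J else 0) = 0 := fun m => by
    refine Eq.trans ?_ (sum_mul_count_eq_zero p hp (fun J => if P m J ∧ cnt J m < N + 1 then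
      c J / ∑ t ∈ Finset.range (cnt J m), p ^ t else 0) ?_ m ?_)
    · refine Finset.sum_congr rfl fun J _ => ?_
      split_ifs with h
      · exact (div_mul_cancel₀ _ (hp' _ h.1.2 h.2)).symm
      · rw [zero_mul]
    · intro i J hJ
      simp only [hPswap, cnt, count_swap, hc i J hJ]
      split_ifs
      · rw [mul_div_assoc]
      · rw [mul_zero]
    · intro J hJ
      by_contra hcon
      exact hJ (if_neg fun h => hcon h.1.1)
  have hex : ∀ J : Fin (N + 1) → Fin n, ∃! m, P m J := fun J => by
    obtain ⟨s, -, hs⟩ := Finset.exists_max_image Finset.univ J ⟨0, Finset.mem_univ _⟩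
    refine ⟨J s, ⟨fun t => hs t (Finset.mem_univ _), Finset.card_pos.2 ⟨s, by simp⟩⟩, ?_⟩
    rintro m ⟨h1, h2⟩
    obtain ⟨t, ht⟩ := Finset.card_pos.1 h2
    simp only [Finset.mem_filter, Finset.mem_univ, true_and] at ht
    exact le_antisymm (ht ▸ hs t (Finset.mem_univ _)) (h1 s)
  have hsplit : ∀ J, c J = ∑ m, if P m J then c J else 0 := fun J => by
    obtain ⟨m, hm, hu⟩ := hex J
    rw [Finset.sum_eq_single m, if_pos hm]
    · exact fun m' _ hne => if_neg fun h => hne (hu m' h)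
    · exact fun h => absurd (Finset.mem_univ _) h
  rw [Finset.sum_congr rfl fun J _ => hsplit J, Finset.sum_comm]
  refine Finset.sum_congr rfl fun m _ => ?_
  have hfull : ∀ J, P m J ∧ ¬ cnt J m < N + 1 ↔ J = fun _ => m := fun J => by
    constructor
    · rintro ⟨-, h⟩
      have hcard : cnt J m = (Finset.univ : Finset (Fin (N + 1))).card :=
        le_antisymm (Finset.card_le_univ _) (by simpa using h)
      have := Finset.filter_card_eq hcard
      exact funext fun s => this s (Finset.mem_univ _)
    · rintro rfl
      refine ⟨⟨fun _ => le_rfl, ?_⟩, ?_⟩ <;> simp [cnt]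
  calc ∑ J, (if P m J then c J else 0)
      = ∑ J, ((if P m J ∧ cnt J m < N + 1 then c J else 0) +
          (if J = fun _ => m then c J else 0)) := by
        refine Finset.sum_congr rfl fun J _ => ?_
        simp only [← hfull]
        by_cases h1 : P m J <;> by_cases h2 : cnt J m < N + 1 <;> simp [h1, h2]
    _ = c (fun _ => m) := by
        rw [Finset.sum_add_distrib, key, zero_add]
        simp
end Comb

/-- The tensor power `V_n^{⊗ d}` of `V_n = K^n`, written in its basis of the tensors
`e_I = e_{I 0} ⊗ ⋯ ⊗ e_{I (d - 1)}` for `I : Fin d → Fin n`. The basis vector `e_I` is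
`Pi.single I 1`, and `v I` is the coordinate of `v` at `e_I`. -/
abbrev Tens (K : Type u) [Field K] (n d : ℕ) : Type u := (Fin d → Fin n) → K

section Hecke
variable {K : Type u} [Field K]

/-- The action of a generator of the Hecke algebra `H_d` on `V_n^{⊗ d}`: the Yang-Baxter operator
`R_n` applied to the tensor factors in the (zero-based) positions `i` and `i + 1`, where
`R_n (e_x ⊗ e_y)` is `e_y ⊗ e_x` for `x < y`, `q e_x ⊗ e_x` for `x = y`, and
`(q - q⁻¹) e_x ⊗ e_y + e_y ⊗ e_x` for `x > y`. -/
noncomputable def heckeOp (q : K) (n d : ℕ) (i : ℕ) (hi : i + 1 < d) :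
    Tens K n d →ₗ[K] Tens K n d :=
  Fintype.linearCombination K fun I : Fin d → Fin n =>
    let a : Fin d := ⟨i, Nat.lt_of_succ_lt hi⟩
    let b : Fin d := ⟨i + 1, hi⟩
    if I a < I b then Pi.single (I ∘ Equiv.swap a b) 1
    else if I a = I b then Pi.single I q
    else Pi.single I (q - q⁻¹) + Pi.single (I ∘ Equiv.swap a b) 1

/-- The rectangular `q`-Schur bimodule `S_q(n, m; d)`: the space of all `H_d`-linear maps
`V_n^{⊗ d} → V_m^{⊗ d}`, i.e. of the linear maps that commute with the generators of `H_d`. -/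
def schur (q : K) (n m d : ℕ) : Submodule K (Tens K n d →ₗ[K] Tens K m d) where
  carrier := {f | ∀ (i : ℕ) (hi : i + 1 < d), f ∘ₗ heckeOp q n d i hi = heckeOp q m d i hi ∘ₗ f}
  add_mem' hf hg i hi := by
    rw [LinearMap.add_comp, LinearMap.comp_add, hf i hi, hg i hi]
  zero_mem' i hi := by rw [LinearMap.zero_comp, LinearMap.comp_zero]
  smul_mem' c f hf i hi := by rw [LinearMap.smul_comp, LinearMap.comp_smul, hf i hi]

end Hecke

/-- The source category of quantum polynomial functors of degree `d`. Its objects are the spaces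
`V_n^{⊗ d}` with `n ≥ 1`, its morphisms are the `H_d`-linear maps. -/
structure Src (K : Type u) [Field K] (q : K) (d : ℕ) : Type where
  /-- The index `n` of the object `V_n^{⊗ d}`. -/
  n : ℕ
  one_le : 1 ≤ n

variable {K : Type u} [Field K] {q : K} {d : ℕ}

instance : Category.{u} (Src K q d) where
  Hom X Y := schur q X.n Y.n d
  id X := ⟨LinearMap.id, fun _ _ => rfl⟩
  comp f g := ⟨g.1 ∘ₗ f.1, fun i hi => by
    rw [LinearMap.comp_assoc, f.2 i hi, ← LinearMap.comp_assoc, g.2 i hi, LinearMap.comp_assoc]⟩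

instance : Preadditive (Src K q d) where
  homGroup X Y := inferInstanceAs (AddCommGroup (schur q X.n Y.n d))
  add_comp X Y Z f f' g := Subtype.ext (LinearMap.ext fun x => map_add g.1 (f.1 x) (f'.1 x))
  comp_add X Y Z f g g' := Subtype.ext (LinearMap.ext fun x => rfl)

instance : Linear K (Src K q d) where
  homModule X Y := inferInstanceAs (Module K (schur q X.n Y.n d))
  smul_comp X Y Z r f g := Subtype.ext (LinearMap.comp_smul g.1 r f.1)
  comp_smul X Y Z f r g := Subtype.ext (LinearMap.smul_comp r g.1 f.1)

/-- The `K`-linear functors from the source category to finite dimensional vector spaces. -/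
def isLinear (K : Type u) [Field K] (q : K) (d : ℕ) :
    ObjectProperty (Src K q d ⥤ FGModuleCat.{u} K) :=
  fun F => F.Additive ∧ F.Linear K

instance : (isLinear K q d).IsClosedUnderSubobjects where
  prop_of_mono {F G} ι _ hG := by
    obtain ⟨hA, hL⟩ := hG
    refine ⟨⟨fun {X Y f g} => ?_⟩, ⟨fun {X Y} f r => ?_⟩⟩
    · rw [← cancel_mono (ι.app Y)]
      simp only [Preadditive.add_comp, NatTrans.naturality, Functor.map_add, Preadditive.comp_add]
    · rw [← cancel_mono (ι.app Y)]
      simp only [Linear.smul_comp, NatTrans.naturality, Functor.map_smul, Linear.comp_smul]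

instance : (isLinear K q d).IsClosedUnderQuotients where
  prop_of_epi {F G} π _ hF := by
    obtain ⟨hA, hL⟩ := hF
    refine ⟨⟨fun {X Y f g} => ?_⟩, ⟨fun {X Y} f r => ?_⟩⟩
    · rw [← cancel_epi (π.app X)]
      simp only [Preadditive.add_comp, ← NatTrans.naturality, Functor.map_add, Preadditive.comp_add]
    · rw [← cancel_epi (π.app X)]
      simp only [Linear.smul_comp, ← NatTrans.naturality, Functor.map_smul, Linear.comp_smul]

instance : (isLinear K q d).ContainsZero where
  exists_zero := by
    have h0 := isZero_zero (Src K q d ⥤ FGModuleCat.{u} K)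
    refine ⟨_, h0, ⟨⟨fun {X Y f g} => ?_⟩, ⟨fun {X Y} f r => ?_⟩⟩⟩
    · exact (h0.obj X).eq_of_src _ _
    · exact (h0.obj X).eq_of_src _ _

instance : (isLinear K q d).IsClosedUnderFiniteProducts where
  isClosedUnderLimitsOfShape S _ := ⟨by
    rintro F ⟨p⟩
    have key : ∀ {X Y : Src K q d} {a b : F.obj X ⟶ F.obj Y},
        (∀ s, a ≫ (p.π.app s).app Y = b ≫ (p.π.app s).app Y) → a = b := fun {X Y a b} h =>
      (isLimitOfPreserves ((evaluation _ _).obj Y) p.isLimit).hom_ext h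
    refine ⟨⟨fun {X Y f g} => key fun s => ?_⟩, ⟨fun {X Y} f r => key fun s => ?_⟩⟩
    · have := (p.prop_diag_obj s).1
      have h := (p.π.app s).naturality
      simp only [Functor.const_obj_obj] at h
      simp only [Preadditive.add_comp, h, Functor.map_add, Preadditive.comp_add]
    · have := (p.prop_diag_obj s).1
      have := (p.prop_diag_obj s).2
      have h := (p.π.app s).naturality
      simp only [Functor.const_obj_obj] at h
      simp only [Linear.smul_comp, h, Functor.map_smul, Linear.comp_smul]⟩

/-- The category of homogeneous quantum polynomial functors of degree `d`: the full subcategory of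
the `K`-linear functors, with all natural transformations. -/
abbrev HQF (K : Type u) [Field K] (q : K) (d : ℕ) := (isLinear K q d).FullSubcategory


/-- The identity functor `I`, homogeneous of degree `1`: `I(n) = V_n` and `I(f) = f`. -/
noncomputable def I (K : Type u) [Field K] (q : K) : HQF K q 1 where
  obj :=
    { obj := fun X => FGModuleCat.of K (Tens K X.n 1)
      map := fun f => FGModuleCat.ofHom f.1
      map_id := fun X => rfl
      map_comp := fun f g => rfl }
  property := ⟨⟨rfl⟩, ⟨fun _ _ => rfl⟩⟩

section Frobenius

variable {n m r : ℕ}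

/-- The action of `T_{i+1}` in coordinates. -/
theorem heckeOp_apply (i : ℕ) (hi : i + 1 < d) (v : Tens K n d) (J : Fin d → Fin n) :
    heckeOp q n d i hi v J =
      if J ⟨i, Nat.lt_of_succ_lt hi⟩ < J ⟨i + 1, hi⟩ then
        v (J ∘ Equiv.swap ⟨i, Nat.lt_of_succ_lt hi⟩ ⟨i + 1, hi⟩)
      else if J ⟨i, Nat.lt_of_succ_lt hi⟩ = J ⟨i + 1, hi⟩ then q * v J
      else (q - q⁻¹) * v J + v (J ∘ Equiv.swap ⟨i, Nat.lt_of_succ_lt hi⟩ ⟨i + 1, hi⟩) := by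
  set a : Fin d := ⟨i, Nat.lt_of_succ_lt hi⟩ with ha
  set b : Fin d := ⟨i + 1, hi⟩ with hb
  have hinv : ∀ I : Fin d → Fin n, J = I ∘ Equiv.swap a b ↔ I = J ∘ Equiv.swap a b := fun I => by
    constructor <;> rintro rfl <;> funext s <;> simp
  have key : ∀ I : Fin d → Fin n, v I * (if I a < I b then
        (Pi.single (I ∘ Equiv.swap a b) 1 : Tens K n d)
      else if I a = I b then Pi.single I q
      else Pi.single I (q - q⁻¹) + Pi.single (I ∘ Equiv.swap a b) 1) J =
      (if I = J ∘ Equiv.swap a b then (if J a = J b then 0 else v I) else 0) +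
      (if I = J then (if J a < J b then 0 else if J a = J b then q * v I
        else (q - q⁻¹) * v I) else 0) := fun I => by
    by_cases h1 : I = J
    · subst h1
      rcases lt_trichotomy (I a) (I b) with h | h | h
      · have : I ≠ I ∘ Equiv.swap a b := fun e => h.ne (by
          conv_lhs => rw [e]
          simp)
        simp [h, h.ne, Pi.single_apply, this]
      · simp [h, Pi.single_apply, mul_comm]
      · have : I ≠ I ∘ Equiv.swap a b := fun e => h.ne (by
          conv_rhs => rw [e]
          simp)
        simp [h.ne', not_lt.2 h.le, Pi.single_apply, this, mul_comm]
    · by_cases h2 : I = J ∘ Equiv.swap a b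
      · have h3 := (hinv I).2 h2
        have e1 : J a = I b := by rw [h3]; simp
        have e2 : J b = I a := by rw [h3]; simp
        rw [if_neg h1, if_pos h2, e1, e2]
        have h1' : ¬ J = I := fun h => h1 h.symm
        rcases lt_trichotomy (I a) (I b) with h | h | h
        · simp [h, h.ne', Pi.single_apply, ← h3]
        · simp [h, Pi.single_apply, h1']
        · simp [h.ne, h.ne', not_lt.2 h.le, Pi.single_apply, ← h3, h1']
      · have h1' : ¬ J = I := fun h => h1 h.symm
        have h2' : ¬ J = I ∘ Equiv.swap a b := fun h => h2 ((hinv I).1 h)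
        rw [if_neg h1, if_neg h2]
        split_ifs <;> simp [Pi.single_apply, h1', h2']
  rw [heckeOp, Fintype.linearCombination_apply, Finset.sum_apply]
  simp only [Pi.smul_apply, smul_eq_mul, ← ha, ← hb]
  rw [Finset.sum_congr rfl fun I _ => key I, Finset.sum_add_distrib]
  simp only [Finset.sum_ite_eq', Finset.sum_ite_eq, Finset.mem_univ, if_true]
  rcases lt_trichotomy (J a) (J b) with h | h | h
  · simp [h, h.ne]
  · simp [h]
  · simp [h.ne', not_lt.2 h.le, add_comm]

/-- The linear map `V_n → V_n^{⊗ ℓ}`, `e_x ↦ e_x ⊗ ⋯ ⊗ e_x`. -/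
noncomputable def powIncl (K : Type u) [Field K] (n ℓ : ℕ) : Tens K n 1 →ₗ[K] Tens K n ℓ :=
  Fintype.linearCombination K fun I : Fin 1 → Fin n => Pi.single (fun _ => I 0) 1

/-- The linear map `V_n^{⊗ ℓ} → V_n` that sends `e_x ⊗ ⋯ ⊗ e_x` to `e_x` and every other basis
tensor to `0`. -/
def powProj (K : Type u) [Field K] (n ℓ : ℕ) : Tens K n ℓ →ₗ[K] Tens K n 1 :=
  LinearMap.funLeft K K fun (I : Fin 1 → Fin n) _ => I 0

theorem powIncl_single (ℓ : ℕ) (I : Fin 1 → Fin n) :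
    powIncl K n ℓ (Pi.single I 1) = Pi.single (fun _ => I 0) 1 := by
  rw [powIncl, Fintype.linearCombination_apply_single, one_smul]

theorem powProj_comp_powIncl {ℓ : ℕ} (hℓ : 1 < ℓ) :
    powProj K n ℓ ∘ₗ powIncl K n ℓ = LinearMap.id := by
  refine LinearMap.pi_ext' fun I => LinearMap.ext_ring ?_
  simp only [LinearMap.comp_apply, LinearMap.single_apply, powIncl_single, LinearMap.id_apply]
  funext J
  change (Pi.single (fun _ => I 0) 1 : Tens K n ℓ) (fun _ => J 0) = _
  have : ((fun _ => J 0 : Fin ℓ → Fin n) = fun _ => I 0) ↔ J = I := by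
    constructor
    · intro h
      funext s
      rw [Subsingleton.elim s 0]
      exact congrFun h ⟨0, by omega⟩
    · rintro rfl; rfl
  simp only [Pi.single_apply, this]

theorem heckeOp_single_const {ℓ : ℕ} (i : ℕ) (hi : i + 1 < ℓ) (x : Fin n) :
    heckeOp q n ℓ i hi (Pi.single (fun _ => x) 1) = q • Pi.single (fun _ => x) 1 := by
  rw [heckeOp, Fintype.linearCombination_apply_single, one_smul, if_neg (lt_irrefl _), if_pos rfl,
    ← Pi.single_smul, smul_eq_mul, mul_one]

theorem powProj_schur_eq {ℓ : ℕ} (hq : IsPrimitiveRoot q ℓ) (hodd : Odd ℓ) (hℓ : 1 < ℓ)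
    (g : schur q m r ℓ) (w : Tens K m ℓ)
    (hw : ∀ i hi, heckeOp q m ℓ i hi w = q • w) :
    powProj K r ℓ (g.1 w) = powProj K r ℓ (g.1 (powIncl K m ℓ (powProj K m ℓ w))) := by
  obtain ⟨N, rfl⟩ : ∃ N, ℓ = N + 1 := ⟨ℓ - 1, by omega⟩
  have hp : IsPrimitiveRoot (q ^ 2) (N + 1) :=
    hq.pow_of_coprime 2 (Nat.coprime_two_left.2 hodd)
  have hsum : ∀ v : Tens K m (N + 1), ∀ K', g.1 v K' = ∑ J, v J * g.1 (Pi.single J 1) K' := by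
    intro v K'
    conv_lhs => rw [← Finset.univ_sum_single v]
    rw [map_sum, Finset.sum_apply]
    refine Finset.sum_congr rfl fun J _ => ?_
    have : (Pi.single J (v J) : Tens K m (N + 1)) = v J • Pi.single J 1 := by
      rw [← Pi.single_smul, smul_eq_mul, mul_one]
    rw [this, map_smul, Pi.smul_apply, smul_eq_mul]
  funext L
  change g.1 w (fun _ => L 0) = g.1 (powIncl K m (N + 1) (powProj K m (N + 1) w)) (fun _ => L 0)
  set y : Fin r := L 0
  rw [hsum]
  rw [sum_eq_sum_const (q ^ 2) (hp.geom_sum_eq_zero hℓ) ?_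
    (fun J => w J * g.1 (Pi.single J 1) (fun _ => y)) ?_]
  · rw [powIncl, Fintype.linearCombination_apply, map_sum, Finset.sum_apply]
    rw [← (Equiv.funUnique (Fin 1) (Fin m)).symm.sum_comp]
    refine Finset.sum_congr rfl fun x _ => ?_
    rw [map_smul, Pi.smul_apply, smul_eq_mul]
    rfl
  · intro k hk hk' h0
    have h1 := mul_geom_sum (q ^ 2) k
    rw [h0, mul_zero] at h1
    exact hp.pow_ne_one_of_pos_of_lt hk.ne' hk' (sub_eq_zero.1 h1.symm)
  · intro i J hJ
    have hi : (i : ℕ) + 1 < N + 1 := Nat.succ_lt_succ i.2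
    have hJ' : J ⟨i, Nat.lt_of_succ_lt hi⟩ < J ⟨i + 1, hi⟩ := hJ
    have e1 := congrFun (hw i hi) J
    rw [heckeOp_apply, if_pos hJ'] at e1
    have e2 := congrFun (LinearMap.congr_fun (g.2 i hi) (Pi.single J 1)) (fun _ => y)
    simp only [LinearMap.comp_apply] at e2
    rw [heckeOp_apply, if_neg (lt_irrefl _), if_pos rfl, heckeOp,
      Fintype.linearCombination_apply_single, one_smul, if_pos hJ'] at e2
    change w (J ∘ Equiv.swap i.castSucc i.succ) *
      g.1 (Pi.single (J ∘ Equiv.swap i.castSucc i.succ) 1) (fun _ => y) = _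
    rw [show w (J ∘ Equiv.swap i.castSucc i.succ) = q * w J from e1,
      show g.1 (Pi.single (J ∘ Equiv.swap i.castSucc i.succ) 1) (fun _ => y) =
        q * g.1 (Pi.single J 1) (fun _ => y) from e2]
    ring

/-- The quantum Frobenius in degree one, a functor from the source category of degree `ℓ` for `q`
to the one of degree `1` for `q = 1`. It sends `V_n^{⊗ ℓ}` to `V_n` and
`f : V_n^{⊗ ℓ} → V_m^{⊗ ℓ}` to the matrix whose `(y, x)` entry is the coefficient of
`e_y ⊗ ⋯ ⊗ e_y` in `f (e_x ⊗ ⋯ ⊗ e_x)`; that is, it is the transpose of the map `x_{ij} ↦ x_{ij}^ℓ`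
between coordinate spaces. -/
noncomputable def frobenius {ℓ : ℕ} (hq : IsPrimitiveRoot q ℓ) (hodd : Odd ℓ) (hℓ : 1 < ℓ) :
    Src K q ℓ ⥤ Src K (1 : K) 1 where
  obj X := ⟨X.n, X.one_le⟩
  map {X Y} f := ⟨powProj K Y.n ℓ ∘ₗ f.1 ∘ₗ powIncl K X.n ℓ,
    fun _ hi => absurd hi (by omega)⟩
  map_id X := Subtype.ext (powProj_comp_powIncl hℓ)
  map_comp {X Y Z} f g := Subtype.ext <| by
    refine LinearMap.pi_ext' fun I => LinearMap.ext_ring ?_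
    refine powProj_schur_eq hq hodd hℓ g (f.1 (powIncl K X.n ℓ (Pi.single I 1))) fun i hi => ?_
    rw [powIncl_single, ← LinearMap.comp_apply, ← f.2 i hi, LinearMap.comp_apply,
      heckeOp_single_const, map_smul]

instance {ℓ : ℕ} (hq : IsPrimitiveRoot q ℓ) (hodd : Odd ℓ) (hℓ : 1 < ℓ) :
    (frobenius hq hodd hℓ).Additive where
  map_add {X Y f g} := Subtype.ext (LinearMap.ext fun v =>
    map_add (powProj K Y.n ℓ) (f.1 (powIncl K X.n ℓ v)) (g.1 (powIncl K X.n ℓ v)))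

instance {ℓ : ℕ} (hq : IsPrimitiveRoot q ℓ) (hodd : Odd ℓ) (hℓ : 1 < ℓ) :
    (frobenius hq hodd hℓ).Linear K where
  map_smul {X Y} f c := Subtype.ext (LinearMap.ext fun v =>
    map_smul (powProj K Y.n ℓ) c (f.1 (powIncl K X.n ℓ v)))

/-- The quantum Frobenius twist `F^{(1)_q}` of a functor `F` that is homogeneous of degree `1`, namely
its pullback along the quantum Frobenius. -/
noncomputable def frobeniusTwist {ℓ : ℕ} (hq : IsPrimitiveRoot q ℓ) (hodd : Odd ℓ) (hℓ : 1 < ℓ)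
    (F : HQF K (1 : K) 1) : HQF K q ℓ where
  obj := frobenius hq hodd hℓ ⋙ F.obj
  property := by
    have := F.property.1
    have := F.property.2
    exact ⟨inferInstance, inferInstance⟩

end Frobenius

/-- The category of quantum polynomial functors, the direct sum over all `d ≥ 0` of the categories of
homogeneous quantum polynomial functors of degree `d`. -/
abbrev QF (K : Type u) [Field K] (q : K) :=
  CatFamily.DirectSumCat fun d : ℕ => HQF K q d

instance (K : Type u) [Field K] (q : K) : HasExt.{u + 1} (QF K q) := HasExt.standard _

/-- The quantum polynomial functor `I^{(1)_q}`, homogeneous of degree `ℓ`. -/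
noncomputable def frobeniusTwistI (K : Type u) [Field K] {q : K} {ℓ : ℕ}
    (hq : IsPrimitiveRoot q ℓ) (hodd : Odd ℓ) (hℓ : 1 < ℓ) : QF K q :=
  CatFamily.single ℓ (frobeniusTwist hq hodd hℓ (I K (1 : K)))

end QPoly

/-!
The twist `L = I^{(1)_q}` is resolved by the quantum Koszul and de Rham complexes of degree `ℓ`, whose
terms are the subfunctors `Γ^a ⊗ Λ^b`, `a + b = ℓ`, of the tensor power `V^{⊗ ℓ}`.

*The complexes.* Let `T_i` be the generators of the Hecke algebra acting on `V_n^{⊗ ℓ}`. The operators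
`-T_{ℓ-2-i}⁻¹` satisfy the same relations, and exchange symmetric and antisymmetric tensors. The
subspace `symAlt` of `V_n^{⊗ ℓ}` consists of the tensors that are symmetric in the first `a` and
antisymmetric in the last `b` positions. The partial symmetrizers `symOp` for the two families are the
de Rham differential `Γ^a ⊗ Λ^b → Γ^{a+1} ⊗ Λ^{b-1}` and the Koszul differential in the opposite
direction. Their anticommutator is the quantum integer `1 + q² + ⋯ + q^{2(ℓ-1)} = 0`
(`IsHeckeFamily.symOp_dual_add`), so it gives no contracting homotopy. A homotopy is found by moving the
largest letter of each word from one part to the other instead, dividing by the quantum integer of its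
multiplicity, which is invertible unless the word is constant. Hence both complexes are exact up to
constant words (`exists_symOp_hop_eq`, `exists_symOp_hopDual_eq`), and the de Rham differential
restricts to an equally exact complex on the Koszul cycles. The constant words occur only in
`Γ^{ℓ-1} ⊗ Λ^1` and `Γ^ℓ`. The Koszul complex is exact there too (`isSES_koszul`), while the de Rham
homology is a copy of `L` in both places (`isSES_sym_twist`, `isSES_deRhamKernel_twist`).

*Projectivity.* The space `V_d^{⊗ d}` is spanned by the words with letters `0, …, d - 1`, and for every
`w` in `V_n^{⊗ d}` there is a unique Hecke-linear map `V_d^{⊗ d} → V_n^{⊗ d}` that sends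
`e_0 ⊗ ⋯ ⊗ e_{d-1}` to `w` and kills the words that are not permutations (`ofVec`). So the tensor power is
projective and has no morphism to `L`. This passes to its direct summands `Γ^a ⊗ Λ^b` with `a, b < ℓ`,
whereas `Γ^ℓ` is projective as a representable functor. The maps `ofVec` also reduce the braid relations to
the single word `0 1 ⋯ (d - 1)`.

*Extensions.* Shifting dimensions along the exact sequences shows that the image of the de Rham
differential in `Γ^{ℓ-1} ⊗ Λ^1` has extensions by `L` only in degree `2ℓ - 3`, and that
`Ext^n(L, L) = 0` for `n > 2ℓ - 2`. The three short exact sequences that join `L` to itself through `Γ^ℓ`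
and `Γ^{ℓ-1} ⊗ Λ^1` define a class `e` of degree two for which the Yoneda product with `e` is bijective
`Ext^n(L, L) → Ext^{n+2}(L, L)` in degrees `n < 2ℓ - 3` (`exists_periodicity`). As `End L` consists of
scalars and `Ext^1(L, L) = 0`, the powers of `e` are a basis. These computations are made in degree `ℓ`;
the inclusion of a summand into a direct sum of categories is adjoint to the projection on both sides, so
it is exact and preserves projective objects.
-/

namespace QPoly

/-! ### Partial symmetrizers in a representation of the Hecke algebra -/

section HeckeFamily
variable {K : Type u} [Field K] {V : Type v} [AddCommGroup V] [Module K V]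

theorem smul_sub_inv_smul {q : K} (hq : q ≠ 0) (x : V) :
    q • (q - q⁻¹) • x = q ^ 2 • x - x := by
  rw [smul_smul, mul_sub, mul_inv_cancel₀ hq, sub_smul, one_smul, pow_two]

/-- A representation of the Hecke algebra `H_N` on `V`: endomorphisms `T 0, …, T (N - 2)` with
`(T i - q) (T i + q⁻¹) = 0` and the braid relations. -/
structure IsHeckeFamily (q : K) (N : ℕ) (T : ℕ → V →ₗ[K] V) : Prop where
  quad : ∀ i, i + 1 < N → ∀ w, T i (T i w) = w + (q - q⁻¹) • T i w
  comm : ∀ i j, i + 1 < j → j + 1 < N → ∀ w, T i (T j w) = T j (T i w)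
  braid : ∀ i, i + 2 < N → ∀ w, T i (T (i + 1) (T i w)) = T (i + 1) (T i (T (i + 1) w))

/-- The vector `w` is symmetric in the first `a` positions. -/
def IsSym (q : K) (T : ℕ → V →ₗ[K] V) (a : ℕ) (w : V) : Prop :=
  ∀ i, i + 1 < a → T i w = q • w

/-- The sum of `q ^ length` times the minimal representatives of the left cosets of `S_a` in
`S_{a + 1}`, that is `1 + q T_{a - 1} + q² T_{a - 2} T_{a - 1} + ⋯ + q ^ a T_0 ⋯ T_{a - 1}`. It
symmetrizes a vector which is symmetric in the first `a` positions. -/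
def symOp (q : K) (T : ℕ → V →ₗ[K] V) : ℕ → V →ₗ[K] V
  | 0 => LinearMap.id
  | a + 1 => LinearMap.id + q • (symOp q T a ∘ₗ T a)

/-- The quantum integer `1 + q² + ⋯ + q ^ (2 (m - 1))`. -/
def qInt (q : K) (m : ℕ) : K := ∑ t ∈ Finset.range m, (q ^ 2) ^ t

variable {q : K} {N a : ℕ} {T : ℕ → V →ₗ[K] V} {w : V}

theorem symOp_zero_apply : symOp q T 0 w = w := rfl

theorem symOp_succ_apply : symOp q T (a + 1) w = w + q • symOp q T a (T a w) := rfl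

theorem qInt_zero : qInt q 0 = 0 := rfl

theorem qInt_succ (m : ℕ) : qInt q (m + 1) = 1 + q ^ 2 * qInt q m := by
  rw [qInt, Finset.sum_range_succ', qInt, Finset.mul_sum, add_comm]
  simp only [pow_zero, pow_succ, mul_comm]

theorem qInt_add (a b : ℕ) :
    qInt q (a + b) = qInt q b + qInt q a + (q ^ 2 - 1) * (qInt q a * qInt q b) := by
  induction b with
  | zero => simp [qInt_zero]
  | succ b ih => rw [← add_assoc, qInt_succ, qInt_succ, ih]; ring

theorem IsSym.mono {b : ℕ} (h : IsSym q T a w) (hb : b ≤ a) : IsSym q T b w :=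
  fun i hi => h i (by omega)

theorem IsSym.add {w' : V} (h : IsSym q T a w) (h' : IsSym q T a w') : IsSym q T a (w + w') :=
  fun i hi => by rw [map_add, h i hi, h' i hi, smul_add]

theorem IsSym.smul (c : K) (h : IsSym q T a w) : IsSym q T a (c • w) :=
  fun i hi => by rw [map_smul, h i hi, smul_comm]

/-- An operator commuting with `T 0, …, T (a - 2)` preserves symmetric vectors. -/
theorem IsSym.map {U : V →ₗ[K] V} (hU : ∀ i, i + 1 < a → ∀ w, T i (U w) = U (T i w))
    (h : IsSym q T a w) : IsSym q T a (U w) :=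
  fun i hi => by rw [hU i hi, h i hi, map_smul]

/-- The operator `symOp q T a` lies in the algebra generated by `T 0, …, T (a - 1)`. -/
theorem map_symOp {V' : Type*} [AddCommGroup V'] [Module K V'] {T' : ℕ → V' →ₗ[K] V'}
    {U : V →ₗ[K] V'} (hU : ∀ i < a, ∀ w, U (T i w) = T' i (U w)) (w : V) :
    U (symOp q T a w) = symOp q T' a (U w) := by
  induction a generalizing w with
  | zero => rfl
  | succ a ih =>
    rw [symOp_succ_apply, symOp_succ_apply, map_add, map_smul,
      ih (fun i hi => hU i (hi.trans a.lt_succ_self)), hU a a.lt_succ_self]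

/-- Symmetrizing a vector which is symmetric already multiplies it by a quantum integer. -/
theorem symOp_eq_smul (h : IsSym q T (a + 1) w) : symOp q T a w = qInt q (a + 1) • w := by
  induction a with
  | zero => simp [symOp_zero_apply, qInt]
  | succ a ih =>
    rw [symOp_succ_apply, h a (by omega), map_smul, ih (h.mono (by omega)), qInt_succ (a + 1),
      add_smul, one_smul, smul_smul, smul_smul]
    ring_nf

namespace IsHeckeFamily
variable (hT : IsHeckeFamily q N T) (hq : q ≠ 0)
include hT

theorem isSym_apply (ha : a + 2 ≤ N) (h : IsSym q T a w) : IsSym q T a (T a w) :=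
  h.map fun i hi w => hT.comm i a (by omega) (by omega) w

omit hT in
theorem apply_symOp_comm {j : ℕ} (hT : IsHeckeFamily q N T) (hj : a < j) (hN : j + 1 < N) (w : V) :
    T j (symOp q T a w) = symOp q T a (T j w) :=
  map_symOp (fun i hi w => (hT.comm i j (by omega) hN w).symm) w

include hq in
/-- Partial symmetrization extends the symmetry by one position. -/
theorem isSym_symOp (ha : a + 1 ≤ N) (h : IsSym q T a w) : IsSym q T (a + 1) (symOp q T a w) := by
  have hqq := smul_sub_inv_smul (V := V) hq
  induction a generalizing w with
  | zero => exact fun i hi => absurd hi (by omega)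
  | succ a ih =>
    intro i hi
    have hTa : IsSym q T a (T a w) := hT.isSym_apply (by omega) (h.mono (by omega))
    rw [symOp_succ_apply, map_add, map_smul]
    rcases Nat.lt_succ_iff_lt_or_eq.1 (show i < a + 1 by omega) with hia | rfl
    · rw [ih (by omega) hTa i (by omega), h i (by omega), smul_add]
    · cases i with
      | zero =>
        rw [symOp_zero_apply, hT.quad 0 (by omega), smul_add q w, hqq]
        module
      | succ i =>
        have e : T (i + 1) (symOp q T (i + 1) (T (i + 1) w)) =
            T (i + 1) (T (i + 1) w) + (q * q) • symOp q T i (T i (T (i + 1) w)) := by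
          rw [symOp_succ_apply, map_add, map_smul,
            hT.apply_symOp_comm (Nat.lt_succ_self i) (by omega), ← hT.braid i (by omega),
            h i (by omega)]
          simp only [map_smul, smul_smul]
        rw [e, symOp_succ_apply, hT.quad _ (by omega), smul_add q (w + _), smul_add q w, hqq]
        module

include hq in
/-- The symmetrization which adds the positions `a` and `a + 1` successively absorbs the generator `T a`
that exchanges these positions, with a factor `q`. -/
theorem symOp_symOp_apply (ha : a + 2 ≤ N) (h : IsSym q T a w) :
    symOp q T (a + 1) (symOp q T a (T a w)) = q • symOp q T (a + 1) (symOp q T a w) := by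
  have hqq := smul_sub_inv_smul (V := V) hq
  induction a generalizing w with
  | zero =>
    simp only [symOp_succ_apply, symOp_zero_apply, hT.quad 0 (by omega), smul_add, hqq]
    module
  | succ a ih =>
    set u := T (a + 1) (T a w) with hu
    have hsym : IsSym q T a u := by
      intro i hi
      rw [hu, hT.comm i (a + 1) (by omega) (by omega), hT.comm i a (by omega) (by omega),
        h i (by omega), map_smul, map_smul]
    have e1 : T (a + 1) (symOp q T (a + 1) w) = T (a + 1) w + q • symOp q T a u := by
      rw [symOp_succ_apply, map_add, map_smul, hT.apply_symOp_comm (Nat.lt_succ_self a) (by omega)]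
    have e2 : T (a + 1) (symOp q T (a + 1) (T (a + 1) w)) =
        w + (q - q⁻¹) • T (a + 1) w + q • symOp q T a (T a u) := by
      rw [symOp_succ_apply, map_add, map_smul, hT.apply_symOp_comm (Nat.lt_succ_self a) (by omega),
        ← hT.braid a (by omega), hT.quad _ (by omega)]
    rw [symOp_succ_apply (a := a + 1), symOp_succ_apply (a := a + 1), e1, e2]
    simp only [map_add, map_smul, ih (by omega) hsym, smul_add, hqq]
    module

/-- Symmetrizing two positions in which the vector is antisymmetric gives zero. -/
theorem symOp_symOp_eq_zero (hq : q ≠ 0) (hq2 : q ^ 2 + 1 ≠ 0) (ha : a + 2 ≤ N)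
    (h : IsSym q T a w) (hw : T a w = (-q⁻¹) • w) :
    symOp q T (a + 1) (symOp q T a w) = 0 := by
  have e := hT.symOp_symOp_apply hq ha h
  rw [hw, map_smul, map_smul, ← sub_eq_zero, ← sub_smul] at e
  refine (smul_eq_zero.1 e).resolve_left fun h0 => hq2 ?_
  have : -(q * (-q⁻¹ - q)) = 0 := by rw [h0, mul_zero, neg_zero]
  rw [mul_sub, mul_neg, mul_inv_cancel₀ hq] at this
  linear_combination this

end IsHeckeFamily

/-- The operators `-T_{N - 2 - i}⁻¹`, where `T_i⁻¹ = T_i - (q - q⁻¹)`. -/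
def dualFamily (q : K) (N : ℕ) (T : ℕ → V →ₗ[K] V) (i : ℕ) : V →ₗ[K] V :=
  (q - q⁻¹) • LinearMap.id - T (N - 2 - i)

theorem dualFamily_apply (i : ℕ) : dualFamily q N T i w = (q - q⁻¹) • w - T (N - 2 - i) w := rfl

/-- The automorphism `T_i ↦ -T_{N - 2 - i}⁻¹` of the Hecke algebra exchanges the trivial and the
sign representation. -/
theorem IsHeckeFamily.dual (hT : IsHeckeFamily q N T) : IsHeckeFamily q N (dualFamily q N T) where
  quad i hi w := by
    simp only [dualFamily_apply, map_sub, map_smul, hT.quad (N - 2 - i) (by omega)]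
    module
  comm i j hij hj w := by
    have := hT.comm (N - 2 - j) (N - 2 - i) (by omega) (by omega) w
    simp only [dualFamily_apply, map_sub, map_smul, this]
    module
  braid i hi w := by
    have e := hT.braid (N - 2 - (i + 1)) (by omega) w
    rw [show N - 2 - (i + 1) + 1 = N - 2 - i by omega] at e
    simp only [dualFamily_apply, map_sub, map_smul, e, hT.quad (N - 2 - i) (by omega),
      hT.quad (N - 2 - (i + 1)) (by omega)]
    module

theorem dualFamily_eq_smul_iff (i : ℕ) :
    dualFamily q N T i w = q • w ↔ T (N - 2 - i) w = (-q⁻¹) • w := by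
  rw [dualFamily_apply, sub_eq_iff_eq_add, ← sub_eq_iff_eq_add']
  constructor
  · intro h; rw [← h]; module
  · intro h; rw [h]; module

/-- The homotopy formula: on vectors which are symmetric in the first `a + 1` and antisymmetric in the
last `b + 1` of `a + b + 2` positions, the anticommutator of symmetrization and antisymmetrization
is a quantum integer. -/
theorem IsHeckeFamily.symOp_dual_add (hT : IsHeckeFamily q N T) (hq : q ≠ 0) {b : ℕ}
    (hN : a + b + 2 = N)
    (h : IsSym q T (a + 1) w) (h' : IsSym q (dualFamily q N T) (b + 1) w) :
    symOp q (dualFamily q N T) b (symOp q T (a + 1) w) +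
      symOp q T a (symOp q (dualFamily q N T) (b + 1) w) = qInt q N • w := by
  have hc : ∀ w, symOp q (dualFamily q N T) b (symOp q T a w) =
      symOp q T a (symOp q (dualFamily q N T) b w) := fun w =>
    map_symOp (fun i hi w => by
      refine (map_symOp (U := T i) (fun j hj w => ?_) w).symm
      rw [dualFamily_apply, dualFamily_apply, map_sub, map_smul,
        hT.comm i (N - 2 - j) (by omega) (by omega)]) w
  rw [symOp_succ_apply, symOp_succ_apply, dualFamily_apply, show N - 2 - b = a by omega]
  simp only [map_add, map_sub, map_smul, hc, symOp_eq_smul h, symOp_eq_smul h', smul_sub,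
    smul_sub_inv_smul hq]
  rw [show N = (a + 1) + (b + 1) by omega, qInt_add (a + 1) (b + 1)]
  module

end HeckeFamily
end QPoly

namespace QPoly

/-! ### The Hecke action on words -/

section Words
variable {K : Type u} [Field K] {q : K} {d n m : ℕ}

/-- The transposition of the adjacent positions `i` and `i + 1`. -/
abbrev adj (i : ℕ) (hi : i + 1 < d) : Equiv.Perm (Fin d) :=
  Equiv.swap ⟨i, Nat.lt_of_succ_lt hi⟩ ⟨i + 1, hi⟩

theorem adj_val (i : ℕ) (hi : i + 1 < d) (s : Fin d) :
    (adj i hi s : ℕ) = if (s : ℕ) = i then i + 1 else if (s : ℕ) = i + 1 then i else s := by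
  simp only [Equiv.swap_apply_def, Fin.ext_iff]
  split_ifs <;> rfl

theorem comp_adj_adj (J : Fin d → Fin n) (i : ℕ) (hi : i + 1 < d) : (J ∘ adj i hi) ∘ adj i hi = J := by
  funext s; simp

/-- A word in a nonempty set of words which maximizes the pairing with the weights `ω` is sorted, with
respect to those adjacent transpositions that do not lead out of the set. -/
theorem exists_sorted (S : Set (Fin d → Fin n)) (hS : S.Nonempty) (ω : ℕ → ℤ) :
    ∃ J ∈ S, ∀ (i : ℕ) (hi : i + 1 < d), J ∘ adj i hi ∈ S →
      (ω i - ω (i + 1)) * ((J ⟨i + 1, hi⟩ : ℤ) - J ⟨i, Nat.lt_of_succ_lt hi⟩) ≤ 0 := by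
  obtain ⟨J, hJ, hmax⟩ := Set.exists_max_image S (fun J => ∑ s : Fin d, ω s * (J s : ℤ))
    (Set.toFinite S) hS
  refine ⟨J, hJ, fun i hi h => ?_⟩
  have h1 := hmax _ h
  set a : Fin d := ⟨i, Nat.lt_of_succ_lt hi⟩
  set b : Fin d := ⟨i + 1, hi⟩
  have hab : a ≠ b := by simp [a, b, Fin.ext_iff]
  have e : ∀ J' : Fin d → Fin n, ∑ s : Fin d, ω s * (J' s : ℤ) =
      ω a * J' a + (ω b * J' b + ∑ s ∈ (Finset.univ.erase a).erase b, ω s * (J' s : ℤ)) :=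
    fun J' => by
      rw [Finset.add_sum_erase _ (fun s : Fin d => ω s * (J' s : ℤ)) (by simp [hab.symm]),
        Finset.add_sum_erase _ (fun s : Fin d => ω s * (J' s : ℤ)) (by simp)]
  have e2 : ∑ s ∈ (Finset.univ.erase a).erase b, ω s * ((J ∘ adj i hi) s : ℤ) =
      ∑ s ∈ (Finset.univ.erase a).erase b, ω s * (J s : ℤ) :=
    Finset.sum_congr rfl fun s hs => by
      simp only [Finset.mem_erase, Finset.mem_univ, and_true] at hs
      rw [Function.comp_apply, Equiv.swap_apply_of_ne_of_ne hs.2 hs.1]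
  simp only [e, e2] at h1
  have e3 : (J ∘ adj i hi) a = J b := by simp [a, b]
  have e4 : (J ∘ adj i hi) b = J a := by simp [a, b]
  rw [e3, e4] at h1
  simp only [a, b] at h1 ⊢
  linarith

/-- Every word is obtained from a weakly increasing one by adjacent transpositions that create
inversions. -/
theorem word_induction {P : (Fin d → Fin n) → Prop} (hmono : ∀ J, Monotone J → P J)
    (hstep : ∀ J i (hi : i + 1 < d), J ⟨i + 1, hi⟩ < J ⟨i, Nat.lt_of_succ_lt hi⟩ →
      P (J ∘ adj i hi) → P J) (J : Fin d → Fin n) : P J := by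
  by_contra hP
  obtain ⟨J, hJ, h⟩ := exists_sorted {J : Fin d → Fin n | ¬ P J} ⟨J, hP⟩ (fun t => t)
  have hle : ∀ i (hi : i + 1 < d), J ⟨i, Nat.lt_of_succ_lt hi⟩ ≤ J ⟨i + 1, hi⟩ := fun i hi => by
    by_contra hc
    have h1 := h i hi fun hp => hJ (hstep J i hi (not_le.1 hc) hp)
    rw [not_le, Fin.lt_def] at hc
    push_cast at h1
    linarith
  refine hJ (hmono J fun s t hst => ?_)
  obtain ⟨s, hs⟩ := s
  obtain ⟨t, ht⟩ := t
  have hst' : s ≤ t := hst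
  induction t, hst' using Nat.le_induction with
  | base => exact le_rfl
  | succ t hst' ih => exact (ih (by omega) hst').trans (hle t ht)

/-- The basis tensor `e_J`. -/
abbrev ten (K : Type u) [Field K] (J : Fin d → Fin n) : Tens K n d := Pi.single J 1

theorem Tens.ext_ten {M : Type*} [AddCommGroup M] [Module K M] {f g : Tens K n d →ₗ[K] M}
    (h : ∀ J, f (ten K J) = g (ten K J)) : f = g :=
  LinearMap.pi_ext' fun J => LinearMap.ext_ring (h J)

theorem heckeOp_ten (J : Fin d → Fin n) (i : ℕ) (hi : i + 1 < d) :
    heckeOp q n d i hi (ten K J) =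
      if J ⟨i, Nat.lt_of_succ_lt hi⟩ < J ⟨i + 1, hi⟩ then ten K (J ∘ adj i hi)
      else if J ⟨i, Nat.lt_of_succ_lt hi⟩ = J ⟨i + 1, hi⟩ then q • ten K J
      else (q - q⁻¹) • ten K J + ten K (J ∘ adj i hi) := by
  rw [heckeOp, Fintype.linearCombination_apply_single, one_smul]
  simp only [ten, ← Pi.single_smul, smul_eq_mul, mul_one]

theorem heckeOp_ten_lt (J : Fin d → Fin n) (i : ℕ) (hi : i + 1 < d)
    (h : J ⟨i, Nat.lt_of_succ_lt hi⟩ < J ⟨i + 1, hi⟩) :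
    heckeOp q n d i hi (ten K J) = ten K (J ∘ adj i hi) := by
  rw [heckeOp_ten, if_pos h]

theorem heckeOp_ten_eq (J : Fin d → Fin n) (i : ℕ) (hi : i + 1 < d)
    (h : J ⟨i, Nat.lt_of_succ_lt hi⟩ = J ⟨i + 1, hi⟩) :
    heckeOp q n d i hi (ten K J) = q • ten K J := by
  rw [heckeOp_ten, if_neg h.not_lt, if_pos h]

theorem heckeOp_ten_gt (J : Fin d → Fin n) (i : ℕ) (hi : i + 1 < d)
    (h : J ⟨i + 1, hi⟩ < J ⟨i, Nat.lt_of_succ_lt hi⟩) :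
    heckeOp q n d i hi (ten K J) = (q - q⁻¹) • ten K J + ten K (J ∘ adj i hi) := by
  rw [heckeOp_ten, if_neg h.not_gt, if_neg h.ne']

theorem ten_eq_heckeOp (J : Fin d → Fin n) (i : ℕ) (hi : i + 1 < d)
    (h : J ⟨i + 1, hi⟩ < J ⟨i, Nat.lt_of_succ_lt hi⟩) :
    ten K J = heckeOp q n d i hi (ten K (J ∘ adj i hi)) := by
  rw [heckeOp_ten_lt _ i hi (by simpa using h), comp_adj_adj]

theorem schur_apply_heckeOp (f : schur q n m d) (i : ℕ) (hi : i + 1 < d) (w : Tens K n d) :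
    f.1 (heckeOp q n d i hi w) = heckeOp q m d i hi (f.1 w) :=
  LinearMap.congr_fun (f.2 i hi) w

/-! ### The tensor power is free on the word `0 1 ⋯ (d - 1)` -/

/-- A linear map on `V_d^{⊗ d}` supported on the permutation words is `H_d`-linear as soon as it
commutes with the generators on these words. -/
theorem mem_schur_of_injective {f : Tens K d d →ₗ[K] Tens K n d}
    (h0 : ∀ J, ¬ Function.Injective J → f (ten K J) = 0)
    (h : ∀ J, Function.Injective J → ∀ i hi,
      f (heckeOp q d d i hi (ten K J)) = heckeOp q n d i hi (f (ten K J))) :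
    f ∈ schur q d n d := fun i hi => Tens.ext_ten fun J => by
  by_cases hJ : Function.Injective J
  · exact h J hJ i hi
  · have hJ' : ¬ Function.Injective (J ∘ adj i hi) := fun h =>
      hJ (by simpa [Function.comp_assoc] using h.comp (adj i hi).injective)
    simp only [LinearMap.comp_apply, h0 J hJ, map_zero, heckeOp_ten]
    split_ifs <;> simp [h0 J hJ, h0 _ hJ']

theorem adj_ne (i : ℕ) (hi : i + 1 < d) :
    (⟨i, Nat.lt_of_succ_lt hi⟩ : Fin d) ≠ ⟨i + 1, hi⟩ := by simp [Fin.ext_iff]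

theorem adj_lt_adj_iff (i : ℕ) (hi : i + 1 < d) (s t : Fin d)
    (hst : ¬ (s = ⟨i, Nat.lt_of_succ_lt hi⟩ ∧ t = ⟨i + 1, hi⟩))
    (hts : ¬ (t = ⟨i, Nat.lt_of_succ_lt hi⟩ ∧ s = ⟨i + 1, hi⟩)) :
    adj i hi s < adj i hi t ↔ s < t := by
  simp only [Fin.ext_iff] at hst hts
  rw [Fin.lt_def, Fin.lt_def, adj_val, adj_val]
  split_ifs <;> omega

/-- The weight by which the pair of letters `x`, `y`, in this order, enters `inflate`. -/
noncomputable def inflateWeight (q : K) (I : Fin d → Fin n) (x y : Fin d) : K :=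
  if y < x ∧ I x = I y then q else 1

/-- The product of the weights of all pairs of positions. -/
noncomputable def pairProd (f : Fin d → Fin d → K) (J : Fin d → Fin d) : K :=
  ∏ p ∈ Finset.univ.filter (fun p : Fin d × Fin d => p.1 < p.2), f (J p.1) (J p.2)

/-- Exchanging adjacent letters changes only the factor of this pair. -/
theorem pairProd_comp_adj (f : Fin d → Fin d → K) (J : Fin d → Fin d) (i : ℕ) (hi : i + 1 < d) :
    pairProd f (J ∘ adj i hi) * f (J ⟨i, Nat.lt_of_succ_lt hi⟩) (J ⟨i + 1, hi⟩) =
      pairProd f J * f (J ⟨i + 1, hi⟩) (J ⟨i, Nat.lt_of_succ_lt hi⟩) := by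
  classical
  set a : Fin d := ⟨i, Nat.lt_of_succ_lt hi⟩ with ha
  set b : Fin d := ⟨i + 1, hi⟩ with hb
  have hab : a < b := by simp [a, b]
  have key : ∀ J : Fin d → Fin d, pairProd f J = f (J a) (J b) *
      ∏ p ∈ (Finset.univ.filter (fun p : Fin d × Fin d => p.1 < p.2)).erase (a, b),
        f (J p.1) (J p.2) := fun J => by
    rw [pairProd]
    exact (Finset.mul_prod_erase (Finset.univ.filter fun p : Fin d × Fin d => p.1 < p.2)
      (fun p : Fin d × Fin d => f (J p.1) (J p.2)) (a := (a, b)) (by simpa using hab)).symm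
  rw [key (J ∘ adj i hi), key J]
  have e : ∏ p ∈ (Finset.univ.filter (fun p : Fin d × Fin d => p.1 < p.2)).erase (a, b),
        f ((J ∘ adj i hi) p.1) ((J ∘ adj i hi) p.2) =
      ∏ p ∈ (Finset.univ.filter (fun p : Fin d × Fin d => p.1 < p.2)).erase (a, b),
        f (J p.1) (J p.2) := by
    refine Finset.prod_equiv ((adj i hi).prodCongr (adj i hi)) (fun p => ?_) fun p _ => rfl
    obtain ⟨s, t⟩ := p
    simp only [Finset.mem_erase, Finset.mem_filter, Finset.mem_univ, true_and, Equiv.prodCongr_apply,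
      Prod.map, ne_eq, Prod.mk.injEq]
    have hba : ¬ b < a := hab.not_gt
    by_cases h1 : s = a ∧ t = b
    · obtain ⟨rfl, rfl⟩ := h1
      simp [ha, hb]
    by_cases h2 : t = a ∧ s = b
    · obtain ⟨rfl, rfl⟩ := h2
      simp [a, b]
    rw [adj_lt_adj_iff i hi s t h1 h2]
    have h3 : ¬ (adj i hi s = a ∧ adj i hi t = b) := by
      rintro ⟨h3, h4⟩
      rw [← Equiv.eq_symm_apply] at h3 h4
      exact h2 ⟨by simpa [a, b] using h4, by simpa [a, b] using h3⟩
    simp [h1, h3]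
  rw [e]
  simp [a, b]
  ring

/-- For a weakly increasing word `I`, the `H_d`-linear map `V_d^{⊗ d} → V_n^{⊗ d}` with
`e_0 ⊗ ⋯ ⊗ e_{d - 1} ↦ e_I`. It substitutes the letters, with a factor `q` for each inversion
between two letters that become equal. -/
noncomputable def inflate (q : K) (I : Fin d → Fin n) : Tens K d d →ₗ[K] Tens K n d :=
  open scoped Classical in
  Fintype.linearCombination K fun J : Fin d → Fin d =>
    if Function.Injective J then pairProd (inflateWeight q I) J • ten K (I ∘ J) else 0

theorem inflate_ten (I : Fin d → Fin n) (J : Fin d → Fin d) (hJ : Function.Injective J) :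
    inflate q I (ten K J) = pairProd (inflateWeight q I) J • ten K (I ∘ J) := by
  rw [inflate, Fintype.linearCombination_apply_single, one_smul, if_pos hJ]

theorem inflate_ten_of_not (I : Fin d → Fin n) (J : Fin d → Fin d) (hJ : ¬ Function.Injective J) :
    inflate q I (ten K J) = 0 := by
  rw [inflate, Fintype.linearCombination_apply_single, one_smul, if_neg hJ]

theorem inflate_ten_id (I : Fin d → Fin n) : inflate q I (ten K id) = ten K I := by
  rw [inflate_ten I id Function.injective_id, Function.comp_id, pairProd, Finset.prod_eq_one,
    one_smul]
  rintro ⟨s, t⟩ h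
  simp only [Finset.mem_filter, Finset.mem_univ, true_and] at h
  exact if_neg fun h' => h.not_gt h'.1

theorem inflate_mem_schur (hq : q ≠ 0) (I : Fin d → Fin n) (hI : Monotone I) :
    inflate q I ∈ schur q d n d := by
  refine mem_schur_of_injective (inflate_ten_of_not I) fun J hJ i hi => ?_
  have hJ' : Function.Injective (J ∘ adj i hi) := hJ.comp (adj i hi).injective
  have hc := pairProd_comp_adj (inflateWeight q I) J i hi
  set a : Fin d := ⟨i, Nat.lt_of_succ_lt hi⟩ with ha
  set b : Fin d := ⟨i + 1, hi⟩ with hb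
  have hab : a ≠ b := adj_ne i hi
  have hIJ : I (J a) = I (J b) → I ∘ (J ∘ adj i hi) = I ∘ J := fun h => by
    funext s
    simp only [Function.comp, Equiv.swap_apply_def]
    split_ifs with h1 h2
    · rw [h1, ← hb, ← h]
    · rw [h2, ← ha, h]
    · rfl
  rw [inflate_ten I J hJ, map_smul]
  rcases lt_or_gt_of_ne (hJ.ne hab) with h | h
  · rw [heckeOp_ten_lt J i hi h, inflate_ten I _ hJ']
    rw [inflateWeight, if_neg (fun h' => h.not_gt h'.1), mul_one, inflateWeight] at hc
    rw [hc]
    rcases (hI h.le).lt_or_eq with h2 | h2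
    · rw [heckeOp_ten_lt (I ∘ J) i hi h2, if_neg (fun h' => h2.ne h'.2.symm), mul_one,
        Function.comp_assoc]
    · rw [heckeOp_ten_eq (I ∘ J) i hi h2, hIJ h2, if_pos ⟨h, h2.symm⟩, mul_smul]
  · rw [heckeOp_ten_gt J i hi h, map_add, map_smul, inflate_ten I J hJ, inflate_ten I _ hJ']
    rw [inflateWeight, inflateWeight, if_neg (fun h' : J a < J b ∧ _ => h.not_gt h'.1), mul_one] at hc
    rcases (hI h.le).lt_or_eq with h2 | h2
    · rw [if_neg (fun h' => h2.ne h'.2.symm), mul_one] at hc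
      rw [heckeOp_ten_gt (I ∘ J) i hi h2, hc, smul_add, smul_comm, Function.comp_assoc]
    · rw [if_pos ⟨h, h2.symm⟩] at hc
      rw [heckeOp_ten_eq (I ∘ J) i hi h2.symm, hIJ h2.symm, ← hc,
        smul_smul, smul_smul, ← add_smul]
      congr 1
      field_simp
      ring

open scoped Classical in
/-- Right multiplication by the generator `T_k` on the regular representation of the Hecke algebra,
realized on the permutation words. It exchanges the letters `k` and `k + 1`. -/
noncomputable def rightOp (q : K) (k : ℕ) (hk : k + 1 < d) : Tens K d d →ₗ[K] Tens K d d :=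
  Fintype.linearCombination K fun J : Fin d → Fin d =>
    if Function.Injective J then
      if ∃ s t, s < t ∧ J s = ⟨k, Nat.lt_of_succ_lt hk⟩ ∧ J t = ⟨k + 1, hk⟩ then ten K (adj k hk ∘ J)
      else (q - q⁻¹) • ten K J + ten K (adj k hk ∘ J)
    else 0

theorem rightOp_ten_of_not (k : ℕ) (hk : k + 1 < d) (J : Fin d → Fin d)
    (hJ : ¬ Function.Injective J) : rightOp q k hk (ten K J) = 0 := by
  rw [rightOp, Fintype.linearCombination_apply_single, one_smul, if_neg hJ]

theorem rightOp_ten_pos (k : ℕ) (hk : k + 1 < d) (J : Fin d → Fin d) (hJ : Function.Injective J)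
    (h : ∃ s t, s < t ∧ J s = ⟨k, Nat.lt_of_succ_lt hk⟩ ∧ J t = ⟨k + 1, hk⟩) :
    rightOp q k hk (ten K J) = ten K (adj k hk ∘ J) := by
  rw [rightOp, Fintype.linearCombination_apply_single, one_smul, if_pos hJ, if_pos h]

theorem rightOp_ten_neg (k : ℕ) (hk : k + 1 < d) (J : Fin d → Fin d) (hJ : Function.Injective J)
    (h : ¬ ∃ s t, s < t ∧ J s = ⟨k, Nat.lt_of_succ_lt hk⟩ ∧ J t = ⟨k + 1, hk⟩) :
    rightOp q k hk (ten K J) = (q - q⁻¹) • ten K J + ten K (adj k hk ∘ J) := by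
  rw [rightOp, Fintype.linearCombination_apply_single, one_smul, if_pos hJ, if_neg h]

/-- Exchanging two adjacent positions which hold the letters `k` and `k + 1` is the same as exchanging
these two letters. -/
theorem adj_comp_eq_comp_adj (k : ℕ) (hk : k + 1 < d) (i : ℕ) (hi : i + 1 < d) (J : Fin d → Fin d)
    (hJ : Function.Injective J)
    (h : adj k hk = Equiv.swap (J ⟨i, Nat.lt_of_succ_lt hi⟩) (J ⟨i + 1, hi⟩)) :
    adj k hk ∘ J = J ∘ adj i hi := by
  rw [h]
  funext s
  exact (hJ.swap_apply _ _ s)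

theorem rightOp_mem_schur (k : ℕ) (hk : k + 1 < d) : rightOp q k hk ∈ schur q d d d := by
  refine mem_schur_of_injective (rightOp_ten_of_not k hk) fun J hJ i hi => ?_
  set x : Fin d := ⟨k, Nat.lt_of_succ_lt hk⟩ with hx
  set y : Fin d := ⟨k + 1, hk⟩ with hy
  have hxy : x < y := by simp [x, y]
  have hJ' : Function.Injective (J ∘ adj i hi) := hJ.comp (adj i hi).injective
  -- on words with the letters `k`, `k + 1` in the positions `i`, `i + 1` both operators agree
  have hlt : ∀ J : Fin d → Fin d, Function.Injective J → J ⟨i, Nat.lt_of_succ_lt hi⟩ = x →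
      J ⟨i + 1, hi⟩ = y → rightOp q k hk (ten K J) = heckeOp q d d i hi (ten K J) :=
    fun J hJ h1 h2 => by
      rw [rightOp_ten_pos k hk J hJ ⟨_, _, by simp, h1, h2⟩,
        heckeOp_ten_lt J i hi (by rw [h1, h2]; exact hxy),
        adj_comp_eq_comp_adj k hk i hi J hJ (by rw [h1, h2])]
  have hgt : ∀ J : Fin d → Fin d, Function.Injective J → J ⟨i, Nat.lt_of_succ_lt hi⟩ = y →
      J ⟨i + 1, hi⟩ = x → rightOp q k hk (ten K J) = heckeOp q d d i hi (ten K J) :=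
    fun J hJ h1 h2 => by
      rw [rightOp_ten_neg k hk J hJ, heckeOp_ten_gt J i hi (by rw [h1, h2]; exact hxy),
        adj_comp_eq_comp_adj k hk i hi J hJ (by rw [h1, h2, Equiv.swap_comm])]
      rintro ⟨s, t, hst, hs, ht⟩
      rw [hJ (hs.trans h2.symm), hJ (ht.trans h1.symm), Fin.lt_def] at hst
      simp at hst
  by_cases h1 : J ⟨i, Nat.lt_of_succ_lt hi⟩ = x ∧ J ⟨i + 1, hi⟩ = y
  · have e1 := hlt J hJ h1.1 h1.2
    have e2 := hgt (J ∘ adj i hi) hJ' (by simpa using h1.2) (by simpa using h1.1)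
    rw [e1, heckeOp_ten_lt J i hi (by rw [h1.1, h1.2]; exact hxy), e2]
  by_cases h2 : J ⟨i, Nat.lt_of_succ_lt hi⟩ = y ∧ J ⟨i + 1, hi⟩ = x
  · have e1 := hgt J hJ h2.1 h2.2
    have e2 := hlt (J ∘ adj i hi) hJ' (by simpa using h2.2) (by simpa using h2.1)
    rw [e1, heckeOp_ten_gt J i hi (by rw [h2.1, h2.2]; exact hxy), map_add, map_add, map_smul,
      map_smul, e1, e2, heckeOp_ten_gt J i hi (by rw [h2.1, h2.2]; exact hxy)]
  have hA : (adj k hk ∘ J) ⟨i, Nat.lt_of_succ_lt hi⟩ < (adj k hk ∘ J) ⟨i + 1, hi⟩ ↔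
      J ⟨i, Nat.lt_of_succ_lt hi⟩ < J ⟨i + 1, hi⟩ :=
    adj_lt_adj_iff k hk _ _ h1 fun h => h2 ⟨h.2, h.1⟩
  have hA' : (adj k hk ∘ J) ⟨i + 1, hi⟩ < (adj k hk ∘ J) ⟨i, Nat.lt_of_succ_lt hi⟩ ↔
      J ⟨i + 1, hi⟩ < J ⟨i, Nat.lt_of_succ_lt hi⟩ :=
    adj_lt_adj_iff k hk _ _ (fun h => h2 ⟨h.2, h.1⟩) h1
  have hB : (∃ s t, s < t ∧ (J ∘ adj i hi) s = x ∧ (J ∘ adj i hi) t = y) ↔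
      ∃ s t, s < t ∧ J s = x ∧ J t = y := by
    have aux : ∀ J : Fin d → Fin d,
        ¬ (J ⟨i, Nat.lt_of_succ_lt hi⟩ = x ∧ J ⟨i + 1, hi⟩ = y) →
        ¬ (J ⟨i, Nat.lt_of_succ_lt hi⟩ = y ∧ J ⟨i + 1, hi⟩ = x) →
        (∃ s t, s < t ∧ J s = x ∧ J t = y) →
        ∃ s t, s < t ∧ (J ∘ adj i hi) s = x ∧ (J ∘ adj i hi) t = y := by
      rintro J h1 h2 ⟨s, t, hst, hs, ht⟩
      refine ⟨adj i hi s, adj i hi t, (adj_lt_adj_iff i hi s t ?_ ?_).2 hst, ?_, ?_⟩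
      · rintro ⟨rfl, rfl⟩; exact h1 ⟨hs, ht⟩
      · rintro ⟨rfl, rfl⟩; exact h2 ⟨ht, hs⟩
      · simpa using hs
      · simpa using ht
    refine ⟨fun h => ?_, aux J h1 h2⟩
    have := aux (J ∘ adj i hi) (by simpa [and_comm] using h2) (by simpa [and_comm] using h1) h
    rwa [comp_adj_adj] at this
  rcases lt_or_gt_of_ne (hJ.ne (adj_ne i hi)) with h | h
  · rw [heckeOp_ten_lt J i hi h]
    by_cases hex : ∃ s t, s < t ∧ J s = x ∧ J t = y
    · rw [rightOp_ten_pos k hk J hJ hex, rightOp_ten_pos k hk _ hJ' (hB.2 hex),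
        heckeOp_ten_lt _ i hi (hA.2 h), Function.comp_assoc]
    · rw [rightOp_ten_neg k hk J hJ hex, rightOp_ten_neg k hk _ hJ' (fun h => hex (hB.1 h)),
        map_add, map_smul, heckeOp_ten_lt _ i hi (hA.2 h), heckeOp_ten_lt _ i hi h,
        Function.comp_assoc]
  · rw [heckeOp_ten_gt J i hi h]
    by_cases hex : ∃ s t, s < t ∧ J s = x ∧ J t = y
    · rw [map_add, map_smul, rightOp_ten_pos k hk J hJ hex, rightOp_ten_pos k hk _ hJ' (hB.2 hex),
        heckeOp_ten_gt _ i hi (hA'.2 h), Function.comp_assoc]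
    · rw [map_add, map_smul, rightOp_ten_neg k hk J hJ hex,
        rightOp_ten_neg k hk _ hJ' (fun h => hex (hB.1 h)),
        map_add, map_smul, heckeOp_ten_gt _ i hi (hA'.2 h), heckeOp_ten_gt _ i hi h,
        Function.comp_assoc]
      module

/-- Every basis tensor is the image of `e_0 ⊗ ⋯ ⊗ e_{d - 1}`: sorted words are treated by `inflate`, and
each further inversion by a right multiplication. -/
theorem exists_schur_ten (hq : q ≠ 0) (I : Fin d → Fin n) :
    ∃ f : schur q d n d, f.1 (ten K id) = ten K I ∧
      ∀ J, ¬ Function.Injective J → f.1 (ten K J) = 0 := by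
  induction I using word_induction with
  | hmono I hI => exact ⟨⟨_, inflate_mem_schur hq I hI⟩, inflate_ten_id I, inflate_ten_of_not I⟩
  | hstep I i hi h ih =>
    obtain ⟨f, hf, hf0⟩ := ih
    refine ⟨⟨f.1 ∘ₗ rightOp q i hi, fun j hj => ?_⟩, ?_, fun J hJ => ?_⟩
    · rw [LinearMap.comp_assoc, rightOp_mem_schur i hi j hj, ← LinearMap.comp_assoc, f.2 j hj,
        LinearMap.comp_assoc]
    · rw [LinearMap.comp_apply, rightOp_ten_pos i hi _ Function.injective_id
        ⟨⟨i, Nat.lt_of_succ_lt hi⟩, ⟨i + 1, hi⟩, by simp, rfl, rfl⟩,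
        ten_eq_heckeOp (q := q) I i hi h, ← hf,
        ← schur_apply_heckeOp, heckeOp_ten_lt _ i hi (by simp)]
      rfl
    · rw [LinearMap.comp_apply, rightOp_ten_of_not i hi J hJ, map_zero]

/-- The permutation words are generated by the word `0 1 ⋯ (d - 1)` under the Hecke action. -/
theorem schur_eq_zero {f : schur q d n d} (h : f.1 (ten K id) = 0)
    (h0 : ∀ J, ¬ Function.Injective J → f.1 (ten K J) = 0) : f = 0 := by
  refine Subtype.ext (Tens.ext_ten fun J => ?_)
  induction J using word_induction with
  | hmono J hJ =>
    by_cases hinj : Function.Injective J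
    · have : J = id := (StrictMono.range_inj (hJ.strictMono_of_injective hinj) strictMono_id).1 (by
        rw [Set.range_id, (Finite.injective_iff_surjective.1 hinj).range_eq])
      rw [this, h]; rfl
    · rw [h0 J hinj]; rfl
  | hstep J i hi hlt ih =>
    rw [ten_eq_heckeOp (q := q) J i hi hlt, schur_apply_heckeOp, ih]
    simp

/-- Every vector `w` of `V_n^{⊗ d}` is the image of `e_0 ⊗ ⋯ ⊗ e_{d - 1}` under an `H_d`-linear map
supported on the permutation words. -/
theorem exists_schur (hq : q ≠ 0) (w : Tens K n d) :
    ∃ f : schur q d n d, f.1 (ten K id) = w ∧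
      ∀ J, ¬ Function.Injective J → f.1 (ten K J) = 0 := by
  choose f hf hf0 using fun I : Fin d → Fin n => exists_schur_ten (K := K) hq I
  refine ⟨∑ I, w I • f I, ?_, fun J hJ => ?_⟩
  · simp only [Submodule.coe_sum, Submodule.coe_smul, LinearMap.sum_apply, LinearMap.smul_apply, hf]
    conv_rhs => rw [← Finset.univ_sum_single w]
    exact Finset.sum_congr rfl fun I _ => by rw [← Pi.single_smul, smul_eq_mul, mul_one]
  · simp only [Submodule.coe_sum, Submodule.coe_smul, LinearMap.sum_apply, LinearMap.smul_apply,
      hf0 _ J hJ, smul_zero, Finset.sum_const_zero]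

/-- The `H_d`-linear map `V_d^{⊗ d} → V_n^{⊗ d}` supported on the permutation words with
`e_0 ⊗ ⋯ ⊗ e_{d - 1} ↦ w`. -/
noncomputable def ofVec (hq : q ≠ 0) (w : Tens K n d) : schur q d n d := (exists_schur hq w).choose

theorem ofVec_ten_id (hq : q ≠ 0) (w : Tens K n d) : (ofVec hq w).1 (ten K id) = w :=
  (exists_schur hq w).choose_spec.1

theorem ofVec_ten_of_not (hq : q ≠ 0) (w : Tens K n d) (J : Fin d → Fin d)
    (hJ : ¬ Function.Injective J) : (ofVec hq w).1 (ten K J) = 0 :=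
  (exists_schur hq w).choose_spec.2 J hJ

theorem ofVec_unique (hq : q ≠ 0) {w : Tens K n d} {f : schur q d n d} (h : f.1 (ten K id) = w)
    (h0 : ∀ J, ¬ Function.Injective J → f.1 (ten K J) = 0) : ofVec hq w = f :=
  sub_eq_zero.1 <| schur_eq_zero (by
    change (ofVec hq w).1 _ - f.1 _ = 0
    rw [ofVec_ten_id, h, sub_self]) fun J hJ => by
    change (ofVec hq w).1 _ - f.1 _ = 0
    rw [ofVec_ten_of_not hq w J hJ, h0 J hJ, sub_self]

/-- Identities between operators that commute with all `H_d`-linear maps can be checked on the word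
`0 1 ⋯ (d - 1)`. -/
theorem eq_of_ten_id (hq : q ≠ 0) {X Y : ∀ n, Tens K n d →ₗ[K] Tens K n d}
    (hX : ∀ n (f : schur q d n d) w, f.1 (X d w) = X n (f.1 w))
    (hY : ∀ n (f : schur q d n d) w, f.1 (Y d w) = Y n (f.1 w))
    (h : X d (ten K id) = Y d (ten K id)) (w : Tens K n d) : X n w = Y n w := by
  rw [← ofVec_ten_id hq w, ← hX, ← hY, h]

/-- The generators of the Hecke algebra acting on `V_n^{⊗ d}`, extended by zero to all indices. -/
noncomputable def hop (q : K) (n d : ℕ) (i : ℕ) : Tens K n d →ₗ[K] Tens K n d :=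
  if hi : i + 1 < d then heckeOp q n d i hi else 0

theorem hop_eq (i : ℕ) (hi : i + 1 < d) : hop q n d i = heckeOp q n d i hi := dif_pos hi

theorem schur_apply_hop (f : schur q n m d) (i : ℕ) (w : Tens K n d) :
    f.1 (hop q n d i w) = hop q m d i (f.1 w) := by
  by_cases hi : i + 1 < d
  · rw [hop_eq i hi, hop_eq i hi, schur_apply_heckeOp]
  · simp [hop, hi]

/-- The relations hold on the word `0 1 ⋯ (d - 1)`, where each generator that occurs only exchanges
letters (apart from the quadratic term), and therefore everywhere. -/
theorem isHeckeFamily_hop (hq : q ≠ 0) (n d : ℕ) : IsHeckeFamily q d (hop q n d) where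
  quad i hi w := by
    refine eq_of_ten_id (q := q) (X := fun n => hop q n d i ∘ₗ hop q n d i)
      (Y := fun n => LinearMap.id + (q - q⁻¹) • hop q n d i) hq ?_ ?_ ?_ w
    · intro n f w; simp only [LinearMap.comp_apply, schur_apply_hop]
    · intro n f w; simp [schur_apply_hop]
    · simp only [LinearMap.comp_apply, LinearMap.add_apply, LinearMap.smul_apply, LinearMap.id_apply,
        hop_eq i hi]
      rw [heckeOp_ten_lt id i hi (by simp), heckeOp_ten_gt _ i hi (by simp), comp_adj_adj, add_comm]
  comm i j hij hj w := by
    have hi : i + 1 < d := by omega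
    refine eq_of_ten_id (q := q) (X := fun n => hop q n d i ∘ₗ hop q n d j)
      (Y := fun n => hop q n d j ∘ₗ hop q n d i) hq ?_ ?_ ?_ w
    · intro n f w; simp only [LinearMap.comp_apply, schur_apply_hop]
    · intro n f w; simp only [LinearMap.comp_apply, schur_apply_hop]
    · simp only [LinearMap.comp_apply, hop_eq i hi, hop_eq j hj]
      rw [heckeOp_ten_lt id j hj (by simp), heckeOp_ten_lt id i hi (by simp),
        heckeOp_ten_lt _ i hi, heckeOp_ten_lt _ j hj]
      · congr 1
        funext s
        rw [Fin.ext_iff]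
        simp only [Function.comp_apply, id, adj_val]
        split_ifs <;> omega
      all_goals
        rw [Fin.lt_def]
        simp only [Function.comp_apply, id, adj_val]
        split_ifs <;> omega
  braid i hi w := by
    have hi' : i + 1 < d := by omega
    have hj : i + 1 + 1 < d := by omega
    have n1 : i ≠ i + 1 + 1 := by omega
    refine eq_of_ten_id (q := q)
      (X := fun n => hop q n d i ∘ₗ hop q n d (i + 1) ∘ₗ hop q n d i)
      (Y := fun n => hop q n d (i + 1) ∘ₗ hop q n d i ∘ₗ hop q n d (i + 1)) hq ?_ ?_ ?_ w
    · intro n f w; simp only [LinearMap.comp_apply, schur_apply_hop]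
    · intro n f w; simp only [LinearMap.comp_apply, schur_apply_hop]
    · simp only [LinearMap.comp_apply, hop_eq i hi', hop_eq (i + 1) hj]
      rw [heckeOp_ten_lt id i hi' (by simp), heckeOp_ten_lt _ (i + 1) hj, heckeOp_ten_lt _ i hi',
        heckeOp_ten_lt id (i + 1) hj (by simp), heckeOp_ten_lt _ i hi', heckeOp_ten_lt _ (i + 1) hj]
      · congr 1
        funext s
        rw [Fin.ext_iff]
        simp only [Function.comp_apply, id]
        obtain h | h | h | ⟨h0, h1, h2⟩ : (s : ℕ) = i ∨ (s : ℕ) = i + 1 ∨ (s : ℕ) = i + 1 + 1 ∨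
          ((s : ℕ) ≠ i ∧ (s : ℕ) ≠ i + 1 ∧ (s : ℕ) ≠ i + 1 + 1) := by omega
        · simp [adj_val, h, n1, n1.symm]
        · simp [adj_val, h, n1, n1.symm]
        · simp [adj_val, h, n1, n1.symm]
        · simp [adj_val, h0, h1, h2]
      all_goals
        rw [Fin.lt_def]
        simp [adj_val, n1, n1.symm]

end Words
end QPoly

namespace QPoly

/-! ### Exactness of the quantum Koszul and de Rham complexes -/

section Exactness
variable {K : Type u} [Field K] {q : K} {d n a b : ℕ}

/-- The operators `-T_{d - 2 - i}⁻¹` on `V_n^{⊗ d}`. -/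
noncomputable abbrev hopDual (q : K) (n d : ℕ) : ℕ → Tens K n d →ₗ[K] Tens K n d :=
  dualFamily q d (hop q n d)

/-- The subspace `Γ^a ⊗ Λ^b` of the tensors in `V_n^{⊗ d}` which are symmetric in the first `a` and
antisymmetric in the last `b` positions. -/
def symAlt (q : K) (n d a b : ℕ) : Submodule K (Tens K n d) where
  carrier := {w | IsSym q (hop q n d) a w ∧ IsSym q (hopDual q n d) b w}
  add_mem' h h' := ⟨h.1.add h'.1, h.2.add h'.2⟩
  zero_mem' := ⟨fun i _ => by simp, fun i _ => by simp⟩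
  smul_mem' c _ h := ⟨h.1.smul c, h.2.smul c⟩

theorem hop_apply_lt (i : ℕ) (hi : i + 1 < d) (v : Tens K n d) (J : Fin d → Fin n)
    (h : J ⟨i, Nat.lt_of_succ_lt hi⟩ < J ⟨i + 1, hi⟩) : hop q n d i v J = v (J ∘ adj i hi) := by
  rw [hop_eq i hi, heckeOp_apply, if_pos h]

theorem hop_apply_eq (i : ℕ) (hi : i + 1 < d) (v : Tens K n d) (J : Fin d → Fin n)
    (h : J ⟨i, Nat.lt_of_succ_lt hi⟩ = J ⟨i + 1, hi⟩) : hop q n d i v J = q * v J := by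
  rw [hop_eq i hi, heckeOp_apply, if_neg h.not_lt, if_pos h]

theorem hop_apply_gt (i : ℕ) (hi : i + 1 < d) (v : Tens K n d) (J : Fin d → Fin n)
    (h : J ⟨i + 1, hi⟩ < J ⟨i, Nat.lt_of_succ_lt hi⟩) :
    hop q n d i v J = (q - q⁻¹) * v J + v (J ∘ adj i hi) := by
  rw [hop_eq i hi, heckeOp_apply, if_neg h.not_gt, if_neg h.ne']

/-- The tensor `v` has no component in the words of `E`. -/
def VanishOn (E : Set (Fin d → Fin n)) (v : Tens K n d) : Prop := ∀ J ∈ E, v J = 0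

theorem VanishOn.hop {E : Set (Fin d → Fin n)} {v : Tens K n d} (hv : VanishOn E v) (i : ℕ)
    (hE : ∀ hi : i + 1 < d, ∀ J ∈ E, J ∘ adj i hi ∈ E) : VanishOn E (hop q n d i v) := by
  intro J hJ
  by_cases hi : i + 1 < d
  · rw [hop_eq i hi, heckeOp_apply, hv J hJ, hv _ (hE hi J hJ)]
    simp
  · simp [QPoly.hop, hi]

theorem VanishOn.hopDual {E : Set (Fin d → Fin n)} {v : Tens K n d} (hv : VanishOn E v) (i : ℕ)
    (hE : ∀ hi : d - 2 - i + 1 < d, ∀ J ∈ E, J ∘ adj (d - 2 - i) hi ∈ E) :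
    VanishOn E (hopDual q n d i v) := fun J hJ => by
  rw [dualFamily_apply, Pi.sub_apply, Pi.smul_apply, hv J hJ, hv.hop _ hE J hJ, smul_zero, sub_zero]

theorem VanishOn.symOp {E : Set (Fin d → Fin n)} {T : ℕ → Tens K n d →ₗ[K] Tens K n d}
    {v : Tens K n d} (hv : VanishOn E v)
    (hT : ∀ i < a, ∀ v, VanishOn E v → VanishOn E (T i v)) : VanishOn E (symOp q T a v) := by
  induction a generalizing v with
  | zero => exact hv
  | succ a ih =>
    intro J hJ
    rw [symOp_succ_apply, Pi.add_apply, Pi.smul_apply, hv J hJ,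
      ih (hT a a.lt_succ_self v hv) (fun i hi => hT i (by omega)) J hJ, smul_zero, add_zero]

theorem VanishOn.symOp_hop {E : Set (Fin d → Fin n)} {v : Tens K n d} (hv : VanishOn E v)
    (hE : ∀ i < a, ∀ hi : i + 1 < d, ∀ J ∈ E, J ∘ adj i hi ∈ E) :
    VanishOn E (QPoly.symOp q (QPoly.hop q n d) a v) :=
  hv.symOp fun i hi _ hv => hv.hop i (hE i hi)

theorem VanishOn.symOp_hopDual {E : Set (Fin d → Fin n)} {v : Tens K n d} (hv : VanishOn E v)
    (hb : b + 1 ≤ d) (hE : ∀ i, d - 1 ≤ i + b → ∀ hi : i + 1 < d, ∀ J ∈ E, J ∘ adj i hi ∈ E) :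
    VanishOn E (QPoly.symOp q (QPoly.hopDual q n d) b v) :=
  hv.symOp fun i hi _ hv => hv.hopDual i (hE _ (by omega))

/-- The set of the constant words. -/
def constWords (d n : ℕ) : Set (Fin d → Fin n) := Set.range fun x _ => x

theorem constWords_comp {J : Fin d → Fin n} (hJ : J ∈ constWords d n) (σ : Fin d → Fin d) :
    J ∘ σ ∈ constWords d n := by
  obtain ⟨x, rfl⟩ := hJ
  exact ⟨x, rfl⟩

theorem vanishOn_constWords_symOp {v : Tens K n d} (hv : VanishOn (constWords d n) v) (a : ℕ) :
    VanishOn (constWords d n) (symOp q (hop q n d) a v) :=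
  hv.symOp_hop fun _ _ _ _ hJ => constWords_comp hJ _

theorem vanishOn_constWords_symOp_dual {v : Tens K n d} (hv : VanishOn (constWords d n) v)
    (hb : b + 1 ≤ d) : VanishOn (constWords d n) (symOp q (hopDual q n d) b v) :=
  hv.symOp_hopDual hb fun _ _ _ _ hJ => constWords_comp hJ _

/-- An eigenvector of a generator with nonzero eigenvalue has a support stable under the
corresponding adjacent transposition. -/
theorem apply_comp_adj_ne_zero {c : K} (hc : c ≠ 0) {w : Tens K n d} (i : ℕ) (hi : i + 1 < d)
    (hw : hop q n d i w = c • w) {J : Fin d → Fin n} (hJ : w J ≠ 0) : w (J ∘ adj i hi) ≠ 0 := by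
  rcases lt_trichotomy (J ⟨i, Nat.lt_of_succ_lt hi⟩) (J ⟨i + 1, hi⟩) with h | h | h
  · rw [← hop_apply_lt (q := q) i hi w J h, hw]
    exact mul_ne_zero hc hJ
  · have : J ∘ adj i hi = J := by
      funext s
      simp only [Function.comp, Equiv.swap_apply_def]
      split_ifs with h1 h2
      · rw [h1, h]
      · rw [h2, h]
      · rfl
    rwa [this]
  · have e := hop_apply_lt (q := q) i hi w (J ∘ adj i hi) (by simpa using h)
    rw [hw, comp_adj_adj] at e
    intro h0
    rw [Pi.smul_apply, h0, smul_zero] at e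
    exact hJ e.symm

theorem apply_eq_zero_of_eq (hq : q ≠ 0) (hq2 : q ^ 2 + 1 ≠ 0) {w : Tens K n d} (i : ℕ) (hi : i + 1 < d)
    (hw : hop q n d i w = (-q⁻¹) • w) {J : Fin d → Fin n}
    (hJ : J ⟨i, Nat.lt_of_succ_lt hi⟩ = J ⟨i + 1, hi⟩) : w J = 0 := by
  have e := hop_apply_eq (q := q) i hi w J hJ
  rw [hw, Pi.smul_apply, smul_eq_mul] at e
  by_contra h
  have e' := mul_right_cancel₀ h e
  apply hq2
  field_simp at e'
  linear_combination -e'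

theorem hop_eq_of_isSym_dual {w : Tens K n d} (h : IsSym q (hopDual q n d) b w) (i : ℕ)
    (hi : i + 1 < d) (hb : d ≤ i + b) : hop q n d i w = (-q⁻¹) • w := by
  have := (dualFamily_eq_smul_iff (d - 2 - i)).1 (h (d - 2 - i) (by omega))
  rwa [show d - 2 - (d - 2 - i) = i by omega] at this

/-- An antisymmetric tensor has no component in a word with a repeated letter. -/
theorem apply_eq_zero_of_repeat (hq : q ≠ 0) (hq2 : q ^ 2 + 1 ≠ 0) {w : Tens K n d}
    (h : IsSym q (hopDual q n d) b w) {s t : ℕ} (ht : t < d) (hst : s < t) (hb : d ≤ s + b)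
    {J : Fin d → Fin n} (hJ : J ⟨s, hst.trans ht⟩ = J ⟨t, ht⟩) : w J = 0 := by
  induction t, (show s + 1 ≤ t from hst) using Nat.le_induction generalizing J with
  | base => exact apply_eq_zero_of_eq hq hq2 s ht (hop_eq_of_isSym_dual h s ht hb) hJ
  | succ t hle ih =>
    by_contra hne
    refine apply_comp_adj_ne_zero (neg_ne_zero.2 (inv_ne_zero hq)) t ht
      (hop_eq_of_isSym_dual h t ht (by omega)) hne (ih (by omega) (by omega) ?_)
    simp only [Function.comp_apply, Equiv.swap_apply_left]
    rw [← hJ]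
    congr 1
    exact Equiv.swap_apply_of_ne_of_ne (by simp [Fin.ext_iff]; omega) (by simp [Fin.ext_iff]; omega)

/-- A nonempty set of words, stable under the permutations of the positions below `a` and of those from
`a` on, contains a word which is weakly increasing below `a` and weakly decreasing from `a` on. -/
theorem exists_block_sorted (a : ℕ) (S : Set (Fin d → Fin n)) (hS : S.Nonempty)
    (hcl : ∀ J ∈ S, ∀ (i : ℕ) (hi : i + 1 < d), i + 1 ≠ a → J ∘ adj i hi ∈ S) :
    ∃ J ∈ S, (∀ s t : Fin d, s ≤ t → (t : ℕ) < a → J s ≤ J t) ∧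
      ∀ s t : Fin d, s ≤ t → a ≤ (s : ℕ) → J t ≤ J s := by
  obtain ⟨J, hJ, h⟩ := exists_sorted S hS fun t => if t < a then (t : ℤ) else -t
  refine ⟨J, hJ, ?_, ?_⟩
  · rintro ⟨s, hs⟩ ⟨t, ht⟩ hst hta
    have hst' : s ≤ t := hst
    simp only at hta
    induction t, hst' using Nat.le_induction with
    | base => exact le_rfl
    | succ t hst' ih =>
      refine (ih (by omega) hst' (by omega)).trans ?_
      have h1 := h t ht (hcl J hJ t ht (by omega))
      rw [if_pos (by omega), if_pos hta] at h1
      push_cast at h1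
      rw [Fin.le_def]
      linarith
  · rintro ⟨s, hs⟩ ⟨t, ht⟩ hst hsa
    have hst' : s ≤ t := hst
    simp only at hsa
    induction t, hst' using Nat.le_induction with
    | base => exact le_rfl
    | succ t hst' ih =>
      refine le_trans ?_ (ih (by omega) hst')
      have h1 := h t ht (hcl J hJ t ht (by omega))
      rw [if_neg (by omega), if_neg (by omega)] at h1
      push_cast at h1
      rw [Fin.le_def]
      linarith

/-- The value of a symmetrized tensor at a word whose largest letter `x` fills exactly the last `m` of the
positions `0, …, a`: only the summands which leave `x` in position `a` contribute. -/
theorem symOp_hop_apply {x : Fin n} (ha : a < d) {m : ℕ} {J₀ : Fin d → Fin n} {v : Tens K n d}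
    (hx : ∃ t, J₀ t = x) (hle : ∀ t, J₀ t ≤ x)
    (h1 : ∀ t : Fin d, (t : ℕ) ≤ a → a + 1 ≤ t + m → J₀ t = x)
    (h2 : ∀ t : Fin d, (t : ℕ) + m < a + 1 → J₀ t < x)
    (hv : ∀ J : Fin d → Fin n, (∃ t, J t = x) → (∀ t, J t ≤ x) →
      (∀ t : Fin d, a < t → J t = J₀ t) → J ⟨a, ha⟩ ≠ x → v J = 0) (hm : m ≤ a + 1) :
    symOp q (hop q n d) a v J₀ = qInt q m * v J₀ := by
  induction a generalizing m v with
  | zero =>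
    obtain rfl | rfl : m = 0 ∨ m = 1 := by omega
    · rw [qInt_zero, zero_mul]
      exact hv J₀ hx hle (fun _ _ => rfl) (h2 ⟨0, ha⟩ (by simp)).ne
    · simp [qInt, symOp_zero_apply]
  | succ a ih =>
    obtain _ | m := m
    · rw [qInt_zero, zero_mul]
      refine VanishOn.symOp_hop (E := {J | (∃ t, J t = x) ∧ (∀ t, J t ≤ x) ∧
        (∀ t : Fin d, a + 1 < t → J t = J₀ t) ∧ ∀ t : Fin d, (t : ℕ) ≤ a + 1 → J t < x})
        (v := v) (fun J hJ => hv J hJ.1 hJ.2.1 hJ.2.2.1 (hJ.2.2.2 _ le_rfl).ne) ?_ J₀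
        ⟨hx, hle, fun _ _ => rfl, fun t ht => h2 t (by omega)⟩
      rintro i hia hi J ⟨⟨t, ht⟩, h3, h4, h5⟩
      refine ⟨⟨adj i hi t, by simpa using ht⟩, fun t => h3 _, fun t ht => ?_, fun t ht => h5 _ ?_⟩
      · rw [Function.comp_apply, Equiv.swap_apply_of_ne_of_ne, h4 t ht]
        · rw [ne_eq, Fin.ext_iff]; simp only; omega
        · rw [ne_eq, Fin.ext_iff]; simp only; omega
      · rw [adj_val]; split_ifs <;> omega
    · have hJa : J₀ ⟨a + 1, ha⟩ = x := h1 _ le_rfl (by simp only; omega)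
      have hT : ∀ J : Fin d → Fin n, (∃ t, J t = x) → (∀ t, J t ≤ x) →
          (∀ t : Fin d, a < t → J t = J₀ t) → J ⟨a, by omega⟩ ≠ x → hop q n d a v J = 0 := by
        intro J h3 h4 h5 h6
        have h7 : J ⟨a + 1, ha⟩ = x := by rw [h5 _ (by simp), hJa]
        have hlt : J ⟨a, by omega⟩ < J ⟨a + 1, ha⟩ := by rw [h7]; exact (h4 _).lt_of_ne h6
        rw [hop_apply_lt a ha v J hlt]
        refine hv _ ⟨⟨a, by omega⟩, by simpa using h7⟩ (fun t => h4 _)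
          (fun t ht => ?_) (by simpa using h6)
        rw [Function.comp_apply, Equiv.swap_apply_of_ne_of_ne, h5 t (by omega)]
        · rw [ne_eq, Fin.ext_iff]; simp only; omega
        · rw [ne_eq, Fin.ext_iff]; simp only; omega
      rw [symOp_succ_apply, Pi.add_apply, Pi.smul_apply, smul_eq_mul,
        ih (m := m) (by omega) (fun t ht h => h1 t (by omega) (by omega)) (fun t ht => h2 t (by omega))
          hT (by omega), qInt_succ]
      obtain _ | m := m
      · rw [qInt_zero]; ring
      · rw [hop_apply_eq a ha v J₀ ((h1 ⟨a, by omega⟩ (by simp) (by simp only; omega)).trans hJa.symm)]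
        ring

/-- Antisymmetrization does not change the coefficient of a word whose largest letter stands in the new
position and not after it, if all words with this letter further to the right are missing. -/
theorem symOp_hopDual_apply {x : Fin n} {p : ℕ} (hp : p + b + 1 = d) {J₀ : Fin d → Fin n}
    {v : Tens K n d} (hx : J₀ ⟨p, by omega⟩ = x) (hle : ∀ t, J₀ t ≤ x) (hlt : ∀ t : Fin d, p < t → J₀ t < x)
    (hv : ∀ J : Fin d → Fin n, (∀ t, J t ≤ x) → J ⟨p, by omega⟩ < x →
      (∃ t : Fin d, p < t ∧ J t = x) → v J = 0) :
    symOp q (hopDual q n d) b v J₀ = v J₀ := by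
  obtain _ | b := b
  · rfl
  have hp' : p + 1 < d := by omega
  have key : VanishOn {J : Fin d → Fin n | J ⟨p, by omega⟩ = x ∧ (∀ t, J t ≤ x) ∧
      ∀ t : Fin d, p < t → J t < x} (hopDual q n d b v) := by
    rintro J ⟨h1, h2, h3⟩
    have h4 : J ⟨p + 1, hp'⟩ < J ⟨p, by omega⟩ := by rw [h1]; exact h3 _ (by simp)
    rw [dualFamily_apply, Pi.sub_apply, show d - 2 - b = p by omega, hop_apply_gt p hp' v J h4,
      hv (J ∘ adj p hp') (fun t => h2 _) (by simpa [← h1] using h4)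
        ⟨⟨p + 1, hp'⟩, by simp, by simpa using h1⟩, Pi.smul_apply, smul_eq_mul, add_zero, sub_self]
  rw [symOp_succ_apply, Pi.add_apply, Pi.smul_apply, key.symOp_hopDual (by omega) ?_ J₀ ⟨hx, hle, hlt⟩,
    smul_zero, add_zero]
  rintro i hi hi' J ⟨h1, h2, h3⟩
  refine ⟨?_, fun t => h2 _, fun t ht => h3 _ ?_⟩
  · rw [Function.comp_apply, Equiv.swap_apply_of_ne_of_ne, h1]
    · rw [ne_eq, Fin.ext_iff]; simp only; omega
    · rw [ne_eq, Fin.ext_iff]; simp only; omega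
  · rw [adj_val]; split_ifs <;> omega

end Exactness
end QPoly

namespace QPoly

section Homotopy
variable {K : Type u} [Field K] {q : K} {d n a b : ℕ}

/-- The letter of `J` in position `t` is the largest letter of `J`. -/
def IsTop (J : Fin d → Fin n) (t : Fin d) : Prop := ∀ s, J s ≤ J t

open scoped Classical in
/-- The multiplicity of the largest letter. -/
noncomputable def topCount (J : Fin d → Fin n) : ℕ := (Finset.univ.filter (IsTop J)).card

theorem isTop_comp (J : Fin d → Fin n) (σ : Equiv.Perm (Fin d)) (t : Fin d) :
    IsTop (J ∘ σ) t ↔ IsTop J (σ t) :=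
  (σ.surjective.forall (p := fun s => J s ≤ J (σ t))).symm

theorem topCount_comp (J : Fin d → Fin n) (σ : Equiv.Perm (Fin d)) :
    topCount (J ∘ σ) = topCount J := by
  classical
  exact Finset.card_bijective σ σ.bijective fun t => by simp [isTop_comp]

theorem exists_isTop (hd : 0 < d) (J : Fin d → Fin n) : ∃ t, IsTop J t := by
  have : Nonempty (Fin d) := ⟨⟨0, hd⟩⟩
  exact Finite.exists_max J

theorem IsTop.le_iff {J : Fin d → Fin n} {s t : Fin d} (h : IsTop J t) : IsTop J s ↔ J s = J t :=
  ⟨fun hs => le_antisymm (h s) (hs t), fun hs r => (h r).trans hs.ge⟩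

open scoped Classical in
/-- The components of `w` in the words whose letter in position `p` is the largest one, divided by the
quantum integer of the multiplicity of that letter. -/
noncomputable def topPart (q : K) (p : Fin d) (w : Tens K n d) : Tens K n d := fun J =>
  if IsTop J p then (qInt q (topCount J))⁻¹ * w J else 0

theorem topPart_of_isTop {p : Fin d} {w : Tens K n d} {J : Fin d → Fin n} (h : IsTop J p) :
    topPart q p w J = (qInt q (topCount J))⁻¹ * w J := if_pos h

theorem topPart_of_not {p : Fin d} {w : Tens K n d} {J : Fin d → Fin n} (h : ¬ IsTop J p) :
    topPart q p w J = 0 := if_neg h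

theorem hop_mul (D v : Tens K n d) (i : ℕ) (hD : ∀ hi : i + 1 < d, ∀ J, D (J ∘ adj i hi) = D J) :
    hop q n d i (D * v) = D * hop q n d i v := by
  by_cases hi : i + 1 < d
  · funext J
    rw [Pi.mul_apply, hop_eq i hi, heckeOp_apply, heckeOp_apply, Pi.mul_apply, Pi.mul_apply, hD hi J]
    split_ifs <;> ring
  · simp [hop, hi]

theorem hop_topPart (p : Fin d) (v : Tens K n d) (i : ℕ) (h1 : i ≠ p) (h2 : i + 1 ≠ p) :
    hop q n d i (topPart q p v) = topPart q p (hop q n d i v) := by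
  classical
  have e : ∀ v : Tens K n d, topPart q p v =
      (fun J => if IsTop J p then (qInt q (topCount J))⁻¹ else 0) * v := fun v => by
    funext J
    rw [Pi.mul_apply, topPart, ite_mul, zero_mul]
  rw [e, e, hop_mul]
  intro hi J
  simp only [isTop_comp, topCount_comp]
  rw [Equiv.swap_apply_of_ne_of_ne]
  · rw [ne_eq, Fin.ext_iff]; simp only; omega
  · rw [ne_eq, Fin.ext_iff]; simp only; omega

theorem topPart_smul (p : Fin d) (c : K) (v : Tens K n d) :
    topPart q p (c • v) = c • topPart q p v := by
  funext J
  simp only [topPart, Pi.smul_apply, smul_eq_mul]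
  split_ifs <;> ring

theorem isSym_topPart {w : Tens K n d} (h : IsSym q (hop q n d) a w) {p : Fin d} (hp : a ≤ p) :
    IsSym q (hop q n d) a (topPart q p w) := fun i hi => by
  rw [hop_topPart p w i (by omega) (by omega), h i hi, topPart_smul]

theorem isSym_dual_topPart {w : Tens K n d} (h : IsSym q (hopDual q n d) b w) {p : Fin d}
    (hp : (p : ℕ) + b < d) : IsSym q (hopDual q n d) b (topPart q p w) := fun i hi => by
  have e := (dualFamily_eq_smul_iff i).1 (h i hi)
  rw [dualFamily_eq_smul_iff, hop_topPart p w _ (by omega) (by omega), e, topPart_smul]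

theorem vanishOn_constWords_topPart {w : Tens K n d} (h : VanishOn (constWords d n) w) (p : Fin d) :
    VanishOn (constWords d n) (topPart q p w) := fun J hJ => by
  simp only [topPart, h J hJ, mul_zero, ite_self]

/-- In a sorted word the largest letter fills an interval of positions ending at `a`. -/
theorem exists_interval {J : Fin d → Fin n} (ha : a < d) (htop : IsTop J ⟨a, ha⟩)
    (hlt : ∀ t : Fin d, a < t → J t < J ⟨a, ha⟩)
    (hmono : ∀ s t : Fin d, s ≤ t → (t : ℕ) < a → J s ≤ J t) :
    0 < topCount J ∧ topCount J ≤ a + 1 ∧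
      (∀ t : Fin d, (t : ℕ) ≤ a → a + 1 ≤ t + topCount J → J t = J ⟨a, ha⟩) ∧
      (∀ t : Fin d, (t : ℕ) + topCount J < a + 1 → J t < J ⟨a, ha⟩) ∧
      (topCount J = d → J ∈ constWords d n) := by
  classical
  set x := J ⟨a, ha⟩ with hx
  have hex : ∃ c, ∃ h : c < d, J ⟨c, h⟩ = x := ⟨a, ha, rfl⟩
  obtain ⟨hc, hcx⟩ := Nat.find_spec hex
  have hmin := fun c (h : c < Nat.find hex) => Nat.find_min hex h
  have hca : Nat.find hex ≤ a := Nat.find_min' hex ⟨ha, rfl⟩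
  set c := Nat.find hex
  have hin : ∀ t : Fin d, IsTop J t ↔ c ≤ t ∧ (t : ℕ) ≤ a := fun t => by
    rw [htop.le_iff]
    constructor
    · intro h
      refine ⟨?_, ?_⟩
      · by_contra hlt'
        exact hmin t (by omega) ⟨t.2, h⟩
      · by_contra hlt'
        exact (hlt t (by omega)).ne h
    · rintro ⟨h1, h2⟩
      rcases h2.lt_or_eq with h3 | h3
      · exact le_antisymm (htop t) (hcx.ge.trans (hmono ⟨c, hc⟩ t h1 h3))
      · congr 1; exact Fin.ext h3
  have hcard : topCount J = a + 1 - c := by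
    have : (Finset.univ.filter (IsTop J)) = Finset.Icc (⟨c, hc⟩ : Fin d) ⟨a, ha⟩ := by
      ext t
      simp [hin, Fin.le_def]
    rw [topCount, this, Fin.card_Icc]
  rw [hcard]
  refine ⟨by omega, by omega, fun t h1 h2 => htop.le_iff.1 ((hin t).2 ⟨by omega, h1⟩),
    fun t h => (htop t).lt_of_ne fun he => ?_, fun h => ⟨x, ?_⟩⟩
  · have := ((hin t).1 (htop.le_iff.2 he)).1
    omega
  · funext t
    exact (htop.le_iff.1 ((hin t).2 ⟨by omega, by omega⟩)).symm

/-- A cycle of the de Rham complex vanishes if the largest letter always occurs in its exterior part,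
constant words apart. Otherwise its support contains a word that is increasing in the symmetric part and
decreasing in the exterior part, and there the differential is a nonzero multiple of the cycle. -/
theorem eq_zero_of_symOp_hop_eq_zero (hq : q ≠ 0) (hq2 : q ^ 2 + 1 ≠ 0)
    (hint : ∀ m, 0 < m → m < d → qInt q m ≠ 0) (hd : a + b + 1 = d) {w : Tens K n d}
    (hw : w ∈ symAlt q n d a (b + 1)) (hw0 : symOp q (hop q n d) a w = 0)
    (hconst : VanishOn (constWords d n) w)
    (htop : ∀ J : Fin d → Fin n, (∀ t : Fin d, a ≤ t → ¬ IsTop J t) → w J = 0) : w = 0 := by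
  by_contra hne
  have hq' : -q⁻¹ ≠ 0 := neg_ne_zero.2 (inv_ne_zero hq)
  obtain ⟨J, hJ, hmono, hanti⟩ := exists_block_sorted a {J : Fin d → Fin n | w J ≠ 0}
    (by by_contra h; exact hne (funext fun J => by_contra fun hJ => h ⟨J, hJ⟩))
    (fun J hJ i hi hia => by
      rcases lt_or_ge (i + 1) a with h | h
      · exact apply_comp_adj_ne_zero hq i hi (hw.1 i h) hJ
      · exact apply_comp_adj_ne_zero hq' i hi (hop_eq_of_isSym_dual hw.2 i hi (by omega)) hJ)
  obtain ⟨t, hta, ht⟩ : ∃ t : Fin d, a ≤ t ∧ IsTop J t := by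
    by_contra h; push Not at h; exact hJ (htop J h)
  have had : a < d := by omega
  have hJa : IsTop J ⟨a, had⟩ := fun s => (ht s).trans (hanti ⟨a, had⟩ t hta le_rfl)
  have hlt : ∀ t : Fin d, a < t → J t < J ⟨a, had⟩ := fun t ht =>
    (hJa t).lt_of_ne fun he => hJ (apply_eq_zero_of_repeat hq hq2 hw.2 t.2 ht (by omega) he.symm)
  obtain ⟨h0, hle, h1, h2, h3⟩ := exists_interval had hJa hlt hmono
  have e := symOp_hop_apply (q := q) (v := w) had ⟨_, rfl⟩ hJa h1 h2
    (fun J' h4 h5 h6 h7 => htop J' fun t hta ht => ?_) hle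
  · rw [hw0] at e
    refine mul_ne_zero (hint _ h0 (lt_of_le_of_ne (by omega) fun h => hJ (hconst J (h3 h)))) hJ e.symm
  · obtain ⟨s, hs⟩ := h4
    have ht' : J' t = J ⟨a, had⟩ := le_antisymm (h5 t) (hs ▸ ht s)
    rcases hta.lt_or_eq with h | h
    · rw [h6 t h] at ht'
      exact (hlt t h).ne ht'
    · exact h7 (by rw [← ht']; congr 1; exact Fin.ext h)

/-- A cycle of the Koszul complex vanishes if the largest letter never occurs in its exterior part: at a
sorted word of its support the differential takes the same value as the cycle. -/
theorem eq_zero_of_symOp_hopDual_eq_zero (hq : q ≠ 0) (hd : a + b + 1 = d) {w : Tens K n d}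
    (hw : w ∈ symAlt q n d a (b + 1)) (hw0 : a ≠ 0 → symOp q (hopDual q n d) (b + 1) w = 0)
    (htop : ∀ J : Fin d → Fin n, (∃ t : Fin d, a ≤ t ∧ IsTop J t) → w J = 0) : w = 0 := by
  by_contra hne
  have hq' : -q⁻¹ ≠ 0 := neg_ne_zero.2 (inv_ne_zero hq)
  obtain ⟨J, hJ, hmono, hanti⟩ := exists_block_sorted a {J : Fin d → Fin n | w J ≠ 0}
    (by by_contra h; exact hne (funext fun J => by_contra fun hJ => h ⟨J, hJ⟩))
    (fun J hJ i hi hia => by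
      rcases lt_or_ge (i + 1) a with h | h
      · exact apply_comp_adj_ne_zero hq i hi (hw.1 i h) hJ
      · exact apply_comp_adj_ne_zero hq' i hi (hop_eq_of_isSym_dual hw.2 i hi (by omega)) hJ)
  obtain ⟨t, ht⟩ := exists_isTop (by omega) J
  have hnot : ∀ s : Fin d, a ≤ s → ¬ IsTop J s := fun s hs h => hJ (htop J ⟨s, hs, h⟩)
  have hta : (t : ℕ) < a := by by_contra h; exact hnot t (by omega) ht
  obtain _ | a := a
  · omega
  have had : a < d := by omega
  have hJa : IsTop J ⟨a, had⟩ := fun s =>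
    (ht s).trans (hmono t ⟨a, had⟩ (Nat.lt_succ_iff.1 hta) a.lt_succ_self)
  have e := symOp_hopDual_apply (q := q) (b := b + 1) (v := w) (p := a) (by omega) rfl hJa
    (fun t ht => (hJa t).lt_of_ne fun he => hnot t ht (hJa.le_iff.2 he))
    (fun J' h1 h2 ⟨t, h3, h4⟩ => htop J' ⟨t, h3, fun s => (h1 s).trans h4.ge⟩)
  rw [hw0 (by omega)] at e
  exact hJ e.symm

variable (hq : q ≠ 0) (hq2 : q ^ 2 + 1 ≠ 0) (hint : ∀ m, 0 < m → m < d → qInt q m ≠ 0)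
include hq

theorem symOp_hop_mem (hd : a + b + 1 ≤ d) {w : Tens K n d}
    (h : IsSym q (hop q n d) a w) (h' : IsSym q (hopDual q n d) b w) :
    symOp q (hop q n d) a w ∈ symAlt q n d (a + 1) b := by
  have hT := isHeckeFamily_hop (K := K) hq n d
  refine ⟨hT.isSym_symOp hq (by omega) h, h'.map fun i hi w => ?_⟩
  refine map_symOp (fun j hj w => ?_) w
  rw [dualFamily_apply, dualFamily_apply, map_sub, map_smul,
    hT.comm j (d - 2 - i) (by omega) (by omega)]

theorem symOp_hopDual_mem (hd : a + b + 1 ≤ d) {w : Tens K n d}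
    (h : IsSym q (hop q n d) a w) (h' : IsSym q (hopDual q n d) b w) :
    symOp q (hopDual q n d) b w ∈ symAlt q n d a (b + 1) := by
  have hT := isHeckeFamily_hop (K := K) hq n d
  refine ⟨h.map fun i hi w => ?_, hT.dual.isSym_symOp hq (by omega) h'⟩
  refine map_symOp (fun j hj w => ?_) w
  rw [dualFamily_apply, dualFamily_apply, map_sub, map_smul,
    hT.comm i (d - 2 - j) (by omega) (by omega)]

include hq2 in
theorem symOp_hop_symOp_hop (hd : a + b + 2 = d) {w : Tens K n d} (hw : w ∈ symAlt q n d a (b + 2)) :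
    symOp q (hop q n d) (a + 1) (symOp q (hop q n d) a w) = 0 :=
  (isHeckeFamily_hop hq n d).symOp_symOp_eq_zero hq hq2 (by omega) hw.1
    (hop_eq_of_isSym_dual hw.2 a (by omega) (by omega))

include hq2 in
theorem symOp_hopDual_symOp_hopDual (hd : a + b + 2 = d) {w : Tens K n d}
    (hw : w ∈ symAlt q n d (a + 2) b) :
    symOp q (hopDual q n d) (b + 1) (symOp q (hopDual q n d) b w) = 0 := by
  refine (isHeckeFamily_hop hq n d).dual.symOp_symOp_eq_zero hq hq2 (by omega) hw.2 ?_
  rw [dualFamily_apply, show d - 2 - b = a by omega, hw.1 a (by omega)]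
  module

/-- The de Rham differential and the Koszul differential anticommute, because their anticommutator is
the quantum integer of the degree, which vanishes. -/
theorem symOp_hop_symOp_hopDual (h0 : qInt q d = 0) (hd : a + b + 2 = d) {w : Tens K n d}
    (hw : w ∈ symAlt q n d (a + 1) (b + 1)) :
    symOp q (hop q n d) a (symOp q (hopDual q n d) (b + 1) w) =
      -symOp q (hopDual q n d) b (symOp q (hop q n d) (a + 1) w) := by
  have e := (isHeckeFamily_hop hq n d).symOp_dual_add hq hd hw.1 hw.2
  rw [h0, zero_smul] at e
  exact eq_neg_of_add_eq_zero_right e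

include hq2 hint in
/-- Exactness of the de Rham complex away from the constant words. The preimage is a cycle of the Koszul
complex if the given tensor is. -/
theorem exists_symOp_hop_eq (h0 : qInt q d = 0) (hd : a + b + 1 = d) {w : Tens K n d}
    (hw : w ∈ symAlt q n d (a + 1) b) (hw0 : b ≠ 0 → symOp q (hop q n d) (a + 1) w = 0)
    (hconst : VanishOn (constWords d n) w) :
    ∃ g ∈ symAlt q n d a (b + 1), symOp q (hop q n d) a g = w ∧
      (symOp q (hopDual q n d) b w = 0 → a ≠ 0 → symOp q (hopDual q n d) (b + 1) g = 0) := by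
  have hq' : -q⁻¹ ≠ 0 := neg_ne_zero.2 (inv_ne_zero hq)
  have had : a < d := by omega
  -- the contracting homotopy moves the largest letter into the exterior part
  set v := topPart q ⟨a, had⟩ w with hv
  set g := symOp q (hopDual q n d) b v with hg
  have hgmem : g ∈ symAlt q n d a (b + 1) :=
    symOp_hopDual_mem hq hd.le (isSym_topPart (hw.1.mono (by omega)) le_rfl)
      (isSym_dual_topPart hw.2 (by simp only; omega))
  have hgconst : VanishOn (constWords d n) g :=
    vanishOn_constWords_symOp_dual (vanishOn_constWords_topPart hconst _) (by omega)
  have hgtop : ∀ J : Fin d → Fin n, (∀ t : Fin d, a ≤ t → ¬ IsTop J t) → g J = 0 := fun J hJ =>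
    VanishOn.symOp_hopDual (E := {J | ∀ t : Fin d, a ≤ t → ¬ IsTop J t}) (v := v)
      (fun J hJ => topPart_of_not (hJ _ le_rfl)) (by omega)
      (fun i hi hi' J hJ t ht => by
        rw [isTop_comp]
        refine hJ _ ?_
        rw [adj_val]; split_ifs <;> omega) J hJ
  have hdw : symOp q (hop q n d) a g ∈ symAlt q n d (a + 1) b :=
    symOp_hop_mem hq hd.le hgmem.1 (hgmem.2.mono (by omega))
  -- the error of the homotopy satisfies the conditions of `eq_zero_of_symOp_hop_eq_zero`
  set u := w - symOp q (hop q n d) a g with hu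
  have humem : u ∈ symAlt q n d (a + 1) b := sub_mem hw hdw
  have huconst : VanishOn (constWords d n) u := fun J hJ => by
    rw [hu, Pi.sub_apply, hconst J hJ, vanishOn_constWords_symOp hgconst a J hJ, sub_zero]
  have hutop : ∀ J : Fin d → Fin n, (∀ t : Fin d, a + 1 ≤ t → ¬ IsTop J t) → u J = 0 := by
    by_contra hcon
    push Not at hcon
    obtain ⟨J, ⟨hJ, hJu⟩, hmono, hanti⟩ := exists_block_sorted (a + 1)
      {J : Fin d → Fin n | (∀ t : Fin d, a + 1 ≤ t → ¬ IsTop J t) ∧ u J ≠ 0} hcon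
      (fun J hJ i hi hia => by
        refine ⟨fun t ht => ?_, ?_⟩
        · rw [isTop_comp]
          refine hJ.1 _ ?_
          rw [adj_val]; split_ifs <;> omega
        · rcases lt_or_ge (i + 1) (a + 1) with h | h
          · exact apply_comp_adj_ne_zero hq i hi (humem.1 i h) hJ.2
          · exact apply_comp_adj_ne_zero hq' i hi (hop_eq_of_isSym_dual humem.2 i hi (by omega)) hJ.2)
    obtain ⟨t, ht⟩ := exists_isTop (by omega) J
    have hta : (t : ℕ) ≤ a := by by_contra h; exact hJ t (by omega) ht
    have hJa : IsTop J ⟨a, had⟩ := fun s =>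
      (ht s).trans (hmono t ⟨a, had⟩ hta a.lt_succ_self)
    have hlt : ∀ t : Fin d, a < t → J t < J ⟨a, had⟩ := fun t ht =>
      (hJa t).lt_of_ne fun he => hJ t ht (hJa.le_iff.2 he)
    obtain ⟨h0', hle, h1, h2, h3⟩ := exists_interval had hJa hlt
      fun s t hst ht => hmono s t hst (by omega)
    have e1 := symOp_hop_apply (q := q) (v := g) had ⟨_, rfl⟩ hJa h1 h2
      (fun J' h4 h5 h6 h7 => hgtop J' fun t hta ht => by
        obtain ⟨s, hs⟩ := h4
        have ht' : J' t = J ⟨a, had⟩ := le_antisymm (h5 t) (hs ▸ ht s)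
        rcases hta.lt_or_eq with h | h
        · rw [h6 t h] at ht'
          exact (hlt t h).ne ht'
        · exact h7 (by rw [← ht']; congr 1; exact Fin.ext h)) hle
    have e2 : g J = v J := symOp_hopDual_apply (q := q) (v := v) (p := a) (by omega) rfl hJa hlt
      (fun J' h4 h5 ⟨t, h6, h7⟩ => topPart_of_not fun h => by
        have := h t
        rw [h7] at this
        exact absurd h5 this.not_gt)
    refine hJu ?_
    rw [hu, Pi.sub_apply, e1, e2, hv, topPart_of_isTop hJa]
    rcases eq_or_ne (topCount J) d with h | h
    · rw [hconst J (h3 h)]; ring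
    · rw [mul_inv_cancel_left₀ (hint _ h0' (lt_of_le_of_ne (by omega) h)), sub_self]
  have hwg : symOp q (hop q n d) a g = w := by
    rw [eq_comm, ← sub_eq_zero, ← hu]
    obtain _ | b := b
    · funext J
      exact hutop J fun t ht => absurd t.2 (by omega)
    · refine eq_zero_of_symOp_hop_eq_zero hq hq2 hint (by omega) humem ?_ huconst hutop
      rw [hu, map_sub, hw0 (by omega), symOp_hop_symOp_hop hq hq2 (b := b) (by omega) hgmem, sub_zero]
  -- the Koszul differential of `g` is a de Rham cycle with the largest letter in its exterior part
  refine ⟨g, hgmem, hwg, fun hκ ha => ?_⟩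
  obtain _ | a := a
  · exact absurd rfl ha
  refine eq_zero_of_symOp_hop_eq_zero (a := a) (b := b + 1) hq hq2 hint (by omega)
    (symOp_hopDual_mem (a := a) (b := b + 1) hq (by omega) (hgmem.1.mono (by omega)) hgmem.2) ?_
    (vanishOn_constWords_symOp_dual hgconst (by omega)) fun J hJ => ?_
  · rw [symOp_hop_symOp_hopDual hq h0 (by omega) hgmem, hwg, hκ, neg_zero]
  · refine VanishOn.symOp_hopDual (E := {J | ∀ t : Fin d, a ≤ t → ¬ IsTop J t}) (v := g)
      (fun J hJ => hgtop J fun t ht => hJ t (by omega)) (by omega)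
      (fun i hi hi' J hJ t ht => ?_) J hJ
    rw [isTop_comp]
    refine hJ _ ?_
    rw [adj_val]; split_ifs <;> omega

include hq2 hint in
/-- Exactness of the Koszul complex away from the constant words. -/
theorem exists_symOp_hopDual_eq (hd : a + b + 1 = d) {w : Tens K n d}
    (hw : w ∈ symAlt q n d a (b + 1)) (hw0 : a ≠ 0 → symOp q (hopDual q n d) (b + 1) w = 0)
    (hconst : VanishOn (constWords d n) w) :
    ∃ g ∈ symAlt q n d (a + 1) b, symOp q (hopDual q n d) b g = w := by
  have hq' : -q⁻¹ ≠ 0 := neg_ne_zero.2 (inv_ne_zero hq)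
  have had : a < d := by omega
  -- the contracting homotopy moves the largest letter into the symmetric part
  set v := topPart q ⟨a, had⟩ w with hv
  set g := symOp q (hop q n d) a v with hg
  have hgmem : g ∈ symAlt q n d (a + 1) b :=
    symOp_hop_mem hq hd.le (isSym_topPart hw.1 le_rfl)
      (isSym_dual_topPart (hw.2.mono (by omega)) (by simp only; omega))
  have hgtop : ∀ J : Fin d → Fin n, (∃ t : Fin d, a + 1 ≤ t ∧ IsTop J t) → g J = 0 := fun J hJ =>
    VanishOn.symOp_hop (E := {J | ∃ t : Fin d, a + 1 ≤ t ∧ IsTop J t}) (v := v)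
      (fun J ⟨t, hat, ht⟩ => by
        by_cases h : IsTop J ⟨a, had⟩
        · rw [hv, topPart_of_isTop h,
            apply_eq_zero_of_repeat hq hq2 hw.2 (s := a) t.2 hat (by omega) (ht.le_iff.1 h), mul_zero]
        · exact topPart_of_not h)
      (fun i hi hi' J ⟨t, hat, ht⟩ => by
        refine ⟨t, hat, ?_⟩
        rw [isTop_comp, Equiv.swap_apply_of_ne_of_ne]
        · exact ht
        · rw [ne_eq, Fin.ext_iff]; simp only; omega
        · rw [ne_eq, Fin.ext_iff]; simp only; omega) J hJ
  have hκmem : symOp q (hopDual q n d) b g ∈ symAlt q n d a (b + 1) :=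
    symOp_hopDual_mem hq hd.le (hgmem.1.mono (by omega)) hgmem.2
  -- the error of the homotopy satisfies the conditions of `eq_zero_of_symOp_hopDual_eq_zero`
  set u := w - symOp q (hopDual q n d) b g with hu
  have humem : u ∈ symAlt q n d a (b + 1) := sub_mem hw hκmem
  refine ⟨g, hgmem, ?_⟩
  rw [eq_comm, ← sub_eq_zero, ← hu]
  refine eq_zero_of_symOp_hopDual_eq_zero hq hd humem (fun ha => ?_) ?_
  · obtain _ | a := a
    · exact absurd rfl ha
    rw [hu, map_sub, hw0 ha, symOp_hopDual_symOp_hopDual hq hq2 (a := a) (by omega) hgmem, sub_zero]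
  · by_contra hcon
    push Not at hcon
    obtain ⟨J, ⟨⟨t, hat, ht⟩, hJu⟩, hmono, hanti⟩ := exists_block_sorted a
      {J : Fin d → Fin n | (∃ t : Fin d, a ≤ t ∧ IsTop J t) ∧ u J ≠ 0} hcon
      (fun J ⟨⟨t, hat, ht⟩, hJu⟩ i hi hia => by
        refine ⟨⟨adj i hi t, ?_, by simpa [isTop_comp] using ht⟩, ?_⟩
        · rw [adj_val]; split_ifs <;> omega
        · rcases lt_or_ge (i + 1) a with h | h
          · exact apply_comp_adj_ne_zero hq i hi (humem.1 i h) hJu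
          · exact apply_comp_adj_ne_zero hq' i hi (hop_eq_of_isSym_dual humem.2 i hi (by omega)) hJu)
    have hJa : IsTop J ⟨a, had⟩ := fun s => (ht s).trans (hanti ⟨a, had⟩ t hat le_rfl)
    have hlt : ∀ t : Fin d, a < t → J t < J ⟨a, had⟩ := fun t ht =>
      (hJa t).lt_of_ne fun he =>
        hJu (apply_eq_zero_of_repeat hq hq2 humem.2 t.2 ht (by omega) he.symm)
    obtain ⟨h0', hle, h1, h2, h3⟩ := exists_interval had hJa hlt hmono
    have e1 : g J = _ := symOp_hop_apply (q := q) (v := v) had ⟨_, rfl⟩ hJa h1 h2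
      (fun J' h4 h5 h6 h7 => topPart_of_not fun h => h7 <| by
        obtain ⟨s, hs⟩ := h4
        exact le_antisymm (h5 _) (hs ▸ h s)) hle
    have e2 := symOp_hopDual_apply (q := q) (v := g) (p := a) (by omega) rfl hJa hlt
      (fun J' h4 h5 ⟨t, h6, h7⟩ => hgtop J' ⟨t, h6, fun s => (h4 s).trans h7.ge⟩)
    refine hJu ?_
    rw [hu, Pi.sub_apply, e2, e1, hv, topPart_of_isTop hJa]
    rcases eq_or_ne (topCount J) d with h | h
    · rw [hconst J (h3 h)]; ring
    · rw [mul_inv_cancel_left₀ (hint _ h0' (lt_of_le_of_ne (by omega) h)), sub_self]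

end Homotopy
end QPoly

namespace QPoly

/-! ### Morphisms and exact sequences of quantum polynomial functors -/

section Functors
variable {K : Type u} [Field K] {q : K} {d : ℕ}

/-- The component of a morphism of quantum polynomial functors at `V_n^{⊗ d}`. -/
noncomputable abbrev comp {F G : HQF K q d} (f : F ⟶ G) (X : Src K q d) :
    F.obj.obj X →ₗ[K] G.obj.obj X := (f.hom.app X).hom.hom

/-- A natural family of linear maps, as a morphism. -/
noncomputable def mkHom {F G : HQF K q d} (φ : ∀ X, F.obj.obj X →ₗ[K] G.obj.obj X)
    (h : ∀ {X Y : Src K q d} (f : X ⟶ Y) (x : F.obj.obj X),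
      φ Y ((F.obj.map f).hom.hom x) = (G.obj.map f).hom.hom (φ X x)) : F ⟶ G :=
  ⟨{ app := fun X => FGModuleCat.ofHom (φ X)
     naturality := fun X Y f => by
      ext x
      exact h f x }⟩

theorem comp_naturality {F G : HQF K q d} (f : F ⟶ G) {X Y : Src K q d} (g : X ⟶ Y) (x : F.obj.obj X) :
   comp f Y ((F.obj.map g).hom.hom x) = (G.obj.map g).hom.hom (comp f X x) := by
   have := f.hom.naturality g
   exact LinearMap.congr_fun (congrArg (fun f => f.hom.hom) this) x

theorem hqf_hom_ext {F G : HQF K q d} {f g : F ⟶ G} (h : ∀ X x, comp f X x = comp g X x) : f = g := by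
  ext X x
  exact h X x

theorem epi_of_surjective {F G : HQF K q d} (f : F ⟶ G) (h : ∀ X, Function.Surjective (comp f X)) :
    Epi f := by
  constructor
  intro Z g g' e
  refine hqf_hom_ext fun X x => ?_
  obtain ⟨y, rfl⟩ := h X x
  have := congrArg (fun f => comp f X y) e
  exact this

theorem surjective_of_epi {F G : HQF K q d} (f : F ⟶ G) [Epi f] (X) :
    Function.Surjective (comp f X) := by
  have := (isLinear K q d).preservesEpimorphisms_ι_of_isNormalMonoCategory
  have h1 : Epi f.hom := inferInstanceAs (Epi ((isLinear K q d).ι.map f))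
  have h2 : Epi (f.hom.app X) := inferInstance
  have h3 : Epi ((forget₂ (FGModuleCat K) (ModuleCat K)).map (f.hom.app X)) := inferInstance
  exact (ModuleCat.epi_iff_surjective _).1 h3

/-- A short exact sequence with the given terms exists. -/
def IsSES {C : Type*} [Category* C] [HasZeroMorphisms C] (X Y Z : C) : Prop :=
  ∃ (f : X ⟶ Y) (g : Y ⟶ Z) (w : f ≫ g = 0), (ShortComplex.mk f g w).ShortExact

/-- Short exactness of quantum polynomial functors is checked on each `V_n^{⊗ d}`. -/
theorem shortExact_of_comp (S : ShortComplex (HQF K q d))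
    (hf : ∀ X, Function.Injective (comp S.f X)) (hg : ∀ X, Function.Surjective (comp S.g X))
    (hex : ∀ X y, comp S.g X y = 0 → ∃ x, comp S.f X x = y) : S.ShortExact := by
  have hm : Mono S.f := ⟨fun a b e => hqf_hom_ext fun X x =>
    hf X (LinearMap.congr_fun (congrArg (fun f => comp f X) e) x)⟩
  have he : Epi S.g := epi_of_surjective _ hg
  have hlim : IsLimit (KernelFork.ofι S.f S.zero) := by
    have hr : ∀ {Z : HQF K q d} (g : Z ⟶ S.X₂), g ≫ S.g = 0 → ∀ X z,
        comp g X z ∈ LinearMap.range (comp S.f X) := fun {Z} g w X z =>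
      hex X _ (LinearMap.congr_fun (congrArg (fun f => comp f X) w) z)
    have key : ∀ {Z : HQF K q d} (g : Z ⟶ S.X₂) (w : g ≫ S.g = 0), ∃ l : Z ⟶ S.X₁, l ≫ S.f = g := by
      intro Z g w
      have hl : ∀ X z, comp S.f X ((LinearEquiv.ofInjective (comp S.f X) (hf X)).symm
          ⟨comp g X z, hr g w X z⟩) = comp g X z := fun X z =>
        congrArg Subtype.val ((LinearEquiv.ofInjective (comp S.f X) (hf X)).apply_symm_apply
          ⟨comp g X z, hr g w X z⟩)
      refine ⟨mkHom (fun X => (LinearEquiv.ofInjective (comp S.f X) (hf X)).symm.toLinearMap ∘ₗ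
        LinearMap.codRestrict _ (comp g X) (hr g w X)) (fun {X Y} f x => hf Y ?_), ?_⟩
      · rw [comp_naturality]
        exact (hl Y _).trans ((comp_naturality g f x).trans (congrArg _ (hl X x).symm))
      · exact hqf_hom_ext fun X x => hl X x
    exact KernelFork.IsLimit.ofι _ _ (fun g w => (key g w).choose) (fun g w => (key g w).choose_spec)
      fun g w m hm' => by rw [← cancel_mono S.f, hm', (key g w).choose_spec]
  exact ⟨S.exact_of_f_is_kernel hlim⟩

/-- A subfunctor of the tensor power `V^{⊗ d}`. -/
@[ext]
structure TensSub (K : Type u) [Field K] (q : K) (d : ℕ) where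
  /-- The subspace of `V_n^{⊗ d}`. -/
  space : ∀ n, Submodule K (Tens K n d)
  stable : ∀ {n m} (f : schur q n m d), ∀ w ∈ space n, f.1 w ∈ space m

/-- A subfunctor of the tensor power, as a quantum polynomial functor. -/
noncomputable def TensSub.functor (A : TensSub K q d) : HQF K q d where
  obj :=
    { obj := fun X => FGModuleCat.of K (A.space X.n)
      map := fun {X Y} f => FGModuleCat.ofHom (LinearMap.restrict f.1 (A.stable f))
      map_id := fun _ => rfl
      map_comp := fun _ _ => rfl }
  property := ⟨⟨rfl⟩, ⟨fun _ _ => rfl⟩⟩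

/-- A natural operator on the tensor power, as a morphism between subfunctors. -/
noncomputable def TensSub.hom (A B : TensSub K q d) (θ : ∀ n, Tens K n d →ₗ[K] Tens K n d)
    (hθ : ∀ {n m} (f : schur q n m d) w, f.1 (θ n w) = θ m (f.1 w))
    (h : ∀ n, ∀ w ∈ A.space n, θ n w ∈ B.space n) : A.functor ⟶ B.functor :=
  mkHom (F := A.functor) (G := B.functor) (fun X => LinearMap.restrict (θ X.n) (h X.n))
    fun f x => Subtype.ext (hθ f x.1).symm

theorem TensSub.isSES (A B C : TensSub K q d) (θ : ∀ n, Tens K n d →ₗ[K] Tens K n d)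
    (hθ : ∀ {n m} (f : schur q n m d) w, f.1 (θ n w) = θ m (f.1 w))
    (hA : ∀ n w, w ∈ A.space n ↔ w ∈ B.space n ∧ θ n w = 0)
    (hC : ∀ n w, w ∈ C.space n ↔ ∃ v ∈ B.space n, θ n v = w) :
    IsSES A.functor B.functor C.functor := by
  refine ⟨A.hom B (fun _ => LinearMap.id) (fun _ _ => rfl) (fun n w hw => ((hA n w).1 hw).1),
    B.hom C θ hθ (fun n w hw => (hC n _).2 ⟨w, hw, rfl⟩),
    hqf_hom_ext fun X x => Subtype.ext ((hA _ _).1 x.2).2, shortExact_of_comp _ ?_ ?_ ?_⟩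
  · exact fun X x y h => Subtype.ext (congrArg (fun z : B.space X.n => z.1) h)
  · rintro X ⟨w, hw⟩
    obtain ⟨v, hv, rfl⟩ := (hC _ w).1 hw
    exact ⟨⟨v, hv⟩, rfl⟩
  · rintro X ⟨w, hw⟩ h
    exact ⟨⟨w, (hA _ w).2 ⟨hw, congrArg Subtype.val h⟩⟩, rfl⟩

/-- A subfunctor of the tensor power is projective if it is corepresented by a vector. -/
theorem TensSub.projective (A : TensSub K q d) (X₀ : Src K q d) (v₀ : A.space X₀.n)
    (φ : ∀ n, A.space n →ₗ[K] schur q X₀.n n d) (hv : ∀ n w, (φ n w).1 v₀.1 = w.1)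
    (hφ : ∀ {n m} (f : schur q n m d) (w : A.space n),
      f.1 ∘ₗ (φ n w).1 = (φ m ⟨f.1 w.1, A.stable f w.1 w.2⟩).1) : Projective A.functor := by
  refine ⟨fun {E G} f e he => ?_⟩
  obtain ⟨u, hu⟩ := surjective_of_epi e X₀ (comp f X₀ v₀)
  have hA := E.property.1
  have hL := E.property.2
  let φ' : ∀ X : Src K q d, A.space X.n → (X₀ ⟶ X) := fun X w => φ X.n w
  refine ⟨mkHom (F := A.functor) (G := E) (fun X =>
    { toFun := fun w => (E.obj.map (φ' X w)).hom.hom u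
      map_add' := fun w w' => by
        have : φ' X (w + w') = φ' X w + φ' X w' := map_add (φ X.n) w w'
        rw [this, Functor.map_add]; rfl
      map_smul' := fun c w => by
        have : φ' X (c • w) = c • φ' X w := map_smul (φ X.n) c w
        rw [this, Functor.map_smul]; rfl }) ?_, ?_⟩
  · intro X Y g w
    have : φ' X w ≫ g = φ' Y ⟨g.1 w.1, A.stable g w.1 w.2⟩ := Subtype.ext (hφ g w)
    change (E.obj.map (φ' Y ⟨g.1 w.1, A.stable g w.1 w.2⟩)).hom.hom u = _
    rw [← this, Functor.map_comp]; rfl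
  · refine hqf_hom_ext fun X w => ?_
    refine (comp_naturality e (φ' X w) u).trans ?_
    rw [hu]
    refine (comp_naturality f (φ' X w) v₀).symm.trans ?_
    exact congrArg _ (Subtype.ext (hv X.n w))

end Functors
end QPoly

namespace QPoly

/-! ### The functors `Γ^a ⊗ Λ^b` and the quantum Frobenius twist -/

section SymAlt
variable {K : Type u} [Field K] {q : K} {d : ℕ}

theorem projective_of_comp_eq_id {C : Type*} [Category* C] {P Q : C} (i : P ⟶ Q) (r : Q ⟶ P)
    (h : i ≫ r = 𝟙 P) [Projective Q] : Projective P :=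
  ⟨fun {E G} f e he => ⟨i ≫ Projective.factorThru (r ≫ f) e, by
    rw [Category.assoc, Projective.factorThru_comp, reassoc_of% h]⟩⟩

theorem schur_apply_symOp_hop {n m : ℕ} (f : schur q n m d) (a : ℕ) (w : Tens K n d) :
    f.1 (symOp q (hop q n d) a w) = symOp q (hop q m d) a (f.1 w) :=
  map_symOp (fun i _ w => schur_apply_hop f i w) w

theorem schur_apply_hopDual {n m : ℕ} (f : schur q n m d) (i : ℕ) (w : Tens K n d) :
    f.1 (hopDual q n d i w) = hopDual q m d i (f.1 w) := by
  rw [dualFamily_apply, dualFamily_apply, map_sub, map_smul, schur_apply_hop]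

theorem schur_apply_symOp_hopDual {n m : ℕ} (f : schur q n m d) (b : ℕ) (w : Tens K n d) :
    f.1 (symOp q (hopDual q n d) b w) = symOp q (hopDual q m d) b (f.1 w) :=
  map_symOp (fun i _ w => schur_apply_hopDual f i w) w

/-- The functor `Γ^a ⊗ V ⊗ ⋯ ⊗ V ⊗ Λ^b` of degree `d`. -/
def symAltSub (K : Type u) [Field K] (q : K) (d a b : ℕ) : TensSub K q d where
  space n := symAlt q n d a b
  stable f w hw := ⟨fun i hi => by rw [← schur_apply_hop, hw.1 i hi, map_smul],
    fun i hi => by rw [← schur_apply_hopDual, hw.2 i hi, map_smul]⟩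

theorem ofVec_add (hq : q ≠ 0) {n : ℕ} (w w' : Tens K n d) :
    ofVec hq (w + w') = ofVec hq w + ofVec hq w' :=
  ofVec_unique hq (congrArg₂ (· + ·) (ofVec_ten_id hq w) (ofVec_ten_id hq w')) fun J hJ => by
    refine (congrArg₂ (· + ·) (ofVec_ten_of_not hq w J hJ) (ofVec_ten_of_not hq w' J hJ)).trans ?_
    simp

theorem ofVec_smul (hq : q ≠ 0) {n : ℕ} (c : K) (w : Tens K n d) :
    ofVec hq (c • w) = c • ofVec hq w :=
  ofVec_unique hq (congrArg (c • ·) (ofVec_ten_id hq w)) fun J hJ => by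
    refine (congrArg (c • ·) (ofVec_ten_of_not hq w J hJ)).trans ?_
    simp

/-- The tensor power is corepresented by the vector `e_0 ⊗ ⋯ ⊗ e_{d - 1}` modulo the words with repeated
letters. -/
theorem projective_tens (hq : q ≠ 0) (hd : 1 ≤ d) : Projective (symAltSub K q d 0 0).functor := by
  refine TensSub.projective _ ⟨d, hd⟩
    ⟨ten K id, ⟨fun i hi => absurd hi (by omega), fun i hi => absurd hi (by omega)⟩⟩
    (fun n => { toFun := fun w => ofVec hq w.1, map_add' := fun w w' => ofVec_add hq w.1 w'.1,
                map_smul' := fun c w => ofVec_smul hq c w.1 }) (fun n w => ofVec_ten_id hq w.1) ?_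
  intro n m f w
  have := ofVec_unique hq (w := f.1 w.1) (f := ⟨f.1 ∘ₗ (ofVec hq w.1).1, fun i hi => by
    rw [LinearMap.comp_assoc, (ofVec hq w.1).2 i hi, ← LinearMap.comp_assoc, f.2 i hi,
      LinearMap.comp_assoc]⟩) (congrArg f.1 (ofVec_ten_id hq w.1)) fun J hJ =>
        (congrArg f.1 (ofVec_ten_of_not hq w.1 J hJ)).trans (map_zero _)
  exact (congrArg Subtype.val this).symm

/-- The morphism `V_1^{⊗ d} → V_n^{⊗ d}` which sends the basis tensor to a symmetric tensor `w`. -/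
def ofSym {n : ℕ} (w : Tens K n d) (hw : ∀ i (hi : i + 1 < d), heckeOp q n d i hi w = q • w) :
    schur q 1 n d :=
  ⟨(LinearMap.toSpanSingleton K _ w) ∘ₗ LinearMap.proj (fun _ => 0), fun i hi => by
    refine LinearMap.ext fun v => ?_
    simp only [LinearMap.comp_apply, LinearMap.proj_apply, LinearMap.toSpanSingleton_apply, map_smul,
      hw i hi]
    rw [heckeOp_apply, if_neg (lt_irrefl _), if_pos rfl, smul_smul, mul_comm]⟩

theorem ofSym_apply {n : ℕ} (w : Tens K n d) (hw) (v : Tens K 1 d) :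
    (ofSym (q := q) w hw).1 v = v (fun _ => 0) • w := rfl

theorem heckeOp_eq_of_mem {n b : ℕ} {w : Tens K n d} (hw : w ∈ symAlt q n d d b) (i : ℕ)
    (hi : i + 1 < d) :
    heckeOp q n d i hi w = q • w := by rw [← hop_eq i hi, hw.1 i hi]

theorem ten_const_mem {n : ℕ} (x : Fin n) : ten K (fun _ => x) ∈ symAlt q n d d 0 :=
  ⟨fun i hi => by rw [hop_eq i hi, heckeOp_ten_eq _ i hi rfl], fun i hi => absurd hi (by omega)⟩

theorem ten_zero_apply (d : ℕ) : (ten K (fun _ => 0) : Tens K 1 d) (fun _ => 0) = 1 :=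
  Pi.single_eq_same (M := fun _ => K) (fun _ => 0) 1

/-- The symmetric tensors are corepresented by `V_1^{⊗ d}`. -/
theorem projective_sym : Projective (symAltSub K q d d 0).functor := by
  refine TensSub.projective _ ⟨1, le_rfl⟩ ⟨ten K fun _ => 0, ten_const_mem 0⟩
    (fun n => { toFun := fun w => ofSym w.1 (heckeOp_eq_of_mem w.2), map_add' := fun w w' => ?_,
                map_smul' := fun c w => ?_ }) (fun n w => ?_) ?_
  · refine Subtype.ext (LinearMap.ext fun v => ?_)
    exact smul_add (v fun _ => 0) w.1 w'.1
  · refine Subtype.ext (LinearMap.ext fun v => ?_)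
    exact smul_comm (v fun _ => 0) c w.1
  · change (ten K (fun _ => 0) : Tens K 1 d) (fun _ => 0) • w.1 = w.1
    rw [ten_zero_apply, one_smul]
  · exact fun f w => LinearMap.ext fun v => map_smul f.1 _ _

/-- `Γ^{a+1} ⊗ Λ^b` is a direct summand of `Γ^a ⊗ V ⊗ Λ^b` if the quantum integer of `a + 1` is
invertible. -/
theorem exists_retract_sym (hq : q ≠ 0) {a b : ℕ} (hd : a + b + 1 ≤ d) (ha : qInt q (a + 1) ≠ 0) :
    ∃ (i : (symAltSub K q d (a + 1) b).functor ⟶ (symAltSub K q d a b).functor) (r : _),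
      i ≫ r = 𝟙 _ := by
  refine ⟨TensSub.hom _ _ (fun _ => LinearMap.id) (fun _ _ => rfl)
    (fun n w hw => ⟨hw.1.mono (by omega), hw.2⟩),
    TensSub.hom _ _ (fun n => (qInt q (a + 1))⁻¹ • symOp q (hop q n d) a) (fun f w => ?_)
    (fun n w hw => Submodule.smul_mem _ _ (symOp_hop_mem hq hd hw.1 hw.2)),
    hqf_hom_ext fun X x => Subtype.ext ?_⟩
  · rw [LinearMap.smul_apply, LinearMap.smul_apply, map_smul, schur_apply_symOp_hop]
  · change (qInt q (a + 1))⁻¹ • symOp q (hop q X.n d) a x.1 = x.1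
    rw [symOp_eq_smul x.2.1, smul_smul, inv_mul_cancel₀ ha, one_smul]

theorem exists_retract_alt (hq : q ≠ 0) {a b : ℕ} (hd : a + b + 1 ≤ d) (hb : qInt q (b + 1) ≠ 0) :
    ∃ (i : (symAltSub K q d a (b + 1)).functor ⟶ (symAltSub K q d a b).functor) (r : _),
      i ≫ r = 𝟙 _ := by
  refine ⟨TensSub.hom _ _ (fun _ => LinearMap.id) (fun _ _ => rfl)
    (fun n w hw => ⟨hw.1, hw.2.mono (by omega)⟩),
    TensSub.hom _ _ (fun n => (qInt q (b + 1))⁻¹ • symOp q (hopDual q n d) b) (fun f w => ?_)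
    (fun n w hw => Submodule.smul_mem _ _ (symOp_hopDual_mem hq hd hw.1 hw.2)),
    hqf_hom_ext fun X x => Subtype.ext ?_⟩
  · rw [LinearMap.smul_apply, LinearMap.smul_apply, map_smul, schur_apply_symOp_hopDual]
  · change (qInt q (b + 1))⁻¹ • symOp q (hopDual q X.n d) b x.1 = x.1
    rw [symOp_eq_smul x.2.2, smul_smul, inv_mul_cancel₀ hb, one_smul]

/-- A property of quantum polynomial functors which passes from the tensor power to direct summands holds
for `Γ^a ⊗ Λ^b` with `a, b < d`. -/
theorem symAlt_induction (hq : q ≠ 0) (hint : ∀ m, 0 < m → m < d → qInt q m ≠ 0)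
    {P : HQF K q d → Prop} (h0 : P (symAltSub K q d 0 0).functor)
    (hP : ∀ {F G : HQF K q d} (i : F ⟶ G) (r : G ⟶ F), i ≫ r = 𝟙 F → P G → P F)
    {a b : ℕ} (hab : a + b ≤ d) (ha : a < d) (hb : b < d) : P (symAltSub K q d a b).functor := by
  induction a with
  | zero =>
    induction b with
    | zero => exact h0
    | succ b ih =>
      obtain ⟨i, r, h⟩ := exists_retract_alt (K := K) (d := d) hq (a := 0) (b := b) (by omega)
        (hint _ b.succ_pos hb)
      exact hP i r h (ih (lt_trans b.lt_succ_self hb) (by omega))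
  | succ a ih =>
    obtain ⟨i, r, h⟩ := exists_retract_sym (K := K) (d := d) hq (a := a) (b := b) (by omega)
      (hint _ a.succ_pos ha)
    exact hP i r h (ih (by omega) (lt_trans a.lt_succ_self ha))

variable {ℓ : ℕ} (hq : IsPrimitiveRoot q ℓ) (hodd : Odd ℓ) (hℓ : 1 < ℓ)

/-- The quantum Frobenius twist of the identity functor. -/
noncomputable abbrev twist : HQF K q ℓ := frobeniusTwist hq hodd hℓ (I K (1 : K))

/-- By naturality a morphism to the twist is determined by its value on `e_0 ⊗ ⋯ ⊗ e_{ℓ - 1}`, and it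
vanishes since the constant words are not permutation words. -/
theorem tens_hom_twist_eq_zero (f : (symAltSub K q ℓ 0 0).functor ⟶ twist hq hodd hℓ) : f = 0 := by
  have hq0 : q ≠ 0 := hq.ne_zero (by omega)
  refine hqf_hom_ext fun X w => ?_
  have hmem : ten K id ∈ (symAltSub K q ℓ 0 0).space ℓ :=
    ⟨fun i hi => absurd hi (by omega), fun i hi => absurd hi (by omega)⟩
  let X₀ : Src K q ℓ := ⟨ℓ, hℓ.le⟩
  let φ : X₀ ⟶ X := ofVec hq0 w.1
  have e1 : ((symAltSub K q ℓ 0 0).functor.obj.map φ).hom.hom ⟨ten K id, hmem⟩ = w :=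
    Subtype.ext (ofVec_ten_id hq0 w.1)
  -- the twist sends a morphism supported on the permutation words to zero
  have e2 : ∀ y : Tens K ℓ 1, powProj K X.n ℓ ((ofVec hq0 w.1).1 (powIncl K ℓ ℓ y)) = 0 := by
    intro y
    have : (ofVec hq0 w.1).1 ∘ₗ powIncl K ℓ ℓ = 0 := Tens.ext_ten fun J => by
      rw [LinearMap.comp_apply, powIncl_single, ofVec_ten_of_not]
      · rfl
      · intro h
        have := congrArg Fin.val (@h ⟨0, by omega⟩ ⟨1, hℓ⟩ rfl)
        simp at this
    rw [← LinearMap.comp_apply (ofVec hq0 w.1).1, this]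
    simp
  exact (congrArg (comp f X) e1).symm.trans ((comp_naturality f φ _).trans (e2 _))

theorem powIncl_mem {n : ℕ} (y : Tens K n 1) : powIncl K n ℓ y ∈ symAlt q n ℓ ℓ 0 := by
  rw [powIncl, Fintype.linearCombination_apply]
  exact Submodule.sum_mem _ fun J _ => Submodule.smul_mem _ _ (ten_const_mem _)

theorem powProj_ofSym (hℓ : 1 < ℓ) {n : ℕ} (y : Tens K n 1) (v : Tens K 1 1) :
    powProj K n ℓ ((ofSym (q := q) (powIncl K n ℓ y) (heckeOp_eq_of_mem (b := 0) (powIncl_mem y))).1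
      (powIncl K 1 ℓ v)) = v (fun _ => 0) • y := by
  rw [ofSym_apply, map_smul]
  exact congrArg₂ (· • ·) (congrFun (LinearMap.congr_fun (powProj_comp_powIncl hℓ) v) fun _ => 0)
    (LinearMap.congr_fun (powProj_comp_powIncl hℓ) y)

/-- The twist is generated by the basis vector of `V_1`, so that its endomorphisms are scalars. -/
theorem end_twist (f : twist hq hodd hℓ ⟶ twist hq hodd hℓ) : ∃ c : K, f = c • 𝟙 _ := by
  let X₁ : Src K q ℓ := ⟨1, le_rfl⟩
  let e₀ : Tens K 1 1 := ten K fun _ => 0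
  let η : Tens K 1 1 →ₗ[K] Tens K 1 1 := comp f X₁
  refine ⟨η e₀ (fun _ => 0), hqf_hom_ext fun X y => ?_⟩
  let φ : X₁ ⟶ X := ofSym (powIncl K X.n ℓ y) (heckeOp_eq_of_mem (b := 0) (powIncl_mem y))
  have h1 : ((twist hq hodd hℓ).obj.map φ).hom.hom e₀ = y := by
    refine (powProj_ofSym (q := q) hℓ y e₀).trans ?_
    exact (congrArg (· • (y : Tens K X.n 1)) (ten_zero_apply (K := K) 1)).trans (one_smul K _)
  exact (congrArg (comp f X) h1).symm.trans ((comp_naturality f φ e₀).trans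
    (powProj_ofSym (q := q) hℓ y (η e₀)))

theorem id_twist_ne_zero : 𝟙 (twist hq hodd hℓ) ≠ 0 := fun h => by
  have := LinearMap.congr_fun (congrArg (fun f => comp f (⟨1, le_rfl⟩ : Src K q ℓ)) h)
    (ten K fun _ => 0 : Tens K 1 1)
  exact one_ne_zero ((ten_zero_apply (K := K) 1).symm.trans (congrFun this (fun _ => (0 : Fin 1))))

/-- A subfunctor of the tensor power on which the projection to the constant words is natural gives a
short exact sequence ending in the twist. -/
theorem isSES_twist (A B : TensSub K q ℓ)
    (hB : ∀ {n m} (f : schur q n m ℓ), ∀ w ∈ B.space n,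
      powProj K m ℓ (f.1 w) = powProj K m ℓ (f.1 (powIncl K n ℓ (powProj K n ℓ w))))
    (hA : ∀ n w, w ∈ A.space n ↔ w ∈ B.space n ∧ powProj K n ℓ w = 0)
    (hsurj : ∀ n y, powIncl K n ℓ y ∈ B.space n) :
    IsSES A.functor B.functor (twist hq hodd hℓ) := by
  refine ⟨A.hom B (fun _ => LinearMap.id) (fun _ _ => rfl) (fun n w hw => ((hA n w).1 hw).1),
    mkHom (F := B.functor) (G := twist hq hodd hℓ)
      (fun X => powProj K X.n ℓ ∘ₗ (B.space X.n).subtype) (fun f w => hB f w.1 w.2),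
    hqf_hom_ext fun X x => ((hA _ _).1 x.2).2, shortExact_of_comp _ ?_ ?_ ?_⟩
  · exact fun X x y h => Subtype.ext (congrArg (fun z : B.space X.n => z.1) h)
  · exact fun X y => ⟨⟨powIncl K X.n ℓ y, hsurj X.n y⟩,
      LinearMap.congr_fun (powProj_comp_powIncl hℓ) y⟩
  · rintro X ⟨w, hw⟩ h
    exact ⟨⟨w, (hA _ w).2 ⟨hw, h⟩⟩, rfl⟩

theorem powProj_eq_zero_iff {n : ℕ} (w : Tens K n ℓ) :
    powProj K n ℓ w = 0 ↔ VanishOn (constWords ℓ n) w := by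
  constructor
  · rintro h _ ⟨x, rfl⟩
    exact congrFun h fun _ => x
  · exact fun h => funext fun J => h _ ⟨J 0, rfl⟩

end SymAlt
end QPoly

namespace QPoly

/-! ### Exact sequences from the Koszul and de Rham complexes -/

section Sequences
variable {K : Type u} [Field K] {q : K} {d n : ℕ}

/-- The cycles of the Koszul complex in `Γ^a ⊗ Λ^b`. The complex ends in `Γ^0 ⊗ Λ^b`, where everything
is a cycle. -/
noncomputable def koszulCycles (K : Type u) [Field K] (q : K) (d a b : ℕ) : TensSub K q d where
  space n :=
    { carrier := {w | w ∈ symAlt q n d a b ∧ (a ≠ 0 → symOp q (hopDual q n d) b w = 0)}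
      add_mem' := fun h h' => ⟨add_mem h.1 h'.1, fun ha => by rw [map_add, h.2 ha, h'.2 ha, add_zero]⟩
      zero_mem' := ⟨zero_mem _, fun _ => map_zero _⟩
      smul_mem' := fun c w h => ⟨Submodule.smul_mem _ c h.1, fun ha => by
        rw [map_smul, h.2 ha, smul_zero]⟩ }
  stable f w h := ⟨(symAltSub K q d a b).stable f w h.1, fun ha => by
    rw [← schur_apply_symOp_hopDual, h.2 ha, map_zero]⟩

/-- The image of a subfunctor of the tensor power under the de Rham differential leaving
`Γ^a ⊗ Λ^b`. -/
noncomputable def deRhamImage (a : ℕ) (A : TensSub K q d) : TensSub K q d where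
  space n := (A.space n).map (symOp q (hop q n d) a)
  stable f w h := by
    obtain ⟨v, hv, rfl⟩ := h
    exact ⟨f.1 v, A.stable f v hv, (schur_apply_symOp_hop f a v).symm⟩

/-- The subfunctor of `A` on which the de Rham differential leaving `Γ^a ⊗ Λ^b` vanishes. -/
noncomputable def deRhamKernel (a : ℕ) (A : TensSub K q d) : TensSub K q d where
  space n := A.space n ⊓ LinearMap.ker (symOp q (hop q n d) a)
  stable f w h := ⟨A.stable f w h.1, LinearMap.mem_ker.2 (by
    rw [← schur_apply_symOp_hop, LinearMap.mem_ker.1 h.2, map_zero])⟩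

theorem isSES_deRham (a : ℕ) {A B : TensSub K q d}
    (hA : ∀ n w, w ∈ A.space n ↔ w ∈ B.space n ∧ symOp q (hop q n d) a w = 0) :
    IsSES A.functor B.functor (deRhamImage a B).functor :=
  TensSub.isSES A B _ (fun n => symOp q (hop q n d) a) (fun f w => schur_apply_symOp_hop f a w) hA
    fun _ _ => Iff.rfl

theorem deRhamImage_zero (A : TensSub K q d) : deRhamImage 0 A = A :=
  TensSub.ext (funext fun _ => Submodule.map_id _)

theorem koszulCycles_zero (b : ℕ) : koszulCycles K q d 0 b = symAltSub K q d 0 b :=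
  TensSub.ext (funext fun _ => Submodule.ext fun _ => and_iff_left fun h => absurd rfl h)

/-- Antisymmetry in at least two positions excludes the constant words. -/
theorem vanishOn_constWords (hq : q ≠ 0) (hq2 : q ^ 2 + 1 ≠ 0) {a b : ℕ} (hb : b + 2 ≤ d)
    {w : Tens K n d} (hw : w ∈ symAlt q n d a (b + 2)) : VanishOn (constWords d n) w := by
  rintro _ ⟨x, rfl⟩
  exact apply_eq_zero_of_repeat hq hq2 hw.2 (s := d - 2) (t := d - 1) (by omega) (by omega)
    (by omega) rfl

/-- The symmetrizer multiplies the components in the constant words by a quantum integer. -/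
theorem symOp_hop_apply_const {a : ℕ} (ha : a < d) (w : Tens K n d) (x : Fin n) :
    symOp q (hop q n d) a w (fun _ => x) = qInt q (a + 1) * w fun _ => x := by
  induction a generalizing w with
  | zero => simp [symOp_zero_apply, qInt]
  | succ a ih =>
    rw [symOp_succ_apply, Pi.add_apply, Pi.smul_apply, ih (by omega), hop_apply_eq a ha _ _ rfl,
      qInt_succ (a + 1), smul_eq_mul]
    ring

/-- The Koszul differential `Γ^d → Γ^{d-1} ⊗ Λ^1` is the inclusion, and its image consists of the
cycles. -/
theorem mem_sym_iff (hq : q ≠ 0) {a : ℕ} (hd : a + 2 = d) {w : Tens K n d} :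
    w ∈ symAlt q n d d 0 ↔ w ∈ symAlt q n d (a + 1) 1 ∧ symOp q (hopDual q n d) 1 w = 0 := by
  have key : symOp q (hopDual q n d) 1 w = 0 ↔ hop q n d a w = q • w := by
    rw [symOp_succ_apply, symOp_zero_apply, dualFamily_apply, show d - 2 - 0 = a by omega, smul_sub,
      smul_sub_inv_smul hq, add_sub_assoc', add_sub_cancel, sub_eq_zero, pow_two, mul_smul]
    exact ⟨fun h => (smul_right_injective _ hq h).symm, fun h => by rw [h]⟩
  rw [key]
  constructor
  · exact fun h => ⟨⟨h.1.mono (by omega), fun i hi => absurd hi (by omega)⟩, h.1 a (by omega)⟩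
  · rintro ⟨h, h'⟩
    refine ⟨fun i hi => ?_, fun i hi => absurd hi (by omega)⟩
    rcases (show i < a ∨ i = a by omega) with hi' | rfl
    · exact h.1 i (by omega)
    · exact h'

variable (hq : q ≠ 0) (hq2 : q ^ 2 + 1 ≠ 0) (hint : ∀ m, 0 < m → m < d → qInt q m ≠ 0)
  (h0 : qInt q d = 0)
include hq hq2 hint

/-- The Koszul complex is exact, also in the constant words: these only occur in `Γ^d` and
`Γ^{d-1} ⊗ Λ^1`, where the differential is the inclusion. -/
theorem isSES_koszul {a b : ℕ} (hd : a + b + 1 = d) (h1 : 1 < d) :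
    IsSES (koszulCycles K q d (a + 1) b).functor (symAltSub K q d (a + 1) b).functor
      (koszulCycles K q d a (b + 1)).functor := by
  refine TensSub.isSES _ _ _ (fun n => symOp q (hopDual q n d) b)
    (fun f w => schur_apply_symOp_hopDual f b w)
    (fun n w => and_congr_right fun _ => ⟨fun h => h a.succ_ne_zero, fun h _ => h⟩) fun n w => ⟨?_, ?_⟩
  · rintro ⟨hw, hw0⟩
    rcases b with _ | b
    · obtain ⟨a, rfl⟩ : ∃ a', a = a' + 1 := ⟨a - 1, by omega⟩
      have hs := (mem_sym_iff hq (by omega)).2 ⟨hw, hw0 a.succ_ne_zero⟩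
      exact ⟨w, ⟨hs.1.mono (by omega), hs.2⟩, rfl⟩
    · exact exists_symOp_hopDual_eq hq hq2 hint hd hw hw0
        (vanishOn_constWords hq hq2 (by omega) hw)
  · rintro ⟨v, hv, rfl⟩
    refine ⟨symOp_hopDual_mem hq hd.le (hv.1.mono a.le_succ) hv.2, fun ha => ?_⟩
    obtain ⟨a, rfl⟩ := Nat.exists_eq_succ_of_ne_zero ha
    exact symOp_hopDual_symOp_hopDual hq hq2 (by omega) hv

include h0

/-- The homology of the de Rham complex is concentrated in the constant words. -/
theorem mem_deRhamImage_iff {a b : ℕ} (hd : a + b + 2 = d) {w : Tens K n d}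
    (hw0 : VanishOn (constWords d n) w) :
    w ∈ (deRhamImage a (symAltSub K q d a (b + 2))).space n ↔
      w ∈ symAlt q n d (a + 1) (b + 1) ∧ symOp q (hop q n d) (a + 1) w = 0 := by
  constructor
  · rintro ⟨v, hv, rfl⟩
    exact ⟨symOp_hop_mem hq (by omega) hv.1 (hv.2.mono (by omega)),
      symOp_hop_symOp_hop hq hq2 (by omega) hv⟩
  · rintro ⟨hw, hS⟩
    obtain ⟨g, hg, e, -⟩ := exists_symOp_hop_eq hq hq2 hint h0 (by omega) hw (fun _ => hS) hw0
    exact ⟨g, hg, e⟩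

/-- The same holds for the subcomplex of the Koszul cycles. -/
theorem mem_deRhamImage_cycles_iff {a b : ℕ} (hd : a + b + 2 = d) {w : Tens K n d}
    (hw0 : VanishOn (constWords d n) w) :
    w ∈ (deRhamImage a (koszulCycles K q d a (b + 2))).space n ↔
      w ∈ (koszulCycles K q d (a + 1) (b + 1)).space n ∧ symOp q (hop q n d) (a + 1) w = 0 := by
  constructor
  · rintro ⟨v, ⟨hv, hv0⟩, rfl⟩
    refine ⟨⟨symOp_hop_mem hq (by omega) hv.1 (hv.2.mono (by omega)), fun _ => ?_⟩,
      symOp_hop_symOp_hop hq hq2 (by omega) hv⟩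
    rcases a with _ | a
    · rw [symOp_zero_apply, symOp_eq_smul (hv.2.mono (by omega)), show b + 1 + 1 = d by omega, h0,
        zero_smul]
    · rw [← neg_eq_zero, ← symOp_hop_symOp_hopDual hq h0 (by omega) ⟨hv.1, hv.2.mono (by omega)⟩,
        hv0 a.succ_ne_zero, map_zero]
  · rintro ⟨⟨hw, hK⟩, hS⟩
    obtain ⟨g, hg, e, h⟩ := exists_symOp_hop_eq hq hq2 hint h0 (by omega) hw (fun _ => hS) hw0
    exact ⟨g, ⟨hg, h (hK a.succ_ne_zero)⟩, e⟩

theorem isSES_deRhamImage {a b : ℕ} (hd : a + b + 3 = d) :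
    IsSES (deRhamImage a (symAltSub K q d a (b + 3))).functor (symAltSub K q d (a + 1) (b + 2)).functor
      (deRhamImage (a + 1) (symAltSub K q d (a + 1) (b + 2))).functor := by
  refine isSES_deRham _ fun n w => ⟨fun h => ?_, fun h => ?_⟩
  · refine (mem_deRhamImage_iff hq hq2 hint h0 (b := b + 1) (by omega) ?_).1 h
    obtain ⟨v, hv, rfl⟩ := h
    exact vanishOn_constWords_symOp (vanishOn_constWords hq hq2 (by omega) hv) a
  · exact (mem_deRhamImage_iff hq hq2 hint h0 (b := b + 1) (by omega)
      (vanishOn_constWords hq hq2 (by omega) h.1)).2 h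

theorem isSES_deRhamImage_cycles {a b : ℕ} (hd : a + b + 3 = d) :
    IsSES (deRhamImage a (koszulCycles K q d a (b + 3))).functor
      (koszulCycles K q d (a + 1) (b + 2)).functor
      (deRhamImage (a + 1) (koszulCycles K q d (a + 1) (b + 2))).functor := by
  refine isSES_deRham _ fun n w => ⟨fun h => ?_, fun h => ?_⟩
  · refine (mem_deRhamImage_cycles_iff hq hq2 hint h0 (b := b + 1) (by omega) ?_).1 h
    obtain ⟨v, hv, rfl⟩ := h
    exact vanishOn_constWords_symOp (vanishOn_constWords hq hq2 (by omega) hv.1) a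
  · exact (mem_deRhamImage_cycles_iff hq hq2 hint h0 (b := b + 1) (by omega)
      (vanishOn_constWords hq hq2 (by omega) h.1.1)).2 h

/-- The last boundaries of the de Rham complex are the symmetric tensors without component in the
constant words; they are already the images of Koszul cycles. -/
theorem mem_deRhamImage_last_iff {a : ℕ} (hd : a + 2 = d) {w : Tens K n d} :
    w ∈ (deRhamImage a (koszulCycles K q d a 2)).space n ↔
      w ∈ symAlt q n d d 0 ∧ VanishOn (constWords d n) w := by
  have key : VanishOn (constWords d n) w → (w ∈ (deRhamImage a (koszulCycles K q d a 2)).space n ↔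
      w ∈ symAlt q n d d 0) := fun hw0 => by
    rw [mem_deRhamImage_cycles_iff hq hq2 hint h0 (b := 0) (by omega) hw0, mem_sym_iff hq hd]
    constructor
    · exact fun h => ⟨h.1.1, h.1.2 a.succ_ne_zero⟩
    · refine fun h => ⟨⟨h.1, fun _ => h.2⟩, ?_⟩
      rw [symOp_eq_smul (((mem_sym_iff hq hd).2 h).1.mono (by omega)), hd, h0, zero_smul]
  refine ⟨fun h => ?_, fun h => (key h.2).2 h.1⟩
  have hw0 : VanishOn (constWords d n) w := by
    obtain ⟨v, hv, rfl⟩ := h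
    exact vanishOn_constWords_symOp (vanishOn_constWords hq hq2 (by omega) hv.1) a
  exact ⟨(key hw0).1 h, hw0⟩

theorem deRhamImage_last {a : ℕ} (hd : a + 2 = d) :
    deRhamImage (a + 1) (symAltSub K q d (a + 1) 1) = deRhamImage a (koszulCycles K q d a 2) := by
  refine TensSub.ext (funext fun n => Submodule.ext fun w => ?_)
  rw [mem_deRhamImage_last_iff hq hq2 hint h0 hd]
  constructor
  · rintro ⟨v, hv, rfl⟩
    refine ⟨hd ▸ symOp_hop_mem hq (by omega) hv.1 fun i hi => absurd hi (by omega), ?_⟩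
    rintro _ ⟨x, rfl⟩
    rw [symOp_hop_apply_const (by omega), hd, h0, zero_mul]
  · rintro ⟨hw, hw0⟩
    obtain ⟨g, hg, e, -⟩ := exists_symOp_hop_eq hq hq2 hint h0 (a := a + 1) (b := 0) (by omega)
      (w := w) (hd ▸ hw) (fun h => absurd rfl h) hw0
    exact ⟨g, hg, e⟩

end Sequences

section TwistSequences
variable {K : Type u} [Field K] {q : K} {ℓ : ℕ} (hq : IsPrimitiveRoot q ℓ) (hodd : Odd ℓ) (hℓ : 1 < ℓ)
include hq

theorem qInt_self (hodd : Odd ℓ) (hℓ : 1 < ℓ) : qInt q ℓ = 0 :=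
  (hq.pow_of_coprime 2 (Nat.coprime_two_left.2 hodd)).geom_sum_eq_zero hℓ

theorem qInt_ne_zero (hodd : Odd ℓ) (m : ℕ) (h : 0 < m) (h' : m < ℓ) : qInt q m ≠ 0 := fun h0 => by
  have h1 := mul_geom_sum (q ^ 2) m
  rw [show ∑ t ∈ Finset.range m, (q ^ 2) ^ t = 0 from h0, mul_zero] at h1
  exact (hq.pow_of_coprime 2 (Nat.coprime_two_left.2 hodd)).pow_ne_one_of_pos_of_lt h.ne' h'
    (sub_eq_zero.1 h1.symm)

theorem sq_add_one_ne_zero (hodd : Odd ℓ) (hℓ : 1 < ℓ) : q ^ 2 + 1 ≠ 0 := by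
  have h := qInt_ne_zero hq hodd 2 two_pos (by
    obtain ⟨k, rfl⟩ := hodd
    omega)
  simpa [qInt, Finset.sum_range_succ, add_comm] using h

/-- The twist is the cokernel of the de Rham differential `Γ^{ℓ-1} ⊗ Λ^1 → Γ^ℓ`. -/
theorem isSES_sym_twist {a : ℕ} (ha : a + 2 = ℓ) :
    IsSES (deRhamImage (a + 1) (symAltSub K q ℓ (a + 1) 1)).functor (symAltSub K q ℓ ℓ 0).functor
      (twist hq hodd hℓ) := by
  have hq0 : q ≠ 0 := hq.ne_zero (by omega)
  have hq2 := sq_add_one_ne_zero hq hodd hℓ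
  have hint := qInt_ne_zero hq hodd
  have h0 := qInt_self hq hodd hℓ
  refine isSES_twist hq hodd hℓ _ _ (fun f w hw => ?_) (fun n w => ?_) fun n y => powIncl_mem y
  · exact powProj_schur_eq hq hodd hℓ f w (heckeOp_eq_of_mem hw)
  · rw [deRhamImage_last hq0 hq2 hint h0 ha, mem_deRhamImage_last_iff hq0 hq2 hint h0 ha,
      powProj_eq_zero_iff]
    rfl

/-- The twist is also the homology of the de Rham complex at `Γ^{ℓ-1} ⊗ Λ^1`. -/
theorem isSES_deRhamKernel_twist {a : ℕ} (ha : a + 2 = ℓ) :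
    IsSES (deRhamImage a (symAltSub K q ℓ a 2)).functor
      (deRhamKernel (a + 1) (symAltSub K q ℓ (a + 1) 1)).functor (twist hq hodd hℓ) := by
  have hq0 : q ≠ 0 := hq.ne_zero (by omega)
  have hq2 := sq_add_one_ne_zero hq hodd hℓ
  have hint := qInt_ne_zero hq hodd
  have h0 := qInt_self hq hodd hℓ
  have hA : ∀ n w, w ∈ (deRhamImage a (symAltSub K q ℓ a 2)).space n ↔
      w ∈ (deRhamKernel (a + 1) (symAltSub K q ℓ (a + 1) 1)).space n ∧ powProj K n ℓ w = 0 := by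
    refine fun n w => ⟨fun h => ?_, fun h => ?_⟩
    · have hw0 : VanishOn (constWords ℓ n) w := by
        obtain ⟨v, hv, rfl⟩ := h
        exact vanishOn_constWords_symOp (vanishOn_constWords hq0 hq2 (by omega) hv) a
      exact ⟨(mem_deRhamImage_iff hq0 hq2 hint h0 (b := 0) ha hw0).1 h, (powProj_eq_zero_iff w).2 hw0⟩
    · exact (mem_deRhamImage_iff hq0 hq2 hint h0 (b := 0) ha ((powProj_eq_zero_iff w).1 h.2)).2 h.1
  have hpow : ∀ n (y : Tens K n 1), powIncl K n ℓ y ∈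
      (deRhamKernel (a + 1) (symAltSub K q ℓ (a + 1) 1)).space n := fun n y => by
    have hy := powIncl_mem (q := q) (ℓ := ℓ) y
    refine ⟨((mem_sym_iff hq0 ha).1 hy).1, LinearMap.mem_ker.2 ?_⟩
    rw [symOp_eq_smul (hy.1.mono (by omega)), ha, h0, zero_smul]
  refine isSES_twist hq hodd hℓ _ _ (fun {n m} f w hw => ?_) hA hpow
  -- the difference of `w` and its constant part lies in the kernel of the projection
  have h1 := (hA n (w - powIncl K n ℓ (powProj K n ℓ w))).2 ⟨sub_mem hw (hpow _ _), by
    rw [map_sub, sub_eq_zero]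
    exact (LinearMap.congr_fun (powProj_comp_powIncl hℓ) _).symm⟩
  have h2 := ((hA m _).1 ((deRhamImage a (symAltSub K q ℓ a 2)).stable f _ h1)).2
  rwa [map_sub, map_sub, sub_eq_zero] at h2

omit hq in
theorem isSES_deRhamKernel (a : ℕ) :
    IsSES (deRhamKernel (a + 1) (symAltSub K q ℓ (a + 1) 1)).functor (symAltSub K q ℓ (a + 1) 1).functor
      (deRhamImage (a + 1) (symAltSub K q ℓ (a + 1) 1)).functor :=
  isSES_deRham _ fun _ _ => Iff.rfl

theorem projective_symAlt (hodd : Odd ℓ) {a b : ℕ} (hab : a + b ≤ ℓ) (ha : a < ℓ) (hb : b < ℓ) :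
    Projective (symAltSub K q ℓ a b).functor :=
  symAlt_induction (P := fun F => Projective F) (hq.ne_zero (by omega)) (qInt_ne_zero hq hodd)
    (projective_tens (hq.ne_zero (by omega)) (by omega))
    (fun i r h _ => projective_of_comp_eq_id i r h) hab ha hb

theorem symAlt_hom_twist_eq_zero {a b : ℕ} (hab : a + b ≤ ℓ) (ha : a < ℓ) (hb : b < ℓ)
    (f : (symAltSub K q ℓ a b).functor ⟶ twist hq hodd hℓ) : f = 0 :=
  symAlt_induction (P := fun F => ∀ f : F ⟶ twist hq hodd hℓ, f = 0) (hq.ne_zero (by omega))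
    (qInt_ne_zero hq hodd) (tens_hom_twist_eq_zero hq hodd hℓ)
    (fun i r h hG f => by
      rw [← Category.id_comp f, ← h, Category.assoc, hG (r ≫ f), comp_zero]) hab ha hb f

end TwistSequences
end QPoly

/-! ### A category as a summand of a direct sum of categories -/

namespace CatFamily
section Single
variable {J : Type w} [DecidableEq J] {C : J → Type u} [∀ i, Category.{v} (C i)] [∀ i, Abelian (C i)]

/-- The projection of the direct sum of categories to a summand. -/
def component (i : J) : DirectSumCat C ⥤ C i where
  obj X := X.obj i
  map f := f.hom i
  map_id _ := rfl
  map_comp _ _ := rfl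

/-- The object `single i X` is `X` in component `i`. -/
noncomputable def singleIso (i : J) (X : C i) : (single i X).obj i ≅ X :=
  eqToIso (single_obj_self i X)

/-- The morphism with a given component in degree `i` and zero in the other degrees. -/
def homOfComponent (i : J) {X Y : DirectSumCat C} (f : X.obj i ⟶ Y.obj i) : X ⟶ Y :=
  ⟨Function.update (β := fun j => X.obj j ⟶ Y.obj j) (fun _ => 0) i f⟩

theorem homOfComponent_hom (i : J) {X Y : DirectSumCat C} (f : X.obj i ⟶ Y.obj i) :
    (homOfComponent i f).hom i = f :=
  Function.update_self (β := fun j => X.obj j ⟶ Y.obj j) i f fun _ => 0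

theorem isZero_single {i j : J} (h : j ≠ i) (X : C i) : IsZero ((single i X).obj j) := by
  rw [single_obj_of_ne h]
  exact isZero_zero _

theorem hom_ext_of_single (i : J) {X : C i} {Y : DirectSumCat C} {f g : single i X ⟶ Y}
    (h : f.hom i = g.hom i) : f = g := by
  ext j
  by_cases hj : j = i
  · subst hj; exact h
  · exact (isZero_single hj X).eq_of_src _ _

theorem hom_ext_to_single (i : J) {X : C i} {Y : DirectSumCat C} {f g : Y ⟶ single i X}
    (h : f.hom i = g.hom i) : f = g := by
  ext j
  by_cases hj : j = i
  · subst hj; exact h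
  · exact (isZero_single hj X).eq_of_tgt _ _

/-- The inclusion of a summand into the direct sum of categories. -/
noncomputable def singleFunctor (i : J) : C i ⥤ DirectSumCat C where
  obj X := single i X
  map {X Y} f := homOfComponent i ((singleIso i X).hom ≫ f ≫ (singleIso i Y).inv)
  map_id X := hom_ext_of_single i (by
    rw [homOfComponent_hom, Category.id_comp, Iso.hom_inv_id]; rfl)
  map_comp {X Y Z} f g := hom_ext_of_single i (by
    rw [homOfComponent_hom]
    change _ = (homOfComponent i _).hom i ≫ (homOfComponent i _).hom i
    rw [homOfComponent_hom, homOfComponent_hom]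
    simp)

theorem singleFunctor_map_hom (i : J) {X Y : C i} (f : X ⟶ Y) :
    ((singleFunctor (C := C) i).map f).hom i = (singleIso i X).hom ≫ f ≫ (singleIso i Y).inv :=
  homOfComponent_hom i _

theorem homOfComponent_comp_left (i : J) {X' X : C i} {Y : DirectSumCat C} (f : X' ⟶ X)
    (g : X ⟶ Y.obj i) : homOfComponent (X := single i X') i ((singleIso i X').hom ≫ f ≫ g) =
      (singleFunctor i).map f ≫ homOfComponent (X := single i X) i ((singleIso i X).hom ≫ g) :=
  hom_ext_of_single i (by
    refine (homOfComponent_hom i _).trans (Eq.trans ?_ (congrArg₂ (· ≫ ·)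
      (singleFunctor_map_hom i f) (homOfComponent_hom i _)).symm)
    have h : ∀ {A S : C i} (a : A ⟶ X') (e : S ≅ X),
      a ≫ f ≫ g = (a ≫ f ≫ e.inv) ≫ e.hom ≫ g := fun a e => by simp
    exact h _ _)

theorem homOfComponent_comp_right (i : J) {X : DirectSumCat C} {Y Y' : C i} (f : X.obj i ⟶ Y)
    (g : Y ⟶ Y') : homOfComponent (Y := single i Y') i ((f ≫ g) ≫ (singleIso i Y').inv) =
      homOfComponent (Y := single i Y) i (f ≫ (singleIso i Y).inv) ≫ (singleFunctor i).map g :=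
  hom_ext_to_single i (by
    refine (homOfComponent_hom i _).trans (Eq.trans ?_ (congrArg₂ (· ≫ ·)
      (homOfComponent_hom i _) (singleFunctor_map_hom i g)).symm)
    have h : ∀ {A S : C i} (c : Y' ⟶ A) (e : S ≅ Y),
      (f ≫ g) ≫ c = (f ≫ e.inv) ≫ e.hom ≫ g ≫ c := fun c e => by simp
    exact h _ _)

/-- Morphisms out of `single i X` are the morphisms out of `X`. -/
noncomputable def singleHomEquiv (i : J) (X : C i) (Y : DirectSumCat C) :
    (single i X ⟶ Y) ≃ (X ⟶ Y.obj i) where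
  toFun f := (singleIso i X).inv ≫ f.hom i
  invFun f := homOfComponent i ((singleIso i X).hom ≫ f)
  left_inv f := hom_ext_of_single i (by rw [homOfComponent_hom, Iso.hom_inv_id_assoc])
  right_inv f := by
    dsimp only
    rw [homOfComponent_hom, Iso.inv_hom_id_assoc]

/-- Morphisms into `single i Y` are the morphisms into `Y`. -/
noncomputable def homSingleEquiv (i : J) (X : DirectSumCat C) (Y : C i) :
    (X.obj i ⟶ Y) ≃ (X ⟶ single i Y) where
  toFun f := homOfComponent i (f ≫ (singleIso i Y).inv)
  invFun f := f.hom i ≫ (singleIso i Y).hom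
  left_inv f := by
    dsimp only
    rw [homOfComponent_hom, Category.assoc, Iso.inv_hom_id, Category.comp_id]
  right_inv f := hom_ext_to_single i (by
    rw [homOfComponent_hom, Category.assoc, Iso.hom_inv_id, Category.comp_id])

/-- The inclusion of a summand is left adjoint to the projection. -/
noncomputable def singleAdj (i : J) : singleFunctor (C := C) i ⊣ component i :=
  Adjunction.mkOfHomEquiv
    { homEquiv := singleHomEquiv i
      homEquiv_naturality_left_symm := fun f g => homOfComponent_comp_left i f g
      homEquiv_naturality_right := fun _ _ => (Category.assoc _ _ _).symm }

/-- The inclusion of a summand is right adjoint to the projection. -/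
noncomputable def componentAdj (i : J) : component (C := C) i ⊣ singleFunctor i :=
  Adjunction.mkOfHomEquiv
    { homEquiv := homSingleEquiv i
      homEquiv_naturality_left_symm := fun _ _ => Category.assoc _ _ _
      homEquiv_naturality_right := fun f g => homOfComponent_comp_right i f g }

instance (i : J) : (singleFunctor (C := C) i).IsLeftAdjoint := (singleAdj i).isLeftAdjoint
instance (i : J) : (singleFunctor (C := C) i).IsRightAdjoint := (componentAdj i).isRightAdjoint

instance (i : J) : (component (C := C) i).IsLeftAdjoint := (componentAdj i).isLeftAdjoint

instance (i : J) : (singleFunctor (C := C) i).Additive := Functor.additive_of_preserves_binary_products _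

instance (i : J) : PreservesFiniteLimits (singleFunctor (C := C) i) := inferInstance
instance (i : J) : PreservesFiniteColimits (singleFunctor (C := C) i) := inferInstance

end Single
end CatFamily

namespace QPoly
open CatFamily
theorem IsSES.map {C D : Type*} [Category* C] [Abelian C] [Category* D] [Abelian D] (F : C ⥤ D)
    [F.Additive] [PreservesFiniteLimits F] [PreservesFiniteColimits F] {X Y Z : C} (h : IsSES X Y Z) :
    IsSES (F.obj X) (F.obj Y) (F.obj Z) := by
  obtain ⟨f, g, w, h⟩ := h
  exact ⟨F.map f, F.map g, _, h.map_of_exact F⟩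

theorem projective_single {J : Type w} [DecidableEq J] {C : J → Type u} [∀ i, Category.{v} (C i)]
    [∀ i, Abelian (C i)] (i : J) (P : C i) (hP : Projective P) : Projective (single i P) :=
  (singleAdj i).map_projective P hP

theorem single_hom_eq_zero {J : Type w} [DecidableEq J] {C : J → Type u} [∀ i, Category.{v} (C i)]
    [∀ i, Abelian (C i)] (i : J) {P L : C i} (h : ∀ f : P ⟶ L, f = 0) (f : single i P ⟶ single i L) :
    f = 0 := by
  refine hom_ext_of_single i ?_
  have := h ((singleIso i P).inv ≫ f.hom i ≫ (singleIso i L).hom)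
  rw [← cancel_epi (singleIso i P).inv, ← cancel_mono (singleIso i L).hom]
  rw [Category.assoc, this]
  change 0 = (_ ≫ 0) ≫ _
  simp

theorem single_end {J : Type w} [DecidableEq J] {C : J → Type u} [∀ i, Category.{v} (C i)]
    [∀ i, Abelian (C i)] {R : Type t} [Ring R] [∀ i, Linear R (C i)] (i : J) {L : C i}
    (h : ∀ f : L ⟶ L, ∃ c : R, f = c • 𝟙 L) (f : single i L ⟶ single i L) :
    ∃ c : R, f = c • 𝟙 (single i L) := by
  obtain ⟨c, hc⟩ := h ((singleIso i L).inv ≫ f.hom i ≫ (singleIso i L).hom)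
  refine ⟨c, hom_ext_of_single i ?_⟩
  rw [Iso.inv_comp_eq, ← Iso.eq_comp_inv, Linear.comp_smul, Category.comp_id, Linear.smul_comp,
    Iso.hom_inv_id] at hc
  exact hc

theorem single_id_ne_zero {J : Type w} [DecidableEq J] {C : J → Type u} [∀ i, Category.{v} (C i)]
    [∀ i, Abelian (C i)] (i : J) {L : C i} (h : 𝟙 L ≠ 0) : 𝟙 (single i L) ≠ 0 := fun h' => by
  have h1 : 𝟙 ((single i L).obj i) = 0 := congrArg (fun f : single i L ⟶ single i L => f.hom i) h'
  exact h ((IsZero.iff_id_eq_zero _).1 (((IsZero.iff_id_eq_zero _).2 h1).of_iso (singleIso i L).symm))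

end QPoly

namespace QPoly
open Abelian

/-! ### Dimension shifting -/

section Shift
variable {C : Type u} [Category.{v} C] [Abelian C] [HasExt.{w} C] {A B D L : C}

theorem IsSES.subsingleton_ext (h : IsSES A B D) {n : ℕ} (hA : Subsingleton (Ext A L n))
    (hB : Subsingleton (Ext B L (n + 1))) : Subsingleton (Ext D L (n + 1)) := by
  obtain ⟨f, g, w, h⟩ := h
  refine subsingleton_of_forall_eq 0 fun x => ?_
  obtain ⟨y, rfl⟩ := Ext.contravariant_sequence_exact₃ h L x (Subsingleton.elim _ _) (add_comm 1 n)
  rw [Subsingleton.elim y 0, Ext.comp_zero]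

theorem IsSES.subsingleton_ext_zero (h : IsSES A B D) (hB : Subsingleton (Ext B L 0)) :
    Subsingleton (Ext D L 0) := by
  obtain ⟨f, g, w, h⟩ := h
  have := h.epi_g
  refine subsingleton_of_forall_eq 0 fun x => Ext.precomp_mk₀_injective_of_epi L g ?_
  exact Subsingleton.elim _ _

theorem bijective_extClass_comp {S : ShortComplex C} (hS : S.ShortExact) {n m : ℕ} (hm : 1 + n = m)
    (h : Subsingleton (Ext S.X₂ L n)) (h' : Subsingleton (Ext S.X₂ L m)) :
    Function.Bijective fun x : Ext S.X₁ L n => hS.extClass.comp x hm := by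
  constructor
  · refine (injective_iff_map_eq_zero (hS.extClass.precomp L hm)).2 fun x hx => ?_
    obtain ⟨y, rfl⟩ := Ext.contravariant_sequence_exact₁ hS L x hm hx
    rw [Subsingleton.elim y 0, Ext.comp_zero]
  · exact fun x => Ext.contravariant_sequence_exact₃ hS L x (Subsingleton.elim _ _) hm

theorem bijective_mk₀_comp {S : ShortComplex C} (hS : S.ShortExact) {n : ℕ}
    (h : Subsingleton (Ext S.X₁ L n)) (h' : ∀ m, m + 1 = n → Subsingleton (Ext S.X₁ L m)) :
    Function.Bijective fun x : Ext S.X₃ L n => (Ext.mk₀ S.g).comp x (zero_add n) := by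
  constructor
  · rcases n with _ | n
    · have := hS.epi_g
      exact Ext.precomp_mk₀_injective_of_epi L S.g
    · refine (injective_iff_map_eq_zero ((Ext.mk₀ S.g).precomp L (zero_add _))).2 fun x hx => ?_
      obtain ⟨y, rfl⟩ := Ext.contravariant_sequence_exact₃ hS L x hx (add_comm 1 n)
      have := h' n rfl
      rw [Subsingleton.elim y 0, Ext.comp_zero]
  · exact fun x => Ext.contravariant_sequence_exact₂ hS L x (Subsingleton.elim _ _)

/-- A self-extension of degree two, composed from two short exact sequences and a morphism, by which all
sufficiently low self-extensions of `L` are periodic. -/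
theorem exists_periodicity {D₁ P₀ P₁ N D₂ L : C} (s₀ : IsSES D₁ P₀ L) (s₁ : IsSES N P₁ D₁)
    (s₂ : IsSES D₂ N L) {M : ℕ} (h₀ : ∀ n, Subsingleton (Ext P₀ L (n + 1)))
    (h₁ : ∀ n, Subsingleton (Ext P₁ L n)) (h₂ : ∀ n, n ≠ M → Subsingleton (Ext D₂ L n)) :
    ∃ e : Ext L L 2, ∀ n < M, Function.Bijective fun x : Ext L L n => e.comp x (add_comm 2 n) := by
  obtain ⟨f₀, g₀, w₀, s₀⟩ := s₀
  obtain ⟨f₁, g₁, w₁, s₁⟩ := s₁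
  obtain ⟨f₂, g₂, w₂, s₂⟩ := s₂
  refine ⟨s₀.extClass.comp (s₁.extClass.comp (Ext.mk₀ g₂) (add_zero 1)) (show 1 + 1 = 2 by rfl),
    fun n hn => ?_⟩
  have b₂ := bijective_mk₀_comp (L := L) s₂ (n := n) (h₂ n hn.ne) fun m hm => h₂ m (by omega)
  have b₁ := bijective_extClass_comp (L := L) s₁ (add_comm 1 n) (h₁ n) (h₁ (n + 1))
  have b₀ := bijective_extClass_comp (L := L) s₀ (add_comm 1 (n + 1)) (h₀ n) (h₀ (n + 1))
  convert b₀.comp (b₁.comp b₂) using 1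
  funext x
  simp only [Function.comp]
  rw [Ext.comp_assoc _ _ _ _ (show 1 + n = n + 1 by omega) (by omega),
    Ext.comp_assoc _ _ _ _ (zero_add n) (by omega)]

end Shift

/-! ### The Yoneda algebra of an object with periodic self-extensions -/

section Yoneda
variable {K : Type t} [Field K] {C : Type u} [Category.{v} C] [Abelian C] [Linear K C] [HasExt.{w} C]
  {L : C} (e : Ext L L 2)

/-- The Yoneda powers of a class in `Ext^2(L, L)`. -/
noncomputable def extPow : ∀ i : ℕ, Ext L L (2 * i)
  | 0 => Ext.mk₀ (𝟙 L)
  | i + 1 => e.comp (extPow i) (by omega)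

theorem of_pow (i : ℕ) : (DirectSum.of (fun n => Ext L L n) 2 e) ^ i =
    DirectSum.of (fun n => Ext L L n) (2 * i) (extPow e i) := by
  induction i with
  | zero => rfl
  | succ i ih =>
    rw [pow_succ, ih, DirectSum.of_mul_of]
    rfl

/-- In the range of the periodicity the powers of `e` span the self-extensions of even degree. -/
theorem exists_smul_extPow (hEnd : ∀ f : L ⟶ L, ∃ c : K, f = c • 𝟙 L) (hid : 𝟙 L ≠ 0) {M : ℕ}
    (he : ∀ n < M, Function.Bijective fun x : Ext L L n => e.comp x (add_comm 2 n)) (i : ℕ)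
    (hi : 2 * i < M + 2) : extPow e i ≠ 0 ∧ ∀ x : Ext L L (2 * i), ∃ c : K, x = c • extPow e i := by
  induction i with
  | zero =>
    refine ⟨fun h => hid ((Ext.mk₀_bijective L L).1 (h.trans (Ext.mk₀_zero L L).symm)), fun x => ?_⟩
    obtain ⟨f, rfl⟩ := (Ext.mk₀_bijective L L).2 x
    obtain ⟨c, rfl⟩ := hEnd f
    exact ⟨c, Ext.mk₀_smul _ _⟩
  | succ i ih =>
    have hb := he (2 * i) (by omega)
    obtain ⟨h1, h2⟩ := ih (by omega)
    refine ⟨fun h => h1 (hb.1 (h.trans (Ext.comp_zero _ _ _ _ _).symm)), fun x => ?_⟩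
    obtain ⟨y, rfl⟩ := hb.2 x
    obtain ⟨c, rfl⟩ := h2 y
    exact ⟨c, Ext.comp_smul _ _ _ _⟩

theorem subsingleton_ext_odd (h1 : Subsingleton (Ext L L 1)) {M : ℕ}
    (he : ∀ n < M, Function.Bijective fun x : Ext L L n => e.comp x (add_comm 2 n)) (i : ℕ)
    (hi : 2 * i < M + 1) : Subsingleton (Ext L L (2 * i + 1)) := by
  induction i with
  | zero => exact h1
  | succ i ih =>
    have := ih (by omega)
    exact (he (2 * i + 1) (by omega)).2.subsingleton

variable {ℓ : ℕ} (hpow : ∀ i < ℓ, extPow e i ≠ 0 ∧ ∀ x : Ext L L (2 * i), ∃ c : K, x = c • extPow e i)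
  (hzero : ∀ j, (∀ i < ℓ, j ≠ 2 * i) → Subsingleton (Ext L L j))
include hpow

theorem nonempty_ext_equiv {i : ℕ} (hi : i < ℓ) : Nonempty (Ext L L (2 * i) ≃ₗ[K] K) := by
  obtain ⟨h1, h2⟩ := hpow i hi
  refine ⟨(LinearEquiv.ofBijective (LinearMap.toSpanSingleton K _ (extPow e i)) ⟨?_, ?_⟩).symm⟩
  · exact smul_left_injective K h1
  · exact fun x => (h2 x).imp fun c hc => hc.symm

include hzero

/-- If the powers of a class `e` of degree two span the self-extensions of `L`, and exactly the first `ℓ`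
of them are nonzero, then the Yoneda algebra is a truncated polynomial algebra. -/
theorem exists_yoneda_equiv :
    ∃ φ : (Polynomial K ⧸ Ideal.span {(Polynomial.X : Polynomial K) ^ ℓ}) ≃ₐ[K] YonedaAlgebra L,
      φ (Ideal.Quotient.mk _ Polynomial.X) = DirectSum.of (fun n => Ext L L n) 2 e := by
  set E : YonedaAlgebra L := DirectSum.of (fun n => Ext L L n) 2 e with hE
  let ψ : Polynomial K →ₐ[K] YonedaAlgebra L := Polynomial.aeval E
  have hsm : ∀ (c : K) (i : ℕ), DirectSum.of (fun n => Ext L L n) (2 * i) (c • extPow e i) =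
      c • E ^ i := fun c i => by
    rw [hE, of_pow]
    exact map_smul (DirectSum.lof K ℕ (fun n => Ext L L n) (2 * i)) c (extPow e i)
  have hsurj : Function.Surjective ψ := by
    intro y
    induction y using DirectSum.induction_on with
    | zero => exact ⟨0, map_zero ψ⟩
    | of n x =>
      by_cases h : ∃ i < ℓ, n = 2 * i
      · obtain ⟨i, hi, rfl⟩ := h
        obtain ⟨c, rfl⟩ := (hpow i hi).2 x
        refine ⟨c • Polynomial.X ^ i, ?_⟩
        rw [hsm, map_smul, map_pow, Polynomial.aeval_X]
      · push Not at h
        have := hzero n h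
        exact ⟨0, by rw [map_zero, Subsingleton.elim x 0, map_zero]⟩
    | add x y hx hy =>
      obtain ⟨a, rfl⟩ := hx
      obtain ⟨b, rfl⟩ := hy
      exact ⟨a + b, map_add ψ a b⟩
  have hEℓ : E ^ ℓ = 0 := by
    have := hzero (2 * ℓ) fun i hi => by omega
    rw [hE, of_pow, Subsingleton.elim (extPow e ℓ) 0, map_zero]
  have hker : RingHom.ker ψ = Ideal.span {(Polynomial.X : Polynomial K) ^ ℓ} := by
    refine le_antisymm (fun p hp => ?_) ?_
    · rw [Ideal.mem_span_singleton, Polynomial.X_pow_dvd_iff]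
      intro i hi
      have h0 : ψ p = 0 := hp
      have h1 : ψ p = ∑ j ∈ Finset.range (p.natDegree + 1), p.coeff j • E ^ j :=
        Polynomial.aeval_eq_sum_range E
      -- the component of degree `2 * i` of the value at `e` is a multiple of the power of `e`
      have h2 : (ψ p) (2 * i) = p.coeff i • extPow e i := by
        rw [h1, DFinsupp.finsetSum_apply]
        rw [Finset.sum_eq_single i]
        · rw [← hsm]; exact DirectSum.of_eq_same _ _
        · intro j _ hj
          rw [← hsm]; exact DirectSum.of_eq_of_ne _ _ _ (by omega)
        · intro hi'
          rw [Polynomial.coeff_eq_zero_of_natDegree_lt (by simpa using hi'), zero_smul]; rfl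
      rw [h0] at h2
      exact (smul_eq_zero.1 h2.symm).resolve_right (hpow i hi).1
    · rw [Ideal.span_singleton_le_iff_mem]
      change ψ (Polynomial.X ^ ℓ) = 0
      rw [map_pow, Polynomial.aeval_X, hEℓ]
  exact ⟨(Ideal.quotientEquivAlgOfEq K hker.symm).trans (Ideal.quotientKerAlgEquivOfSurjective hsurj),
    Polynomial.aeval_X E⟩

end Yoneda
end QPoly

namespace QPoly
open Abelian

/-! ### Self-extensions of the quantum Frobenius twist -/

section TwistExt
variable {K : Type u} [Field K] {q : K} {ℓ : ℕ}

/-- A subfunctor of the tensor power of degree `ℓ`, as a quantum polynomial functor. -/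
noncomputable abbrev TensSub.qf (A : TensSub K q ℓ) : QF K q :=
  (CatFamily.singleFunctor (C := fun d : ℕ => HQF K q d) ℓ).obj A.functor

theorem isSES_single {F G H : HQF K q ℓ} (h : IsSES F G H) :
    IsSES (CatFamily.single (C := fun d : ℕ => HQF K q d) ℓ F)
      (CatFamily.single (C := fun d : ℕ => HQF K q d) ℓ G)
      (CatFamily.single (C := fun d : ℕ => HQF K q d) ℓ H) :=
  h.map (CatFamily.singleFunctor (C := fun d : ℕ => HQF K q d) ℓ)

theorem isZero_of_space {A : TensSub K q ℓ} (h : ∀ n, ∀ w ∈ A.space n, w = 0) : IsZero A.functor :=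
  (IsZero.iff_id_eq_zero _).2 (hqf_hom_ext fun X x => Subtype.ext (h X.n x.1 x.2))

variable (hq : IsPrimitiveRoot q ℓ) (hodd : Odd ℓ) (hℓ : 1 < ℓ)

local notation "L" => frobeniusTwistI K hq hodd hℓ

theorem subsingleton_ext_symAlt_succ {a b : ℕ} (hab : a + b = ℓ) (hb : b < ℓ) (n : ℕ) :
    Subsingleton (Ext (symAltSub K q ℓ a b).qf L (n + 1)) := by
  have : Projective (symAltSub K q ℓ a b).functor := by
    rcases (show a < ℓ ∨ a = ℓ ∧ b = 0 by omega) with ha | ⟨rfl, rfl⟩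
    · exact projective_symAlt hq hodd hab.le ha hb
    · exact projective_sym
  have := projective_single (C := fun d : ℕ => HQF K q d) ℓ _ this
  exact @Ext.subsingleton_of_projective _ _ _ _ _ _ this n

theorem subsingleton_ext_symAlt {a b : ℕ} (hab : a + b = ℓ) (ha : a < ℓ) (hb : b < ℓ) (n : ℕ) :
    Subsingleton (Ext (symAltSub K q ℓ a b).qf L n) := by
  rcases n with _ | n
  · refine Ext.addEquiv₀.subsingleton_congr.2 (subsingleton_of_forall_eq 0 fun f => ?_)
    exact single_hom_eq_zero (C := fun d : ℕ => HQF K q d) ℓ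
      (symAlt_hom_twist_eq_zero hq hodd hℓ hab.le ha hb) f
  · exact subsingleton_ext_symAlt_succ hq hodd hℓ hab hb n

/-- Dimension shifting along the Koszul complex. -/
theorem subsingleton_ext_koszulCycles {a b : ℕ} (hab : a + b = ℓ) (n : ℕ) (hn : n + a + 1 ≠ ℓ) :
    Subsingleton (Ext (koszulCycles K q ℓ a b).qf L n) := by
  induction b generalizing a n with
  | zero =>
    have hz : IsZero (koszulCycles K q ℓ a 0).qf := Functor.map_isZero _ (isZero_of_space
      fun n w hw => hw.2 (by omega))
    refine subsingleton_of_forall_eq 0 fun x => ?_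
    rw [← Ext.mk₀_id_comp x, hz.eq_of_src (𝟙 _) 0, Ext.mk₀_zero, Ext.zero_comp]
  | succ b ih =>
    have s := isSES_single (isSES_koszul (hq.ne_zero (by omega)) (sq_add_one_ne_zero hq hodd hℓ)
      (qInt_ne_zero hq hodd) (a := a) (b := b) (by omega) hℓ)
    rcases n with _ | n
    · exact s.subsingleton_ext_zero
        (subsingleton_ext_symAlt hq hodd hℓ (by omega) (by omega) (by omega) 0)
    · exact s.subsingleton_ext (ih (by omega) n (by omega))
        (subsingleton_ext_symAlt_succ hq hodd hℓ (by omega) (by omega) n)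

/-- Dimension shifting along the de Rham complex. -/
theorem subsingleton_ext_deRhamImage {a b : ℕ} (hab : a + b + 2 = ℓ) (n : ℕ) (hn : n + 1 ≠ ℓ + a) :
    Subsingleton (Ext (deRhamImage a (symAltSub K q ℓ a (b + 2))).qf L n) := by
  induction a generalizing b n with
  | zero =>
    rw [deRhamImage_zero, ← koszulCycles_zero]
    exact subsingleton_ext_koszulCycles hq hodd hℓ (by omega) n (by omega)
  | succ a ih =>
    have s := isSES_single (isSES_deRhamImage (hq.ne_zero (by omega)) (sq_add_one_ne_zero hq hodd hℓ)
      (qInt_ne_zero hq hodd) (qInt_self hq hodd hℓ) (a := a) (b := b) (by omega))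
    have hP := subsingleton_ext_symAlt hq hodd hℓ (a := a + 1) (b := b + 2) (by omega) (by omega)
      (by omega)
    rcases n with _ | n
    · exact s.subsingleton_ext_zero (hP 0)
    · exact s.subsingleton_ext (ih (by omega) n (by omega)) (hP (n + 1))

/-- Dimension shifting along the complex of Koszul cycles with the de Rham differential. -/
theorem subsingleton_ext_deRhamImage_cycles {a b : ℕ} (hab : a + b + 2 = ℓ) (n : ℕ)
    (hn : ℓ + a < n + 1) :
    Subsingleton (Ext (deRhamImage a (koszulCycles K q ℓ a (b + 2))).qf L n) := by
  induction a generalizing b n with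
  | zero =>
    rw [deRhamImage_zero]
    exact subsingleton_ext_koszulCycles hq hodd hℓ (by omega) n (by omega)
  | succ a ih =>
    have s := isSES_single (isSES_deRhamImage_cycles (hq.ne_zero (by omega))
      (sq_add_one_ne_zero hq hodd hℓ) (qInt_ne_zero hq hodd) (qInt_self hq hodd hℓ) (a := a) (b := b)
      (by omega))
    obtain ⟨n, rfl⟩ : ∃ m, n = m + 1 := ⟨n - 1, by omega⟩
    exact s.subsingleton_ext (ih (by omega) n (by omega))
      (subsingleton_ext_koszulCycles hq hodd hℓ (by omega) _ (by omega))

end TwistExt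
end QPoly

open QPoly in
theorem mainTheorem2 (K : Type u) [Field K] (q : K) (ℓ : ℕ) (hℓ : 1 < ℓ) (hodd : Odd ℓ)
    (hq : IsPrimitiveRoot q ℓ) :
    (∃ (e : Abelian.Ext (QPoly.frobeniusTwistI K hq hodd hℓ)
          (QPoly.frobeniusTwistI K hq hodd hℓ) 2)
        (φ : (Polynomial K ⧸ Ideal.span {(Polynomial.X : Polynomial K) ^ ℓ}) ≃ₐ[K]
          YonedaAlgebra (QPoly.frobeniusTwistI K hq hodd hℓ)),
        φ (Ideal.Quotient.mk _ Polynomial.X) =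
          DirectSum.of (fun n : ℕ => Abelian.Ext (QPoly.frobeniusTwistI K hq hodd hℓ)
            (QPoly.frobeniusTwistI K hq hodd hℓ) n) 2 e) ∧
      (∀ i < ℓ, Nonempty (Abelian.Ext (QPoly.frobeniusTwistI K hq hodd hℓ)
        (QPoly.frobeniusTwistI K hq hodd hℓ) (2 * i) ≃ₗ[K] K)) ∧
      ∀ j : ℕ, (∀ i < ℓ, j ≠ 2 * i) →
        Subsingleton (Abelian.Ext (QPoly.frobeniusTwistI K hq hodd hℓ)
          (QPoly.frobeniusTwistI K hq hodd hℓ) j) := by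
  obtain ⟨a, ha⟩ : ∃ a, a + 2 = ℓ := ⟨ℓ - 2, by omega⟩
  have hP₁ := subsingleton_ext_symAlt hq hodd hℓ (a := a + 1) (b := 1) (by omega) (by omega) (by omega)
  have s₀ := isSES_single (isSES_sym_twist hq hodd hℓ ha)
  have s₁ := isSES_single (isSES_deRhamKernel (K := K) (q := q) (ℓ := ℓ) a)
  have s₂ := isSES_single (isSES_deRhamKernel_twist hq hodd hℓ ha)
  have hP₀ := subsingleton_ext_symAlt_succ hq hodd hℓ (a := ℓ) (b := 0) (by omega) (by omega)
  -- `Γ^ℓ`, `Γ^{ℓ-1} ⊗ Λ^1` and the de Rham cycles in the latter connect the twist with itself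
  obtain ⟨e, he⟩ := exists_periodicity s₀ s₁ s₂ (M := ℓ + a - 1) hP₀ hP₁
    fun n hn => subsingleton_ext_deRhamImage hq hodd hℓ (by omega) n (by omega)
  have hone := s₀.subsingleton_ext (s₁.subsingleton_ext_zero (hP₁ 0)) (hP₀ 0)
  have hpow := exists_smul_extPow e
    (single_end (C := fun d : ℕ => HQF K q d) (R := K) ℓ (end_twist hq hodd hℓ))
    (single_id_ne_zero (C := fun d : ℕ => HQF K q d) ℓ (id_twist_ne_zero hq hodd hℓ)) he
  have hzero : ∀ j : ℕ, (∀ i < ℓ, j ≠ 2 * i) → Subsingleton (Abelian.Ext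
      (frobeniusTwistI K hq hodd hℓ) (frobeniusTwistI K hq hodd hℓ) j) := fun j hj => by
    -- above degree `ℓ + a = 2 * ℓ - 2` the Koszul and de Rham resolution is exhausted
    rcases lt_or_ge (ℓ + a) j with h | h
    · obtain ⟨n, rfl⟩ : ∃ m, j = m + 1 := ⟨j - 1, by omega⟩
      refine s₀.subsingleton_ext ?_ (hP₀ n)
      rw [deRhamImage_last (hq.ne_zero (by omega)) (sq_add_one_ne_zero hq hodd hℓ)
        (qInt_ne_zero hq hodd) (qInt_self hq hodd hℓ) ha]
      exact subsingleton_ext_deRhamImage_cycles hq hodd hℓ (b := 0) (by omega) n (by omega)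
    · obtain ⟨i, rfl | rfl⟩ := j.even_or_odd'
      · exact absurd rfl (hj i (by omega))
      · exact subsingleton_ext_odd e hone he i (by omega)
  have hpow' := fun i (hi : i < ℓ) => hpow i (by omega)
  obtain ⟨φ, hφ⟩ := exists_yoneda_equiv e hpow' hzero
  exact ⟨⟨e, φ, hφ⟩, fun i hi => nonempty_ext_equiv e hpow' hi, hzero⟩
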